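/- Given a real $Y>1$, call a zero $\rho_0=\beta_0+i\gamma_0$ of the Riemann zeta function $\zeta(s)$ *$Y$-half-isolated* if every zero $\rho'=\beta'+i\gamma'$ of $\zeta(s)$ with $|\rho'-\rho_0|\le(\log|\gamma_0|)^2$ satisfies at least one of the following: (1) $|\beta'-\beta_0|\le \dfrac{1}{10\log Y}$ and $\gamma'\ge\gamma_0$; (2) $\beta'\le \beta_0-\dfrac{(\log\log|\gamma_0|)^2}{\log Y}$. Call a zero $\rho_0=\beta_0+i\gamma_0$ of $\zeta(s)$ *half-isolated* if it is $Y$-half-isolated for some $Y>1$ satisfying \[ (\log\log|\gamma_0|)^3\le\log Y\le\frac{\log|\gamma_0|}{\log\log|\gamma_0|}. \] Then for every sufficiently large real $T$ and every real $\sigma$, the number of (distinct) half-isolated zeros $\rho_0=\beta+i\gamma$ of $\zeta(s)$ such that $\beta\ge\sigma$ and $\gamma\in[T,2T]$ is finite and at most \[ T^{2(1-\sigma)+o(1)}, \] where $o(1)$ denotes a quantity depending only on $T$ (so uniform in $\sigma$) that tends to $0$ as $T\to\infty$. -/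

import Mathlib

/-- For a real `Y > 1`, a zero `ρ₀ = β₀ + iγ₀` of the Riemann zeta function is
`Y`-half-isolated if every zero `ρ' = β' + iγ'` of zeta with `|ρ' - ρ₀| ≤ (log |γ₀|)²` either has
similar real part and imaginary part at least `γ₀`, or has noticeably smaller real part. -/
def IsYHalfIsolatedZero (Y : ℝ) (ρ₀ : ℂ) : Prop :=
  1 < Y ∧ riemannZeta ρ₀ = 0 ∧
    ∀ ρ' : ℂ, riemannZeta ρ' = 0 → ‖ρ' - ρ₀‖ ≤ (Real.log |ρ₀.im|) ^ 2 →
      (|ρ'.re - ρ₀.re| ≤ 1 / (10 * Real.log Y) ∧ ρ₀.im ≤ ρ'.im) ∨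
        ρ'.re ≤ ρ₀.re - (Real.log (Real.log |ρ₀.im|)) ^ 2 / Real.log Y

/-- A zero `ρ₀ = β₀ + iγ₀` of the Riemann zeta function is half-isolated if it is
`Y`-half-isolated for some `Y` with
`(log log |γ₀|)³ ≤ log Y ≤ log |γ₀| / log log |γ₀|`. -/
def IsHalfIsolatedZero (ρ₀ : ℂ) : Prop :=
  ∃ Y : ℝ, (Real.log (Real.log |ρ₀.im|)) ^ 3 ≤ Real.log Y ∧
    Real.log Y ≤ Real.log |ρ₀.im| / Real.log (Real.log |ρ₀.im|) ∧
    IsYHalfIsolatedZero Y ρ₀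

/-- The set of half-isolated zeros `β + iγ` of the Riemann zeta function with `β ≥ σ` and
`γ ∈ [T, 2T]`. -/
def halfIsolatedZeros (σ T : ℝ) : Set ℂ :=
  {ρ : ℂ | IsHalfIsolatedZero ρ ∧ σ ≤ ρ.re ∧ ρ.im ∈ Set.Icc T (2 * T)}

open Complex Filter Topology Metric MeasureTheory

/-! Write L = log γ₀, ℓ = log Y, M = log L, and view a half-isolated zero ρ₀ from the point s₀ = ρ₀
+ η/ℓ - ip, where η = √M and p = 4(n+1)η/ℓ with n about 6M. The zeros of the first kind, ρ₀
included, lie almost vertically above s₀ at height at least p, so the numbers (i(s₀ - ρ))^{-(n+1)}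
all have positive real part and cannot cancel. The zeros of the second kind are at distance at least
M²/ℓ, far more than p, and the power n + 1 makes them negligible. Landau's local formula therefore
forces the n-th derivative of ζ'/ζ at s₀ to have size at least about n! p^{-(n+1)}
(`le_norm_sum_inv_pow`, `norm_iteratedDeriv_logDeriv_ge`). This is Turán's power sum method, with
positivity in place of Turán's inequality.

On the prime side, `smoothLambda u` is the series of -ζ'/ζ smoothly cut off at n ≈ e^u. To the right
of the nearby zeros it approximates -ζ'/ζ very well when u = u₂ is large, and for small u = u₁ its
n-th derivative is too small to matter; both follow by shifting contours against a Gaussian kernel.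
Some block `smoothLambda (u + 1) - smoothLambda u` with u₁ ≤ u < u₂ must then be at least e^{-εu} in
modulus at a point s close to ρ₀ with Re s ≥ Re ρ₀. The permitted range of log Y is what ensures M ≤
εu and u ≤ εL (`exists_detection_parameters`).

Such blocks are ideal for a large values estimate. As u ≤ εL, some k-th power of the block has
length T^{1+O(ε)}; as M ≤ εu, its coefficients, bounded by (log n)^k, are T^{O(ε)}. The mean value
theorem for Dirichlet polynomials then gives T^{2(1-σ)+O(ε)} points
(`exists_card_le_of_large_smoothLambda`). The points need not be separated: the sub-mean value
property over small discs is used, and the discs overlap O(log T) times because unit height contains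
O(log T) zeros. -/

/-! ### Continuation and growth of ζ to the right of Re s = 1/4. -/

lemma convex_reProdIm {s t : Set ℝ} (hs : Convex ℝ s) (ht : Convex ℝ t) : Convex ℝ (s ×ℂ t) :=
  (hs.linear_preimage Complex.reLm).inter (ht.linear_preimage Complex.imLm)

/-- The difference between the `n`-th term of the zeta series and the corresponding integral. -/
noncomputable def zetaTerm (n : ℕ) (s : ℂ) : ℂ :=
  ((n : ℂ) + 1) ^ (-s) - (((n : ℂ) + 2) ^ (1 - s) - ((n : ℂ) + 1) ^ (1 - s)) / (1 - s)

lemma norm_natCast_cpow_sub_le {a : ℝ} (ha : 1 ≤ a) {s : ℂ} (hs : 0 < s.re) {x : ℝ}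
    (hx : x ∈ Set.Icc a (a + 1)) :
    ‖(a : ℂ) ^ (-s) - (x : ℂ) ^ (-s)‖ ≤ ‖s‖ * a ^ (-s.re - 1) := by
  have hs0 : s ≠ 0 := by rintro rfl; simp at hs
  have hd : ∀ y ∈ Set.Icc a (a + 1), HasDerivWithinAt (fun y : ℝ => (y : ℂ) ^ (-s))
      (-s * (y : ℂ) ^ (-s - 1)) (Set.Icc a (a + 1)) y := by
    intro y hy
    exact (hasDerivAt_ofReal_cpow_const (by linarith [hy.1] : y ≠ 0)
      (neg_ne_zero.mpr hs0)).hasDerivWithinAt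
  have hb : ∀ y ∈ Set.Icc a (a + 1), ‖-s * (y : ℂ) ^ (-s - 1)‖ ≤ ‖s‖ * a ^ (-s.re - 1) := by
    intro y hy
    have hy0 : 0 < y := by linarith [hy.1]
    rw [norm_mul, norm_neg, norm_cpow_eq_rpow_re_of_pos hy0]
    refine mul_le_mul_of_nonneg_left ?_ (norm_nonneg _)
    simp only [sub_re, neg_re, one_re]
    exact Real.rpow_le_rpow_of_nonpos (by linarith) hy.1 (by linarith)
  have := (convex_Icc a (a + 1)).norm_image_sub_le_of_norm_hasDerivWithin_le hd hb hx
    (Set.left_mem_Icc.mpr (by linarith))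
  refine this.trans ?_
  have h1 : ‖a - x‖ ≤ 1 := by rw [Real.norm_eq_abs, abs_le]; constructor <;> linarith [hx.1, hx.2]
  have : 0 ≤ ‖s‖ * a ^ (-s.re - 1) := by positivity
  nlinarith

/-- The term is the integral of a^{-s} - y^{-s} over [a, a + 1] with a = n + 1, and the integrand is
bounded by `norm_natCast_cpow_sub_le`. The extra power of a gives convergence for Re s > 0. -/
lemma norm_zetaTerm_le (n : ℕ) {s : ℂ} (hs : 0 < s.re) (hs1 : s ≠ 1) :
    ‖zetaTerm n s‖ ≤ ‖s‖ * ((n : ℝ) + 1) ^ (-s.re - 1) := by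
  set a : ℝ := n + 1 with ha
  have ha1 : 1 ≤ a := by rw [ha]; linarith [Nat.cast_nonneg (α := ℝ) n]
  have h1s : 1 - s ≠ 0 := sub_ne_zero.mpr hs1.symm
  have hd : ∀ y ∈ Set.Icc a (a + 1),
      HasDerivWithinAt (fun y : ℝ => (y : ℂ) * (a : ℂ) ^ (-s) - (y : ℂ) ^ (1 - s) / (1 - s))
      ((a : ℂ) ^ (-s) - (y : ℂ) ^ (-s)) (Set.Icc a (a + 1)) y := by
    intro y hy
    have h2 := (hasDerivAt_ofReal_cpow_const (by linarith [hy.1] : y ≠ 0) h1s).div_const (1 - s)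
    have h3 := ((hasDerivAt_id y).ofReal_comp).mul_const ((a : ℂ) ^ (-s))
    have h4 := (h3.sub h2).hasDerivWithinAt (s := Set.Icc a (a + 1))
    refine h4.congr_deriv ?_
    rw [show (1 - s - 1 : ℂ) = -s by ring, mul_div_cancel_left₀ _ h1s]
    simp
  have := (convex_Icc a (a + 1)).norm_image_sub_le_of_norm_hasDerivWithin_le hd
    (fun y hy => norm_natCast_cpow_sub_le ha1 hs hy) (Set.left_mem_Icc.mpr (by linarith))
    (Set.right_mem_Icc.mpr (by linarith))
  have e1 : ((a + 1 : ℝ) : ℂ) = (n : ℂ) + 2 := by rw [ha]; push_cast; ring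
  have e2 : ((a : ℝ) : ℂ) = (n : ℂ) + 1 := by rw [ha]; push_cast; ring
  rw [e1, e2] at this
  simp only [add_sub_cancel_left, norm_one, mul_one] at this
  refine le_of_eq_of_le (congrArg _ ?_) this
  unfold zetaTerm
  ring

lemma natCast_add_one_ne_zero' (n : ℕ) : (n : ℂ) + 1 ≠ 0 := Nat.cast_add_one_ne_zero n

lemma natCast_add_two_ne_zero' (n : ℕ) : (n : ℂ) + 2 ≠ 0 := by
  have := Nat.cast_add_one_ne_zero (R := ℂ) (n + 1)
  push_cast at this
  rwa [add_assoc, one_add_one_eq_two] at this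

lemma differentiableAt_zetaTerm (n : ℕ) {s : ℂ} (hs1 : s ≠ 1) :
    DifferentiableAt ℂ (zetaTerm n) s := by
  have h1s : 1 - s ≠ 0 := sub_ne_zero.mpr hs1.symm
  have := natCast_add_one_ne_zero' n
  have := natCast_add_two_ne_zero' n
  unfold zetaTerm
  refine DifferentiableAt.sub ?_ (DifferentiableAt.div (DifferentiableAt.sub ?_ ?_) ?_ h1s)
  · exact (differentiableAt_id.neg).const_cpow (Or.inl ‹_›)
  · exact ((differentiableAt_const _).sub differentiableAt_id).const_cpow (Or.inl ‹_›)
  · exact ((differentiableAt_const _).sub differentiableAt_id).const_cpow (Or.inl ‹_›)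
  · exact (differentiableAt_const _).sub differentiableAt_id

/-- The subtracted integrals telescope to the integral of x^{-s} over [1, ∞), which is 1/(s - 1). -/
lemma riemannZeta_eq_tsum_zetaTerm_of_one_lt {s : ℂ} (hs : 1 < s.re) :
    riemannZeta s = 1 / (s - 1) + ∑' n, zetaTerm n s := by
  have hs1 : s ≠ 1 := by rintro rfl; simp at hs
  have h1s : 1 - s ≠ 0 := sub_ne_zero.mpr hs1.symm
  have hsum : Summable (fun n : ℕ => 1 / ((n : ℂ) + 1) ^ s) := by
    have := (Complex.summable_one_div_nat_cpow (p := s)).mpr hs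
    exact_mod_cast (summable_nat_add_iff 1).mpr this
  have htel : HasSum (fun n : ℕ => (((n : ℂ) + 2) ^ (1 - s) - ((n : ℂ) + 1) ^ (1 - s)) / (1 - s))
      (1 / (s - 1)) := by
    have hlim : Tendsto (fun n : ℕ => ((n : ℂ) + 1) ^ (1 - s)) atTop (𝓝 0) := by
      rw [tendsto_zero_iff_norm_tendsto_zero]
      have : ∀ n : ℕ, ‖((n : ℂ) + 1) ^ (1 - s)‖ = ((n : ℝ) + 1) ^ (-(s.re - 1)) := by
        intro n
        have := norm_cpow_eq_rpow_re_of_pos (x := (n : ℝ) + 1) (by positivity) (1 - s)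
        push_cast at this
        rw [this]; simp
      simp_rw [this]
      exact (tendsto_rpow_neg_atTop (by linarith)).comp
        (tendsto_atTop_add_const_right _ _ tendsto_natCast_atTop_atTop)
    have hS : Summable (fun n : ℕ => (((n : ℂ) + 2) ^ (1 - s) - ((n : ℂ) + 1) ^ (1 - s)) / (1 - s)) := by
      have h1 : Summable (fun n : ℕ => zetaTerm n s) := by
        refine Summable.of_norm_bounded (g := fun n : ℕ => ‖s‖ * ((n : ℝ) + 1) ^ (-s.re - 1)) ?_
          (fun n => norm_zetaTerm_le n (by linarith) hs1)
        refine Summable.mul_left _ ?_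
        have := Real.summable_nat_rpow.mpr (show -s.re - 1 < -1 by linarith)
        exact_mod_cast (summable_nat_add_iff 1).mpr this
      refine (hsum.sub h1).congr fun n => ?_
      unfold zetaTerm
      rw [cpow_neg]; simp
    rw [hS.hasSum_iff_tendsto_nat]
    have : ∀ N : ℕ, ∑ n ∈ Finset.range N,
        (((n : ℂ) + 2) ^ (1 - s) - ((n : ℂ) + 1) ^ (1 - s)) / (1 - s)
        = (((N : ℂ) + 1) ^ (1 - s) - 1) / (1 - s) := by
      intro N
      rw [← Finset.sum_div]
      congr 1
      have := Finset.sum_range_sub (fun n : ℕ => ((n : ℂ) + 1) ^ (1 - s)) N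
      simp only [Nat.cast_zero, zero_add, one_cpow] at this
      rw [← this]
      refine Finset.sum_congr rfl fun n _ => ?_
      push_cast
      ring_nf
    simp_rw [this]
    have := (hlim.sub_const 1).div_const (1 - s)
    convert this using 2
    rw [zero_sub, div_eq_div_iff (sub_ne_zero.mpr hs1) h1s]; ring
  rw [zeta_eq_tsum_one_div_nat_add_one_cpow hs, ← htel.tsum_eq, ← Summable.tsum_add htel.summable]
  · refine tsum_congr fun n => ?_
    unfold zetaTerm
    rw [cpow_neg]; ring
  · refine (hsum.sub htel.summable).congr fun n => ?_
    unfold zetaTerm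
    rw [cpow_neg]; ring

lemma summable_rpow_five_fourths : Summable (fun n : ℕ => ((n : ℝ) + 1) ^ (-(5 / 4 : ℝ))) := by
  have := Real.summable_nat_rpow.mpr (show (-(5 / 4 : ℝ)) < -1 by norm_num)
  exact_mod_cast (summable_nat_add_iff 1).mpr this

lemma norm_zetaTerm_le' (n : ℕ) {s : ℂ} (hs : 1 / 4 ≤ s.re) (hi : 0 < s.im) :
    ‖zetaTerm n s‖ ≤ ‖s‖ * ((n : ℝ) + 1) ^ (-(5 / 4 : ℝ)) := by
  refine (norm_zetaTerm_le n (by linarith) (by rintro rfl; simp at hi)).trans ?_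
  refine mul_le_mul_of_nonneg_left ?_ (norm_nonneg _)
  exact Real.rpow_le_rpow_of_exponent_le (by linarith [Nat.cast_nonneg (α := ℝ) n]) (by linarith)

/-- Identity theorem on a rectangle in the open upper half-plane, which avoids the pole and contains
both s and 2 + i Im s; near the latter the formula is already known. -/
lemma riemannZeta_eq_tsum_zetaTerm {s : ℂ} (hs : 1 / 4 < s.re) (hi : 0 < s.im) :
    riemannZeta s = 1 / (s - 1) + ∑' n, zetaTerm n s := by
  set B : ℝ := s.re + s.im + 3 with hB
  set U : Set ℂ := (Set.Ioo (1 / 4) B) ×ℂ (Set.Ioo 0 B) with hU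
  have hUo : IsOpen U := isOpen_Ioo.reProdIm isOpen_Ioo
  have hUc : IsPreconnected U := (convex_reProdIm (convex_Ioo (1 / 4) B) (convex_Ioo 0 B)).isPreconnected
  have hne : ∀ z ∈ U, z ≠ 1 := by
    rintro z hz rfl
    have := (mem_reProdIm.mp hz).2.1
    simp at this
  have hd : DifferentiableOn ℂ (fun z => 1 / (z - 1) + ∑' n, zetaTerm n z) U := by
    refine DifferentiableOn.add ?_ ?_
    · intro z hz
      have := sub_ne_zero.mpr (hne z hz)
      exact (by fun_prop (disch := assumption) :
        DifferentiableAt ℂ (fun z : ℂ => 1 / (z - 1)) z).differentiableWithinAt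
    · refine differentiableOn_tsum_of_summable_norm
        (u := fun n : ℕ => (2 * B) * ((n : ℝ) + 1) ^ (-(5 / 4 : ℝ)))
        (summable_rpow_five_fourths.mul_left _) ?_ hUo ?_
      · exact fun n z hz => (differentiableAt_zetaTerm n (hne z hz)).differentiableWithinAt
      · intro n z hz
        obtain ⟨⟨h1, h2⟩, h3, h4⟩ := mem_reProdIm.mp hz
        refine (norm_zetaTerm_le' n h1.le h3).trans ?_
        gcongr
        refine (norm_le_abs_re_add_abs_im z).trans ?_
        rw [abs_of_pos (by linarith), abs_of_pos h3]; linarith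
  have hz : DifferentiableOn ℂ riemannZeta U := fun z hz =>
    (differentiableAt_riemannZeta (hne z hz)).differentiableWithinAt
  have hz0 : (⟨2, s.im⟩ : ℂ) ∈ U := by
    refine mem_reProdIm.mpr ⟨⟨by norm_num, by linarith⟩, hi, by linarith⟩
  have hs0 : s ∈ U := mem_reProdIm.mpr ⟨⟨hs, by linarith⟩, hi, by linarith⟩
  refine (hz.analyticOnNhd hUo).eqOn_of_preconnected_of_eventuallyEq
    (hd.analyticOnNhd hUo) hUc hz0 ?_ hs0
  have : {z : ℂ | 1 < z.re} ∈ 𝓝 (⟨2, s.im⟩ : ℂ) :=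
    (isOpen_lt continuous_const continuous_re).mem_nhds (by simp)
  filter_upwards [this] with z hz
  exact riemannZeta_eq_tsum_zetaTerm_of_one_lt hz

/-- Linear growth of `ζ` in vertical strips to the right of `Re s = 1/4`. -/
theorem exists_norm_riemannZeta_le :
    ∃ C : ℝ, 1 ≤ C ∧ ∀ s : ℂ, 1 / 4 < s.re → 1 ≤ s.im → ‖riemannZeta s‖ ≤ C * ‖s‖ := by
  refine ⟨1 + ∑' n : ℕ, ((n : ℝ) + 1) ^ (-(5 / 4 : ℝ)), ?_, fun s hs hi => ?_⟩
  · have : 0 ≤ ∑' n : ℕ, ((n : ℝ) + 1) ^ (-(5 / 4 : ℝ)) := tsum_nonneg fun n => by positivity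
    linarith
  rw [riemannZeta_eq_tsum_zetaTerm hs (by linarith)]
  have h1 : ‖1 / (s - 1)‖ ≤ ‖s‖ := by
    have h2 : 1 ≤ ‖s - 1‖ := by
      refine le_trans ?_ (abs_im_le_norm (s - 1))
      simpa using hi.trans (le_abs_self _)
    have h3 : 1 ≤ ‖s‖ := (hi.trans (le_abs_self _)).trans (abs_im_le_norm s)
    rw [norm_div, norm_one]
    exact ((div_le_one (by linarith)).mpr h2).trans h3
  have h2 : ‖∑' n, zetaTerm n s‖ ≤ ‖s‖ * ∑' n : ℕ, ((n : ℝ) + 1) ^ (-(5 / 4 : ℝ)) := by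
    rw [← tsum_mul_left]
    exact tsum_of_norm_bounded (summable_rpow_five_fourths.mul_left _).hasSum
      (fun n => norm_zetaTerm_le' n hs.le (by linarith))
  calc _ ≤ _ := norm_add_le _ _
    _ ≤ ‖s‖ + ‖s‖ * ∑' n : ℕ, ((n : ℝ) + 1) ^ (-(5 / 4 : ℝ)) := add_le_add h1 h2
    _ = _ := by ring

/-! ### Blaschke quotients and Landau's local formula. -/

/-- The normalised denominator of a Blaschke factor for the disc of radius `R`. -/
noncomputable def blaschkeDenom (R : ℝ) (ρ z : ℂ) : ℂ := (R ^ 2 - (starRingEnd ℂ) ρ * z) / R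

lemma differentiable_blaschkeDenom (R : ℝ) (ρ : ℂ) : Differentiable ℂ (blaschkeDenom R ρ) := by
  unfold blaschkeDenom; fun_prop

/-- On the circle R² = z̄z, so the denominator is the conjugate of z - ρ times z/R: a Blaschke
factor has modulus one there. -/
lemma norm_blaschkeDenom_of_norm_eq {R : ℝ} (hR : 0 < R) (ρ : ℂ) {z : ℂ} (hz : ‖z‖ = R) :
    ‖blaschkeDenom R ρ z‖ = ‖z - ρ‖ := by
  have h : (R : ℂ) ^ 2 = (starRingEnd ℂ) z * z := by
    rw [← normSq_eq_conj_mul_self, normSq_eq_norm_sq, hz]; push_cast; rfl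
  unfold blaschkeDenom
  rw [h, ← sub_mul, ← map_sub, norm_div, norm_mul, RCLike.norm_conj, hz, norm_real,
    Real.norm_eq_abs, abs_of_pos hR, mul_div_cancel_right₀ _ hR.ne']

lemma le_norm_blaschkeDenom {R : ℝ} (hR : 0 < R) (ρ z : ℂ) :
    R - ‖ρ‖ * ‖z‖ / R ≤ ‖blaschkeDenom R ρ z‖ := by
  unfold blaschkeDenom
  rw [norm_div, norm_real, Real.norm_eq_abs, abs_of_pos hR, le_div_iff₀ hR, sub_mul,
    div_mul_cancel₀ _ hR.ne']
  have := norm_sub_norm_le ((R : ℂ) ^ 2) ((starRingEnd ℂ) ρ * z)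
  rw [norm_mul, RCLike.norm_conj, norm_pow, norm_real, Real.norm_eq_abs, abs_of_pos hR] at this
  nlinarith

lemma norm_multiset_map_prod {ι : Type*} (Z : Multiset ι) (φ : ι → ℂ) :
    ‖(Z.map φ).prod‖ = (Z.map fun i => ‖φ i‖).prod := by
  induction Z using Multiset.induction_on with
  | empty => simp
  | cons a Z ih => simp [ih]

/-- `F` is obtained from `f` by dividing out Blaschke factors for the points of `Z`. -/
structure BlaschkeQuotient (R R' : ℝ) (f F : ℂ → ℂ) (Z : Multiset ℂ) : Prop where
  diff : DifferentiableOn ℂ F (ball 0 R')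
  eq : ∀ z ∈ ball (0 : ℂ) R',
    f z * (Z.map fun ρ => blaschkeDenom R ρ z).prod = (Z.map fun ρ => z - ρ).prod * F z

lemma BlaschkeQuotient.cons {R R' : ℝ} {f F : ℂ → ℂ} {Z : Multiset ℂ}
    (h : BlaschkeQuotient R R' f F Z) {ρ : ℂ} (hρ : ρ ∈ ball (0 : ℂ) R') (h0 : F ρ = 0) :
    BlaschkeQuotient R R' f (fun z => dslope F ρ z * blaschkeDenom R ρ z) (ρ ::ₘ Z) := by
  refine ⟨?_, fun z hz => ?_⟩
  · exact ((differentiableOn_dslope (isOpen_ball.mem_nhds hρ)).mpr h.diff).mul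
      (differentiable_blaschkeDenom R ρ).differentiableOn
  · have h1 := sub_smul_dslope F ρ z
    rw [h0, sub_zero, smul_eq_mul] at h1
    have h2 := h.eq z hz
    rw [← h1] at h2
    simp only [Multiset.map_cons, Multiset.prod_cons]
    linear_combination blaschkeDenom R ρ z * h2

/-- On |z| = R the factors have modulus one, so |F| = |f|; the maximum principle does the rest. -/
lemma BlaschkeQuotient.norm_le {R R' B : ℝ} {f F : ℂ → ℂ} {Z : Multiset ℂ} (hR : 0 < R)
    (hRR : R < R') (h : BlaschkeQuotient R R' f F Z) (hZ : ∀ ρ ∈ Z, ‖ρ‖ < R)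
    (hB : ∀ z, ‖z‖ = R → ‖f z‖ ≤ B) {z : ℂ} (hz : ‖z‖ ≤ R) : ‖F z‖ ≤ B := by
  have hcl : closedBall (0 : ℂ) R ⊆ ball 0 R' := closedBall_subset_ball hRR
  have hd : DiffContOnCl ℂ F (ball 0 R) := by
    refine DifferentiableOn.diffContOnCl ?_
    rw [closure_ball _ hR.ne']
    exact h.diff.mono hcl
  refine Complex.norm_le_of_forall_mem_frontier_norm_le isBounded_ball hd (C := B) ?_
    (by rwa [closure_ball _ hR.ne', mem_closedBall_zero_iff])
  intro w hw
  rw [frontier_ball _ hR.ne', mem_sphere_zero_iff_norm] at hw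
  have h1 := congrArg norm (h.eq w (hcl (by simp [hw])))
  rw [norm_mul, norm_mul, norm_multiset_map_prod, norm_multiset_map_prod] at h1
  have h2 : (Z.map (fun ρ => ‖blaschkeDenom R ρ w‖)) = Z.map (fun ρ => ‖w - ρ‖) :=
    Multiset.map_congr rfl fun ρ _ => norm_blaschkeDenom_of_norm_eq hR ρ hw
  rw [h2, mul_comm] at h1
  have h3 : (Z.map (fun ρ => ‖w - ρ‖)).prod ≠ 0 := by
    rw [Ne, Multiset.prod_eq_zero_iff, Multiset.mem_map]
    rintro ⟨ρ, hρ, h4⟩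
    have : w = ρ := by simpa [sub_eq_zero] using h4
    exact absurd (hZ ρ hρ) (by rw [← this, hw]; exact lt_irrefl _)
  rw [← mul_left_cancel₀ h3 h1]
  exact hB w hw

/-- Jensen's inequality in multiplicative form: at the centre every zero divided out gains a factor
of at least R/R₁. -/
lemma BlaschkeQuotient.norm_zero_ge {R R' R₁ : ℝ} {f F : ℂ → ℂ} {Z : Multiset ℂ} (hR : 0 < R)
    (hRR : R < R') (hR1 : 0 < R₁)
    (h : BlaschkeQuotient R R' f F Z) (hZ : ∀ ρ ∈ Z, ‖ρ‖ ≤ R₁) :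
    ‖f 0‖ * (R / R₁) ^ (Multiset.card Z) ≤ ‖F 0‖ := by
  have h1 := congrArg norm (h.eq 0 (by simpa using hR.trans hRR))
  rw [norm_mul, norm_mul, norm_multiset_map_prod, norm_multiset_map_prod] at h1
  have h2 : (Z.map (fun ρ => ‖blaschkeDenom R ρ 0‖)) = Z.map (fun _ => R) := by
    refine Multiset.map_congr rfl fun ρ _ => ?_
    simp only [blaschkeDenom, mul_zero, sub_zero, sq]
    rw [mul_div_assoc, div_self (by exact_mod_cast hR.ne'), mul_one, norm_real,
      Real.norm_eq_abs, abs_of_pos hR]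
  have h3 : (Z.map (fun ρ => ‖0 - ρ‖)).prod ≤ R₁ ^ (Multiset.card Z) := by
    have := Multiset.prod_map_le_prod_map₀ (s := Z) (fun ρ => ‖0 - ρ‖) (fun _ => R₁)
      (fun ρ _ => norm_nonneg _) (fun ρ hρ => by simpa using hZ ρ hρ)
    simpa using this
  rw [h2] at h1
  simp only [Multiset.map_const', Multiset.prod_replicate] at h1
  rw [div_pow, mul_div_assoc', div_le_iff₀ (by positivity), h1, mul_comm]
  exact mul_le_mul_of_nonneg_left h3 (norm_nonneg _)

/-- A maximal family of zeros in the closed disc of radius `R₁` can be divided out. -/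
lemma exists_blaschkeQuotient {R R' R₁ B : ℝ} {f : ℂ → ℂ} (hR1 : 0 < R₁) (hR : R₁ < R)
    (hRR : R < R') (hf : DifferentiableOn ℂ f (ball 0 R')) (hf0 : f 0 ≠ 0)
    (hB : ∀ z, ‖z‖ = R → ‖f z‖ ≤ B) :
    ∃ Z F, BlaschkeQuotient R R' f F Z ∧ (∀ ρ ∈ Z, ‖ρ‖ ≤ R₁) ∧
      ∀ z, ‖z‖ ≤ R₁ → F z ≠ 0 := by
  have hR0 := hR1.trans hR
  have hB' : 0 ≤ B := (norm_nonneg _).trans (hB R (by simp [abs_of_pos hR0]))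
  set P : ℕ → Prop := fun n => ∃ Z F, BlaschkeQuotient R R' f F Z ∧ (∀ ρ ∈ Z, ‖ρ‖ ≤ R₁) ∧
    Multiset.card Z = n with hP
  have h0 : P 0 := ⟨0, f, ⟨hf, by simp⟩, by simp, by simp⟩
  -- Jensen's inequality and the maximum principle together give ‖f 0‖ (R/R₁)^n ≤ B, which bounds
  -- the number of zeros that can be divided out.
  obtain ⟨N, hN⟩ : ∃ N : ℕ, ∀ n, P n → n ≤ N := by
    obtain ⟨N, hN⟩ := pow_unbounded_of_one_lt (B / ‖f 0‖) ((one_lt_div hR1).mpr hR)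
    refine ⟨N, ?_⟩
    rintro n ⟨Z, F, h, hZ, rfl⟩
    by_contra hlt
    push Not at hlt
    have h1 := h.norm_zero_ge hR0 hRR hR1 hZ
    have h2 := h.norm_le hR0 hRR (fun ρ hρ => (hZ ρ hρ).trans_lt hR) hB (z := 0)
      (by simpa using hR0.le)
    have h3 := pow_le_pow_right₀ ((one_lt_div hR1).mpr hR).le hlt.le
    have h4 : B / ‖f 0‖ < (R / R₁) ^ Multiset.card Z := hN.trans_le h3
    rw [div_lt_iff₀ (norm_pos_iff.mpr hf0)] at h4
    linarith
  classical
  -- With the number of factors maximal, F has no zero left in the disc, since otherwise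
  -- `BlaschkeQuotient.cons` would divide out one more. Multiplicities need no separate treatment.
  have hmax := Nat.findGreatest_spec (P := P) (Nat.zero_le N) h0
  obtain ⟨Z, F, h, hZ, hc⟩ := hmax
  refine ⟨Z, F, h, hZ, fun z hz h0z => ?_⟩
  have h5 := h.cons (ρ := z) (by rw [mem_ball_zero_iff]; linarith) h0z
  have h6 : P (Multiset.card Z + 1) := ⟨_, _, h5, by
    intro ρ hρ
    rcases Multiset.mem_cons.mp hρ with rfl | h7
    exacts [hz, hZ ρ h7], by simp⟩
  have h7 := Nat.le_findGreatest (hN _ h6) h6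
  omega

/-- Bound for the logarithmic derivative of a zero-free function. -/
lemma norm_logDeriv_le_of_ne_zero {F : ℂ → ℂ} {r r' r'' A : ℝ} (h2 : 0 < r'') (h1 : r'' < r')
    (h0 : r' < r) (hA : 0 < A) (hF : DifferentiableOn ℂ F (ball 0 r))
    (hne : ∀ z ∈ ball (0 : ℂ) r, F z ≠ 0) (hb : ∀ z ∈ ball (0 : ℂ) r, ‖F z‖ ≤ ‖F 0‖ * Real.exp A)
    {z : ℂ} (hz : z ∈ ball (0 : ℂ) r'') :
    ‖logDeriv F z‖ ≤ 2 * A * r' / (r - r') / (r' - r'') := by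
  have hr : 0 < r := by linarith
  have h00 : (0 : ℂ) ∈ ball (0 : ℂ) r := by simpa using hr
  have hφ : DifferentiableOn ℂ (logDeriv F) (ball 0 r) := by
    have : DifferentiableOn ℂ (deriv F) (ball 0 r) := hF.deriv isOpen_ball
    exact this.div hF hne
  -- Φ is the primitive of F'/F with Φ(0) = 0, so F = F(0) e^Φ and the bound on |F| says Re Φ ≤ A.
  -- Borel–Carathéodory then bounds Φ, and Cauchy's estimate bounds Φ' = F'/F.
  obtain ⟨Φ, hΦ0, hΦ⟩ := hφ.isExactOn_ball.with_val_at 0 0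
  have hFexp : ∀ w ∈ ball (0 : ℂ) r, F w = F 0 * exp (Φ w) := by
    intro w hw
    have hconst := (convex_ball (0 : ℂ) r).is_const_of_fderivWithin_eq_zero (𝕜 := ℂ)
      (f := fun w => F w * exp (-Φ w)) ?_ ?_ hw h00
    · simp only [hΦ0, neg_zero, exp_zero, mul_one] at hconst
      rw [← hconst, mul_assoc, ← exp_add]; simp
    · intro x hx
      exact ((hF.differentiableAt (isOpen_ball.mem_nhds hx)).mul
        ((hΦ x hx).differentiableAt.neg.cexp)).differentiableWithinAt
    · intro x hx
      have hFx := (hF.differentiableAt (isOpen_ball.mem_nhds hx)).hasDerivAt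
      have := hFx.mul (hΦ x hx).neg.cexp
      have h3 : HasDerivAt (fun w => F w * exp (-Φ w)) 0 x := by
        refine this.congr_deriv ?_
        have := hne x hx
        simp only [logDeriv_apply]
        field_simp
        ring
      rw [fderivWithin_eq_fderiv (isOpen_ball.uniqueDiffWithinAt hx) h3.differentiableAt]
      ext
      simp [h3.deriv]
  have hΦd : DifferentiableOn ℂ Φ (ball 0 r) := fun w hw =>
    (hΦ w hw).differentiableAt.differentiableWithinAt
  have hre : Set.MapsTo Φ (ball 0 r) {z | z.re ≤ A} := by
    intro w hw
    have h3 := hb w hw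
    rw [hFexp w hw, norm_mul, norm_exp] at h3
    exact Real.exp_le_exp.mp (le_of_mul_le_mul_left h3 (norm_pos_iff.mpr (hne 0 h00)))
  have hΦb : ∀ w, ‖w‖ ≤ r' → ‖Φ w‖ ≤ 2 * A * r' / (r - r') := by
    intro w hw
    refine (borelCaratheodory_zero hA hΦd hre hr (by rw [mem_ball_zero_iff]; linarith) hΦ0).trans ?_
    have : 0 < r - r' := by linarith
    have : 0 ≤ 2 * A * r' := by
      have : 0 < r' := by linarith
      positivity
    gcongr
  have hz' : ‖z‖ < r'' := mem_ball_zero_iff.mp hz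
  rw [← (hΦ z (by rw [mem_ball_zero_iff]; linarith)).deriv]
  have hsub : closedBall z (r' - r'') ⊆ ball 0 r := by
    intro w hw
    rw [mem_closedBall, dist_eq_norm] at hw
    rw [mem_ball_zero_iff]
    have := norm_le_norm_add_norm_sub' w z
    linarith
  refine norm_deriv_le_of_forall_mem_sphere_norm_le (by linarith) ?_ ?_
  · refine DifferentiableOn.diffContOnCl ?_
    rw [closure_ball _ (by linarith)]
    exact hΦd.mono hsub
  · intro w hw
    rw [mem_sphere, dist_eq_norm] at hw
    refine hΦb w ?_
    have := norm_le_norm_add_norm_sub' w z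
    linarith

lemma logDeriv_multiset_prod {ι : Type*} (Z : Multiset ι) (φ : ι → ℂ → ℂ) {z : ℂ}
    (hd : ∀ i ∈ Z, DifferentiableAt ℂ (φ i) z) (hne : ∀ i ∈ Z, φ i z ≠ 0) :
    DifferentiableAt ℂ (fun w => (Z.map fun i => φ i w).prod) z ∧
    (Z.map fun i => φ i z).prod ≠ 0 ∧
    logDeriv (fun w => (Z.map fun i => φ i w).prod) z = (Z.map fun i => logDeriv (φ i) z).sum := by
  induction Z using Multiset.induction_on with
  | empty => simp
  | cons a Z ih =>
    obtain ⟨h1, h2, h3⟩ := ih (fun i hi => hd i (Multiset.mem_cons_of_mem hi))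
      (fun i hi => hne i (Multiset.mem_cons_of_mem hi))
    have h4 := hd a (Multiset.mem_cons_self a Z)
    have h5 := hne a (Multiset.mem_cons_self a Z)
    simp only [Multiset.map_cons, Multiset.prod_cons, Multiset.sum_cons]
    refine ⟨h4.mul h1, mul_ne_zero h5 h2, ?_⟩
    rw [logDeriv_mul z h5 h2 h4 h1, h3]

/-- **Landau's local formula** for the logarithmic derivative, with constants for the radii
`1.55 < 1.6 < 1.7 < 1.75`. -/
theorem exists_logDeriv_eq_sum_add {f : ℂ → ℂ} {A : ℝ} (hA : 0 < A)
    (hf : DifferentiableOn ℂ f (ball 0 (7 / 4))) (hf0 : f 0 ≠ 0)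
    (hB : ∀ z, ‖z‖ = 17 / 10 → ‖f z‖ ≤ ‖f 0‖ * Real.exp A) :
    ∃ (Z : Multiset ℂ) (g : ℂ → ℂ), (∀ ρ ∈ Z, f ρ = 0 ∧ ‖ρ‖ ≤ 8 / 5) ∧
      (∀ ρ, f ρ = 0 → ‖ρ‖ ≤ 8 / 5 → ρ ∈ Z) ∧ (Multiset.card Z : ℝ) ≤ 20 * A ∧
      DifferentiableOn ℂ g (ball 0 (31 / 20)) ∧
      (∀ z ∈ ball (0 : ℂ) (31 / 20), ‖g z‖ ≤ 6000 * A) ∧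
      ∀ z ∈ ball (0 : ℂ) (31 / 20), f z ≠ 0 →
        logDeriv f z = (Z.map fun ρ => 1 / (z - ρ)).sum + g z := by
  obtain ⟨Z, F, h, hZ, hF⟩ := exists_blaschkeQuotient (R₁ := 8 / 5) (R := 17 / 10) (R' := 7 / 4)
    (by norm_num) (by norm_num) (by norm_num) hf hf0 hB
  have hnorm : ∀ z, ‖z‖ ≤ 17 / 10 → ‖F z‖ ≤ ‖f 0‖ * Real.exp A := fun z hz =>
    h.norm_le (by norm_num) (by norm_num) (fun ρ hρ => (hZ ρ hρ).trans_lt (by norm_num)) hB hz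
  have hge := h.norm_zero_ge (R₁ := 8 / 5) (by norm_num) (by norm_num) (by norm_num) hZ
  have hf0' : 0 < ‖f 0‖ := norm_pos_iff.mpr hf0
  have hcard : (Multiset.card Z : ℝ) ≤ 20 * A := by
    have h1 := hge.trans (hnorm 0 (by norm_num))
    have h2 := le_of_mul_le_mul_left h1 hf0'
    have h3 : 1 + (Multiset.card Z : ℝ) * (1 / 16) ≤ (1 + 1 / 16 : ℝ) ^ Multiset.card Z :=
      one_add_mul_le_pow (by norm_num) _
    -- The ratio of the radii is 17/16, and e^{1/20} ≤ 20/19 < 17/16.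
    have h4 : Real.exp ((Multiset.card Z : ℝ) * (1 / 20)) ≤ Real.exp A := by
      refine le_trans ?_ h2
      rw [Real.exp_nat_mul]
      refine pow_le_pow_left₀ (Real.exp_nonneg _) ?_ _
      have := Real.exp_bound_div_one_sub_of_interval (x := 1 / 20) (by norm_num) (by norm_num)
      linarith
    have := Real.exp_le_exp.mp h4
    linarith
  have hbound : ∀ z ∈ ball (0 : ℂ) (8 / 5), ‖F z‖ ≤ ‖F 0‖ * Real.exp A := by
    intro z hz
    rw [mem_ball_zero_iff] at hz
    refine (hnorm z (by linarith)).trans ?_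
    refine mul_le_mul_of_nonneg_right (le_trans ?_ hge) (Real.exp_nonneg _)
    exact le_mul_of_one_le_right hf0'.le (one_le_pow₀ (by norm_num))
  have hFd : DifferentiableOn ℂ F (ball 0 (8 / 5)) := h.diff.mono (ball_subset_ball (by norm_num))
  have hFne : ∀ z ∈ ball (0 : ℂ) (8 / 5), F z ≠ 0 := fun z hz =>
    hF z (mem_ball_zero_iff.mp hz).le
  have hden : ∀ ρ ∈ Z, ∀ z ∈ ball (0 : ℂ) (31 / 20), (1 / 10 : ℝ) ≤ ‖blaschkeDenom (17 / 10) ρ z‖ := by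
    intro ρ hρ z hz
    refine le_trans ?_ (le_norm_blaschkeDenom (by norm_num) ρ z)
    have h1 := hZ ρ hρ
    have h2 := (mem_ball_zero_iff.mp hz).le
    have : ‖ρ‖ * ‖z‖ ≤ 8 / 5 * (31 / 20) := mul_le_mul h1 h2 (norm_nonneg _) (by norm_num)
    rw [div_eq_mul_inv]
    norm_num
    linarith
  have hdenne : ∀ ρ ∈ Z, ∀ z ∈ ball (0 : ℂ) (31 / 20), blaschkeDenom (17 / 10) ρ z ≠ 0 := by
    intro ρ hρ z hz h0
    have := hden ρ hρ z hz
    rw [h0, norm_zero] at this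
    norm_num at this
  have hZsub : ∀ z, ‖z‖ ≤ 8 / 5 → z ∈ ball (0 : ℂ) (7 / 4) := by
    intro z hz; rw [mem_ball_zero_iff]; linarith
  have hbd : ∀ ρ ∈ Z, ∀ z ∈ ball (0 : ℂ) (31 / 20),
      ‖logDeriv (blaschkeDenom (17 / 10) ρ) z‖ ≤ 16 := by
    intro ρ hρ z hz
    have hder : deriv (blaschkeDenom (17 / 10) ρ) z = -(starRingEnd ℂ) ρ / (17 / 10 : ℝ) := by
      unfold blaschkeDenom
      simp
    rw [logDeriv_apply, hder, norm_div, norm_div, norm_neg, RCLike.norm_conj, norm_real]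
    have h1 := hZ ρ hρ
    have h2 := hden ρ hρ z hz
    rw [div_le_iff₀ (by linarith)]
    norm_num
    linarith
  refine ⟨Z, fun z => logDeriv F z - (Z.map fun ρ => logDeriv (blaschkeDenom (17 / 10) ρ) z).sum,
    ?_, ?_, hcard, ?_, ?_, ?_⟩
  · intro ρ hρ
    refine ⟨?_, hZ ρ hρ⟩
    have h1 := h.eq ρ (hZsub ρ (hZ ρ hρ))
    have h2 : (Z.map fun ρ' => ρ - ρ').prod = 0 := by
      rw [Multiset.prod_eq_zero_iff, Multiset.mem_map]
      exact ⟨ρ, hρ, sub_self ρ⟩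
    rw [h2, zero_mul, mul_eq_zero] at h1
    refine h1.resolve_right ?_
    rw [Multiset.prod_eq_zero_iff, Multiset.mem_map]
    rintro ⟨ρ', hρ', h3⟩
    have h4 := le_norm_blaschkeDenom (R := 17 / 10) (by norm_num) ρ' ρ
    rw [h3, norm_zero] at h4
    have : ‖ρ'‖ * ‖ρ‖ ≤ 8 / 5 * (8 / 5) :=
      mul_le_mul (hZ ρ' hρ') (hZ ρ hρ) (norm_nonneg _) (by norm_num)
    rw [div_eq_mul_inv] at h4
    norm_num at h4
    linarith
  · intro ρ h0 hρ
    have h1 := h.eq ρ (hZsub ρ hρ)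
    rw [h0, zero_mul, eq_comm, mul_eq_zero, or_iff_left (hF ρ hρ), Multiset.prod_eq_zero_iff,
      Multiset.mem_map] at h1
    obtain ⟨ρ', h2, h3⟩ := h1
    rwa [sub_eq_zero.mp h3]
  · have hsub : ball (0 : ℂ) (31 / 20) ⊆ ball 0 (8 / 5) := ball_subset_ball (by norm_num)
    refine DifferentiableOn.sub ?_ ?_
    · exact ((hFd.deriv isOpen_ball).div hFd hFne).mono hsub
    · clear hcard hge hbd h hnorm
      induction Z using Multiset.induction_on with
      | empty => simp
      | cons a Z ih =>
        simp only [Multiset.map_cons, Multiset.sum_cons]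
        refine DifferentiableOn.add ?_ (ih (fun ρ hρ => hZ ρ (Multiset.mem_cons_of_mem hρ))
          (fun ρ hρ => hden ρ (Multiset.mem_cons_of_mem hρ))
          (fun ρ hρ => hdenne ρ (Multiset.mem_cons_of_mem hρ)))
        exact ((differentiable_blaschkeDenom _ a).differentiableOn.deriv isOpen_ball).div
          (differentiable_blaschkeDenom _ a).differentiableOn
          (fun z hz => hdenne a (Multiset.mem_cons_self a Z) z hz)
  · intro z hz
    have h1 := norm_logDeriv_le_of_ne_zero (r := 8 / 5) (r' := 63 / 40) (r'' := 31 / 20) (by norm_num)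
      (by norm_num) (by norm_num) hA hFd hFne hbound hz
    have h2 : ‖(Z.map fun ρ => logDeriv (blaschkeDenom (17 / 10) ρ) z).sum‖
        ≤ Multiset.card Z * 16 := by
      refine (norm_multiset_sum_le _).trans ?_
      rw [Multiset.map_map]
      have := Multiset.sum_map_le_sum_map (s := Z)
        (norm ∘ fun ρ => logDeriv (blaschkeDenom (17 / 10) ρ) z) (fun _ => (16 : ℝ))
        (fun ρ hρ => hbd ρ hρ z hz)
      simpa using this
    refine (norm_sub_le _ _).trans ?_
    -- The zero-free factor contributes 5040 A, and the at most 20 A denominators contribute at most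
    -- 16 each; the sum 5360 A is below 6000 A.
    have h3 : 2 * A * (63 / 40) / (8 / 5 - 63 / 40) / (63 / 40 - 31 / 20) = 5040 * A := by ring
    rw [h3] at h1
    linarith
  · intro z hz hfz
    have hz0 : z ∈ ball (0 : ℂ) (8 / 5) := ball_subset_ball (by norm_num) hz
    have hz1 : z ∈ ball (0 : ℂ) (7 / 4) := ball_subset_ball (by norm_num) hz
    have hzρ : ∀ ρ ∈ Z, z - ρ ≠ 0 := by
      intro ρ hρ h0
      have h1 := h.eq z hz1
      have h2 : (Z.map fun ρ' => z - ρ').prod = 0 := by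
        rw [Multiset.prod_eq_zero_iff, Multiset.mem_map]; exact ⟨ρ, hρ, h0⟩
      rw [h2, zero_mul, mul_eq_zero, or_iff_right hfz, Multiset.prod_eq_zero_iff,
        Multiset.mem_map] at h1
      obtain ⟨ρ', h3, h4⟩ := h1
      exact hdenne ρ' h3 z hz h4
    have hfd : DifferentiableAt ℂ f z := hf.differentiableAt (isOpen_ball.mem_nhds hz1)
    have hFdz : DifferentiableAt ℂ F z := hFd.differentiableAt (isOpen_ball.mem_nhds hz0)
    obtain ⟨a1, a2, a3⟩ := logDeriv_multiset_prod Z (fun ρ w => blaschkeDenom (17 / 10) ρ w) (z := z)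
      (fun ρ _ => (differentiable_blaschkeDenom _ ρ).differentiableAt)
      (fun ρ hρ => hdenne ρ hρ z hz)
    obtain ⟨b1, b2, b3⟩ := logDeriv_multiset_prod Z (fun ρ w => w - ρ) (z := z)
      (fun ρ _ => by fun_prop) hzρ
    have heq : (fun w => f w * (Z.map fun ρ => blaschkeDenom (17 / 10) ρ w).prod) =ᶠ[𝓝 z]
        (fun w => (Z.map fun ρ => w - ρ).prod * F w) := by
      filter_upwards [isOpen_ball.mem_nhds hz1] with w hw using h.eq w hw
    have h1 : logDeriv (fun w => f w * (Z.map fun ρ => blaschkeDenom (17 / 10) ρ w).prod) z =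
        logDeriv (fun w => (Z.map fun ρ => w - ρ).prod * F w) z := by
      rw [logDeriv_apply, logDeriv_apply, heq.deriv_eq, heq.eq_of_nhds]
    rw [logDeriv_mul z hfz a2 hfd a1, logDeriv_mul z b2 (hFne z hz0) b1 hFdz, a3, b3] at h1
    have h2 : (Z.map fun ρ => logDeriv (fun w => w - ρ) z) = Z.map fun ρ => 1 / (z - ρ) := by
      refine Multiset.map_congr rfl fun ρ _ => ?_
      simp [logDeriv_apply]
    rw [h2] at h1
    rw [← add_sub_assoc, ← h1]
    ring

/-! ### The local formula for ζ'/ζ. -/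

/-- The series ∑ μ(n) n^{-s} for 1/ζ(s) has modulus at most ζ(2) = π²/6 ≤ 2 on this line. -/
lemma half_le_norm_riemannZeta {s : ℂ} (hs : s.re = 2) : 1 / 2 ≤ ‖riemannZeta s‖ := by
  have h1 : 1 < s.re := by rw [hs]; norm_num
  have hprod := ArithmeticFunction.LSeries_zeta_mul_Lseries_moebius h1
  rw [ArithmeticFunction.LSeries_zeta_eq_riemannZeta h1] at hprod
  have hm : ‖LSeries (fun n => (ArithmeticFunction.moebius n : ℂ)) s‖ ≤ Real.pi ^ 2 / 6 := by
    refine tsum_of_norm_bounded hasSum_zeta_two fun n => ?_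
    rcases eq_or_ne n 0 with rfl | hn
    · simp
    · rw [LSeries.norm_term_eq, if_neg hn, hs]
      have : ‖((ArithmeticFunction.moebius n : ℤ) : ℂ)‖ ≤ 1 := by
        rw [norm_intCast]
        exact_mod_cast ArithmeticFunction.abs_moebius_le_one
      rw [Real.rpow_two]
      gcongr
  have hpi : Real.pi ^ 2 / 6 ≤ 2 := by nlinarith [Real.pi_lt_d2, Real.pi_pos]
  have h2 := congrArg norm hprod
  rw [norm_mul, norm_one] at h2
  nlinarith [norm_nonneg (riemannZeta s)]

/-- Near height `τ` the logarithmic derivative of `ζ` is a sum over the zeros close by, up to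
`O(log τ)`. -/
theorem exists_logDeriv_riemannZeta_local :
    ∃ K : ℝ, 1 ≤ K ∧ ∀ τ : ℝ, 10 ≤ τ → ∃ (Z : Multiset ℂ) (g : ℂ → ℂ),
      (∀ ρ ∈ Z, riemannZeta ρ = 0 ∧ ‖ρ - (2 + τ * I)‖ ≤ 8 / 5) ∧
      (∀ ρ, riemannZeta ρ = 0 → ‖ρ - (2 + τ * I)‖ ≤ 8 / 5 → ρ ∈ Z) ∧
      (Multiset.card Z : ℝ) ≤ K * Real.log τ ∧
      DifferentiableOn ℂ g (ball (2 + τ * I) (31 / 20)) ∧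
      (∀ s ∈ ball (2 + τ * I) (31 / 20), ‖g s‖ ≤ K * Real.log τ) ∧
      ∀ s ∈ ball (2 + τ * I) (31 / 20), riemannZeta s ≠ 0 →
        logDeriv riemannZeta s = (Z.map fun ρ => 1 / (s - ρ)).sum + g s := by
  obtain ⟨C, hC1, hC⟩ := exists_norm_riemannZeta_le
  have hl4 : 0 ≤ Real.log (4 * C) := Real.log_nonneg (by linarith)
  refine ⟨6000 * (Real.log (4 * C) + 1), by linarith, fun τ hτ => ?_⟩
  set c : ℂ := 2 + τ * I with hc
  have hcre : c.re = 2 := by simp [hc]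
  have hcim : c.im = τ := by simp [hc]
  have hlog : 1 ≤ Real.log τ := by
    rw [Real.le_log_iff_exp_le (by linarith)]
    linarith [Real.exp_one_lt_d9]
  -- On the circle |ζ| ≤ C · 2τ = (1/2) · 4Cτ, while |ζ| ≥ 1/2 at the centre, so the ratio is at
  -- most e^A.
  set A : ℝ := Real.log (4 * C * τ) with hAdef
  have hAle : A ≤ (Real.log (4 * C) + 1) * Real.log τ := by
    rw [hAdef, Real.log_mul (by positivity) (by positivity)]
    nlinarith
  have hA : 0 < A := Real.log_pos (by nlinarith)
  have hre : ∀ z : ℂ, ‖z‖ ≤ 7 / 4 → 1 / 4 ≤ (z + c).re ∧ 1 ≤ (z + c).im := by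
    intro z hz
    have h1 := (abs_le.mp ((abs_re_le_norm z).trans hz)).1
    have h2 := (abs_le.mp ((abs_im_le_norm z).trans hz)).1
    rw [add_re, add_im, hcre, hcim]
    constructor <;> linarith
  have hne1 : ∀ z : ℂ, ‖z‖ ≤ 7 / 4 → z + c ≠ 1 := by
    intro z hz h
    have := (hre z hz).2
    rw [h] at this
    norm_num at this
  have hf : DifferentiableOn ℂ (fun z => riemannZeta (z + c)) (ball 0 (7 / 4)) := by
    intro z hz
    have := differentiableAt_riemannZeta (hne1 z (mem_ball_zero_iff.mp hz).le)
    exact (DifferentiableAt.comp z this (differentiableAt_id.add_const c)).differentiableWithinAt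
  have hf0 : 1 / 2 ≤ ‖riemannZeta (0 + c)‖ := half_le_norm_riemannZeta (by simp [hcre])
  have hf0' : riemannZeta (0 + c) ≠ 0 := by
    rw [← norm_pos_iff]; linarith
  have hB : ∀ z : ℂ, ‖z‖ = 17 / 10 → ‖riemannZeta (z + c)‖ ≤ ‖riemannZeta (0 + c)‖ * Real.exp A := by
    intro z hz
    have h1 := (abs_le.mp ((abs_re_le_norm z).trans hz.le)).1
    have h2 := hC (z + c) (by rw [add_re, hcre]; linarith) (hre z (by linarith)).2
    have h3 : ‖c‖ ≤ 2 + τ := by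
      rw [hc]
      refine (norm_add_le _ _).trans ?_
      rw [norm_mul, norm_I, mul_one, norm_real, Real.norm_eq_abs, abs_of_pos (by linarith)]
      simp
    have h4 : ‖z + c‖ ≤ 2 * τ := by
      refine (norm_add_le _ _).trans ?_
      linarith
    rw [hAdef, Real.exp_log (by positivity)]
    calc _ ≤ C * (2 * τ) := h2.trans (by gcongr)
      _ = 1 / 2 * (4 * C * τ) := by ring
      _ ≤ _ := by gcongr
  obtain ⟨Z, g, hZ1, hZ2, hZ3, hg1, hg2, hg3⟩ := exists_logDeriv_eq_sum_add hA hf hf0' hB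
  have hball : ∀ s ∈ ball c (31 / 20), s - c ∈ ball (0 : ℂ) (31 / 20) := by
    intro s hs
    rwa [mem_ball_zero_iff, ← dist_eq_norm]
  have hK : ∀ x, x ≤ 6000 * A → x ≤ 6000 * (Real.log (4 * C) + 1) * Real.log τ := by
    intro x hx; linarith
  refine ⟨Z.map (fun ρ => ρ + c), fun s => g (s - c), ?_, ?_, ?_, ?_, ?_, ?_⟩
  · intro ρ hρ
    obtain ⟨ρ', h1, rfl⟩ := Multiset.mem_map.mp hρ
    rw [add_sub_cancel_right]
    exact hZ1 ρ' h1
  · intro ρ h1 h2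
    exact Multiset.mem_map.mpr ⟨ρ - c, hZ2 _ (by simpa using h1) h2, by ring⟩
  · rw [Multiset.card_map]
    exact hK _ (by linarith)
  · exact hg1.comp (by fun_prop) hball
  · exact fun s hs => hK _ (hg2 _ (hball s hs))
  · intro s hs hs0
    have := hg3 (s - c) (hball s hs) (by simpa using hs0)
    have h5 : logDeriv (fun z => riemannZeta (z + c)) (s - c) = logDeriv riemannZeta s := by
      rw [logDeriv_apply, deriv_comp_add_const, logDeriv_apply, sub_add_cancel]
    rw [← h5, this, Multiset.map_map]
    congr 3
    ext ρ
    simp only [Function.comp]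
    congr 1
    ring

/-! ### The Gaussian kernel and its distribution function. -/

/-- The kernel `exp (u w + w ^ 2)`, whose inverse Mellin transform is a Gaussian. -/
noncomputable def expKernel (u : ℝ) (w : ℂ) : ℂ := exp (u * w + w ^ 2)

lemma norm_expKernel (u c y : ℝ) :
    ‖expKernel u (c + y * I)‖ = Real.exp (u * c + c ^ 2) * Real.exp (-1 * y ^ 2) := by
  unfold expKernel
  rw [norm_exp, ← Real.exp_add]
  congr 1
  simp [sq]
  ring

lemma differentiable_expKernel (u : ℝ) : Differentiable ℂ (expKernel u) := by
  unfold expKernel; fun_prop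

lemma continuous_expKernel_line (u c : ℝ) : Continuous fun y : ℝ => expKernel u (c + y * I) := by
  unfold expKernel; fun_prop

lemma integrable_expKernel_mul {F : ℝ → ℂ} (u c B : ℝ) (hF : Continuous F)
    (hB : ∀ y, ‖F y‖ ≤ B) : Integrable fun y : ℝ => F y * expKernel u (c + y * I) := by
  have hg : Integrable fun y : ℝ => B * (Real.exp (u * c + c ^ 2) * Real.exp (-1 * y ^ 2)) :=
    ((integrable_exp_neg_mul_sq one_pos).const_mul _).const_mul _
  refine hg.mono' (hF.mul (continuous_expKernel_line u c)).aestronglyMeasurable ?_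
  filter_upwards with y
  rw [norm_mul, norm_expKernel]
  gcongr
  exact hB y

/-- The Gaussian density `exp (- v ^ 2 / 4) / (2 √π)`. -/
noncomputable def gaussDensity (v : ℝ) : ℝ := Real.exp (-(1 / 4) * v ^ 2) / (2 * Real.sqrt Real.pi)

lemma gaussDensity_nonneg (v : ℝ) : 0 ≤ gaussDensity v := by unfold gaussDensity; positivity

lemma integrable_gaussDensity : Integrable gaussDensity :=
  (integrable_exp_neg_mul_sq (by norm_num)).div_const _

lemma integral_gaussDensity : ∫ v, gaussDensity v = 1 := by
  unfold gaussDensity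
  rw [integral_div, integral_gaussian, show Real.pi / (1 / 4) = 2 ^ 2 * Real.pi by ring,
    Real.sqrt_mul (by positivity), Real.sqrt_sq (by positivity)]
  exact div_self (by positivity)

lemma integral_expKernel (u c : ℝ) :
    ∫ y : ℝ, expKernel u (c + y * I) = 2 * Real.pi * gaussDensity u := by
  have h := integral_cexp_quadratic (b := -1) (by simp) ((u + 2 * c) * I) (u * c + c ^ 2)
  have e : (fun y : ℝ => expKernel u (c + y * I)) = fun y : ℝ =>
      exp (-1 * (y : ℂ) ^ 2 + (u + 2 * c) * I * y + (u * c + c ^ 2)) := by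
    ext y
    unfold expKernel
    congr 1
    linear_combination (y : ℂ) ^ 2 * I_sq
  rw [e, h, neg_neg, div_one]
  have h2 : ((u : ℂ) * c + c ^ 2 - ((u + 2 * c) * I) ^ 2 / (4 * -1)) = ((-(1 / 4) * u ^ 2 : ℝ) : ℂ) := by
    rw [mul_pow, I_sq]; push_cast; ring
  have h3 : (Real.pi : ℂ) ^ (1 / 2 : ℂ) = (Real.sqrt Real.pi : ℂ) := by
    rw [Real.sqrt_eq_rpow, ofReal_cpow Real.pi_pos.le]; norm_num
  rw [h2, h3, ← ofReal_exp, ← ofReal_mul]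
  unfold gaussDensity
  rw [← ofReal_ofNat 2, ← ofReal_mul, ← ofReal_mul]
  congr 1
  have h4 : Real.sqrt Real.pi * Real.sqrt Real.pi = Real.pi := Real.mul_self_sqrt Real.pi_pos.le
  have h5 : Real.sqrt Real.pi ≠ 0 := by positivity
  field_simp
  linear_combination h4

/-- The distribution function of `gaussDensity`. -/
noncomputable def gaussCDF (v : ℝ) : ℝ := ∫ x in Set.Iic v, gaussDensity x

lemma gaussCDF_nonneg (v : ℝ) : 0 ≤ gaussCDF v := integral_nonneg gaussDensity_nonneg

lemma gaussCDF_add_neg (v : ℝ) : gaussCDF v + gaussCDF (-v) = 1 := by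
  have h : gaussCDF (-v) = ∫ x in Set.Ioi v, gaussDensity x := by
    have := integral_comp_neg_Iic (-v) gaussDensity
    rw [neg_neg] at this
    rw [← this]
    unfold gaussCDF gaussDensity
    simp
  rw [h, ← integral_gaussDensity]
  exact intervalIntegral.integral_Iic_add_Ioi integrable_gaussDensity.integrableOn
    integrable_gaussDensity.integrableOn

lemma gaussCDF_le_one (v : ℝ) : gaussCDF v ≤ 1 := by
  linarith [gaussCDF_nonneg (-v), gaussCDF_add_neg v]

lemma gaussCDF_mono {v w : ℝ} (h : v ≤ w) : gaussCDF v ≤ gaussCDF w :=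
  setIntegral_mono_set integrable_gaussDensity.integrableOn
    (Filter.Eventually.of_forall gaussDensity_nonneg) (Set.Iic_subset_Iic.mpr h).eventuallyLE

lemma line_ne_zero {c : ℝ} (hc : c ≠ 0) (y : ℝ) : (c : ℂ) + y * I ≠ 0 := by
  intro h
  have := congrArg re h
  simp at this
  exact hc this

lemma abs_le_norm_line (c y : ℝ) : |c| ≤ ‖(c : ℂ) + y * I‖ := by
  simpa using abs_re_le_norm ((c : ℂ) + y * I)

/-- For Re w > 0, e^{vw}/w is the integral of e^{xw} over x ≤ v. Fubini and `integral_expKernel`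
turn the vertical integral into the integral of the density up to v. -/
lemma gaussCDF_eq_integral (v : ℝ) {c : ℝ} (hc : 0 < c) :
    ∫ y : ℝ, (1 / (c + y * I)) * expKernel v (c + y * I) = 2 * Real.pi * gaussCDF v := by
  set ψ : ℝ → ℝ → ℂ := fun x y => exp (((c : ℂ) + y * I) * x) * expKernel 0 (c + y * I) with hψ
  have hK : ∀ x y : ℝ, ψ x y = expKernel x (c + y * I) := by
    intro x y
    simp only [hψ, expKernel]
    rw [← exp_add]
    congr 1
    push_cast; ring
  have hint : Integrable (Function.uncurry ψ) ((volume.restrict (Set.Iic v)).prod volume) := by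
    have h1 : Integrable (fun z : ℝ × ℝ => (exp ((c : ℂ) * z.1)) * expKernel 0 (c + z.2 * I))
        ((volume.restrict (Set.Iic v)).prod volume) := by
      refine Integrable.mul_prod (f := fun x : ℝ => exp ((c : ℂ) * x))
        (g := fun y : ℝ => expKernel 0 (c + y * I)) ?_ ?_
      · exact integrableOn_exp_mul_complex_Iic (by simpa using hc) v
      · simpa using integrable_expKernel_mul (F := fun _ => 1) 0 c 1 continuous_const (by simp)
    refine h1.norm.mono' ?_ ?_
    · refine Continuous.aestronglyMeasurable ?_
      simp only [hψ, Function.uncurry_def, expKernel]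
      fun_prop
    · filter_upwards with z
      simp only [hψ, Function.uncurry_def, norm_mul, norm_exp]
      simp
  have hsw := integral_integral_swap hint
  have h1 : ∫ x in Set.Iic v, ∫ y : ℝ, ψ x y = 2 * Real.pi * gaussCDF v := by
    simp_rw [hK, integral_expKernel]
    rw [integral_const_mul]
    congr 1
    exact integral_ofReal (𝕜 := ℂ)
  rw [← h1, hsw]
  refine integral_congr_ae (Filter.Eventually.of_forall fun y => ?_)
  simp only [hψ]
  rw [integral_mul_const, integral_exp_mul_complex_Iic (by simpa using hc)]
  simp only [expKernel]
  rw [one_div_mul_eq_div, div_mul_eq_mul_div, ← exp_add]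
  congr 2
  push_cast; ring

lemma integral_gaussian_one_lt : ∫ y : ℝ, Real.exp (-1 * y ^ 2) ≤ 2 := by
  rw [integral_gaussian, div_one, Real.sqrt_le_left (by norm_num)]
  linarith [Real.pi_le_four]

/-- A Chernoff bound with free parameter c, read off from the contour integral on Re w = c by
absolute values. -/
lemma gaussCDF_le (v : ℝ) {c : ℝ} (hc : 0 < c) :
    gaussCDF v ≤ Real.exp (v * c + c ^ 2) / c := by
  have h := gaussCDF_eq_integral v hc
  have h2 : ‖∫ y : ℝ, (1 / (c + y * I)) * expKernel v (c + y * I)‖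
      ≤ ∫ y : ℝ, Real.exp (v * c + c ^ 2) / c * Real.exp (-1 * y ^ 2) := by
    refine norm_integral_le_of_norm_le ((integrable_exp_neg_mul_sq one_pos).const_mul _) ?_
    filter_upwards with y
    rw [norm_mul, norm_expKernel, norm_div, norm_one]
    have := abs_le_norm_line c y
    rw [abs_of_pos hc] at this
    have h3 : 1 / ‖(c : ℂ) + y * I‖ ≤ 1 / c := one_div_le_one_div_of_le hc this
    calc _ ≤ 1 / c * (Real.exp (v * c + c ^ 2) * Real.exp (-1 * y ^ 2)) := by gcongr
      _ = _ := by ring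
  rw [h, integral_const_mul, norm_mul, norm_mul, norm_real, norm_real, Real.norm_eq_abs,
    Real.norm_eq_abs, abs_of_pos Real.pi_pos, abs_of_nonneg (gaussCDF_nonneg v)] at h2
  have h3 := integral_gaussian_one_lt
  have h4 : 0 ≤ Real.exp (v * c + c ^ 2) / c := by positivity
  have h5 := gaussCDF_nonneg v
  have h6 := Real.pi_gt_three
  simp only [RCLike.norm_ofNat] at h2
  nlinarith

/-! ### Smooth truncations of the Dirichlet series of -ζ'/ζ. -/

open ArithmeticFunction in
/-- The smoothed Dirichlet series `∑ Λ(n) gaussCDF(u - log n) n^{-s}`. -/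
noncomputable def smoothLambda (u : ℝ) (s : ℂ) : ℂ :=
  LSeries (fun n => (vonMangoldt n : ℂ) * (gaussCDF (u - Real.log n) : ℂ)) s

-- The weight `gaussCDF (u - log n)` is O(n^{-c}) for every c > 0, so the series converges
-- absolutely in the whole plane.
open ArithmeticFunction in
lemma LSeriesSummable_smoothLambda (u : ℝ) (s : ℂ) :
    LSeriesSummable (fun n => (vonMangoldt n : ℂ) * (gaussCDF (u - Real.log n) : ℂ)) s := by
  obtain ⟨c, hc, hc1⟩ : ∃ c : ℝ, 0 < c ∧ 1 < s.re + c := ⟨max 1 (2 - s.re), by positivity, by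
    have := le_max_right (1 : ℝ) (2 - s.re); linarith⟩
  have h1 := (LSeriesSummable_vonMangoldt (s := s + c) (by simpa using hc1)).norm.mul_left
    (Real.exp (u * c + c ^ 2) / c)
  refine Summable.of_norm_bounded h1 fun n => ?_
  rcases eq_or_ne n 0 with rfl | hn
  · simp
  have hn0 : (0 : ℝ) < n := by positivity
  rw [LSeries.norm_term_eq, LSeries.norm_term_eq, if_neg hn, if_neg hn, norm_mul, norm_real,
    norm_real, Real.norm_eq_abs (gaussCDF _), abs_of_nonneg (gaussCDF_nonneg _)]
  have h2 := gaussCDF_le (u - Real.log n) hc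
  have h3 : Real.exp ((u - Real.log n) * c + c ^ 2) / c
      = Real.exp (u * c + c ^ 2) / c * ((n : ℝ) ^ c)⁻¹ := by
    rw [← Real.rpow_neg hn0.le, Real.rpow_def_of_pos hn0, div_mul_eq_mul_div, ← Real.exp_add]
    congr 2; ring
  rw [h3] at h2
  rw [add_re, ofReal_re, Real.rpow_add hn0]
  calc _ ≤ ‖vonMangoldt n‖ * (Real.exp (u * c + c ^ 2) / c * ((n : ℝ) ^ c)⁻¹) / (n : ℝ) ^ s.re := by
        gcongr
    _ = _ := by field_simp

lemma differentiable_smoothLambda (u : ℝ) : Differentiable ℂ (smoothLambda u) := by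
  intro s
  refine (LSeries_hasDerivAt ?_).differentiableAt
  refine (LSeriesSummable_smoothLambda u (s - 1)).abscissaOfAbsConv_le.trans_lt ?_
  simp only [sub_re, one_re]
  exact_mod_cast sub_one_lt s.re

-- Perron's formula with the kernel e^{uw + w²}/w: expand -ζ'/ζ and integrate term by term. The n-th
-- term shifts u to u - log n, and `gaussCDF_eq_integral` evaluates it.
open ArithmeticFunction in
lemma smoothLambda_eq_integral (u : ℝ) {s : ℂ} {c : ℝ} (hc : 0 < c) (hs : 1 < s.re + c) :
    ∫ y : ℝ, (-logDeriv riemannZeta (s + (c + y * I)) / (c + y * I)) * expKernel u (c + y * I)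
      = 2 * Real.pi * smoothLambda u s := by
  have hre : ∀ y : ℝ, 1 < (s + (c + y * I)).re := by intro y; simpa using hs
  set F : ℕ → ℝ → ℂ := fun n y => LSeries.term (fun n => (vonMangoldt n : ℂ)) (s + (c + y * I)) n *
    ((1 / (c + y * I)) * expKernel u (c + y * I)) with hF
  have hnorm : ∀ (n : ℕ) (y : ℝ), ‖LSeries.term (fun n => (vonMangoldt n : ℂ)) (s + (c + y * I)) n‖
      = ‖LSeries.term (fun n => (vonMangoldt n : ℂ)) (s + c) n‖ := by
    intro n y
    rw [LSeries.norm_term_eq, LSeries.norm_term_eq]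
    simp
  have hcont : ∀ n : ℕ, Continuous fun y : ℝ =>
      LSeries.term (fun n => (vonMangoldt n : ℂ)) (s + (c + y * I)) n := by
    intro n
    rcases eq_or_ne n 0 with rfl | hn
    · simp only [LSeries.term_zero]; exact continuous_const
    · have hn' : (n : ℂ) ≠ 0 := by exact_mod_cast hn
      simp only [LSeries.term_of_ne_zero hn]
      refine continuous_const.div ?_ fun y => by simp [cpow_eq_zero_iff, hn']
      exact Continuous.const_cpow (by fun_prop) (Or.inl hn')
  have hcont2 : Continuous fun y : ℝ => 1 / ((c : ℂ) + y * I) :=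
    continuous_const.div (by fun_prop) (line_ne_zero hc.ne')
  have hb2 : ∀ y : ℝ, ‖1 / ((c : ℂ) + y * I)‖ ≤ 1 / c := by
    intro y
    rw [norm_div, norm_one]
    have := abs_le_norm_line c y
    rw [abs_of_pos hc] at this
    exact one_div_le_one_div_of_le hc this
  have hint : ∀ n, Integrable (F n) := by
    intro n
    have := integrable_expKernel_mul u c
      (‖LSeries.term (fun n => (vonMangoldt n : ℂ)) (s + c) n‖ * (1 / c))
      ((hcont n).mul hcont2) (fun y => by
        rw [Pi.mul_apply, norm_mul, hnorm]
        exact mul_le_mul_of_nonneg_left (hb2 y) (norm_nonneg _))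
    simpa only [hF, Pi.mul_apply, mul_assoc] using this
  have hsumm : Summable fun n => ∫ y, ‖F n y‖ := by
    have h1 : ∀ n, ∫ y, ‖F n y‖ = ‖LSeries.term (fun n => (vonMangoldt n : ℂ)) (s + c) n‖ *
        ∫ y : ℝ, ‖(1 / ((c : ℂ) + y * I)) * expKernel u (c + y * I)‖ := by
      intro n
      rw [← integral_const_mul]
      refine integral_congr_ae (Filter.Eventually.of_forall fun y => ?_)
      simp only [hF]
      rw [norm_mul, hnorm]
    simp_rw [h1]
    exact (LSeriesSummable_vonMangoldt (s := s + c) (by simpa using hs)).norm.mul_right _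
  have hmain := hasSum_integral_of_summable_integral_norm hint hsumm
  have hR : ∀ y, ∑' n, F n y =
      (-logDeriv riemannZeta (s + (c + y * I)) / (c + y * I)) * expKernel u (c + y * I) := by
    intro y
    simp only [hF]
    rw [tsum_mul_right]
    have := LSeries_vonMangoldt_eq_deriv_riemannZeta_div (hre y)
    rw [LSeries] at this
    rw [this, logDeriv_apply]
    ring
  simp_rw [hR] at hmain
  rw [← hmain.tsum_eq, smoothLambda, LSeries, ← tsum_mul_left]
  refine tsum_congr fun n => ?_
  rcases eq_or_ne n 0 with rfl | hn
  · simp [hF]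
  have hn0 : (0 : ℝ) < n := by positivity
  have hn' : (n : ℂ) ≠ 0 := by exact_mod_cast hn
  rw [LSeries.term_of_ne_zero hn]
  have h2 : ∀ y : ℝ, F n y = (vonMangoldt n / (n : ℂ) ^ s) *
      ((1 / (c + y * I)) * expKernel (u - Real.log n) (c + y * I)) := by
    intro y
    simp only [hF]
    rw [LSeries.term_of_ne_zero hn, cpow_add _ _ hn']
    have h3 : expKernel (u - Real.log n) (c + y * I) =
        expKernel u (c + y * I) / (n : ℂ) ^ ((c : ℂ) + y * I) := by
      rw [cpow_def_of_ne_zero hn', expKernel, expKernel, ← exp_sub, ← natCast_log]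
      congr 1
      push_cast; ring
    rw [h3]
    field_simp
  simp_rw [h2]
  rw [integral_const_mul, gaussCDF_eq_integral _ hc]
  ring

/-! ### Contour shifts up to the nearby zeros. -/

/-- Shifting the contour of a Gaussian-weighted vertical integral from `Re w = 2` to `Re w = a`,
below height `H`. -/
lemma norm_integral_mul_expKernel_le {F : ℂ → ℂ} {a H B u : ℝ} (ha : -1 ≤ a) (ha1 : a ≤ 1)
    (hu : 0 ≤ u) (hH : 0 ≤ H)
    (hF : DifferentiableOn ℂ F (Set.Icc a 2 ×ℂ Set.Icc (-H) H))
    (hleft : ∀ y ∈ Set.Icc (-H) H, ‖F (a + y * I)‖ ≤ B)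
    (htop : ∀ x ∈ Set.Icc a 2, ‖F (x + H * I)‖ ≤ B)
    (hbot : ∀ x ∈ Set.Icc a 2, ‖F (x + (-H : ℝ) * I)‖ ≤ B)
    (hcont : Continuous fun y : ℝ => F ((2 : ℝ) + y * I))
    (hright : ∀ y : ℝ, ‖F ((2 : ℝ) + y * I)‖ ≤ B) :
    ‖∫ y : ℝ, F ((2 : ℝ) + y * I) * expKernel u ((2 : ℝ) + y * I)‖
      ≤ 9 * B * (Real.exp (u * a) + Real.exp (2 * u + 4 - H ^ 2 / 2)) := by
  have hB0 : 0 ≤ B := (norm_nonneg _).trans (hright 0)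
  set f : ℝ → ℂ := fun y => F ((2 : ℝ) + y * I) * expKernel u ((2 : ℝ) + y * I) with hf
  have hfint : Integrable f := integrable_expKernel_mul u 2 B hcont hright
  have hHH : -H ≤ H := by linarith
  have hrect := integral_boundary_rect_eq_zero_of_differentiableOn
    (fun w => F w * expKernel u w) ⟨a, -H⟩ ⟨2, H⟩ (by
      simp only [Set.uIcc_of_le (show a ≤ 2 by linarith), Set.uIcc_of_le hHH]
      exact hF.mul (differentiable_expKernel u).differentiableOn)
  simp only [smul_eq_mul] at hrect
  set X1 := ∫ x : ℝ in a..2, F (x + (-H : ℝ) * I) * expKernel u (x + (-H : ℝ) * I) with hX1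
  set X2 := ∫ x : ℝ in a..2, F (x + (H : ℝ) * I) * expKernel u (x + (H : ℝ) * I) with hX2
  set X3 := ∫ y : ℝ in (-H)..H, F ((2 : ℝ) + y * I) * expKernel u ((2 : ℝ) + y * I) with hX3
  set X4 := ∫ y : ℝ in (-H)..H, F (a + y * I) * expKernel u (a + y * I) with hX4
  -- The horizontal edges decay like e^{-H²}; this is weakened to e^{-H²/2}, which is what the tail
  -- of the line Re w = 2 yields.
  have hEH : Real.exp (2 * u + 4) * Real.exp (-1 * H ^ 2) ≤ Real.exp (2 * u + 4 - H ^ 2 / 2) := by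
    rw [← Real.exp_add]
    exact Real.exp_le_exp.mpr (by nlinarith [sq_nonneg H])
  have hhor : ∀ h : ℝ, h ^ 2 = H ^ 2 → (∀ x ∈ Set.Icc a 2, ‖F (x + h * I)‖ ≤ B) →
      ‖∫ x : ℝ in a..2, F (x + h * I) * expKernel u (x + h * I)‖
        ≤ B * Real.exp (2 * u + 4 - H ^ 2 / 2) * 3 := by
    intro h hh hb
    refine (intervalIntegral.norm_integral_le_of_norm_le_const (C := B * Real.exp (2 * u + 4 - H ^ 2 / 2)) ?_).trans ?_
    · intro x hx
      rw [Set.uIoc_of_le (by linarith)] at hx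
      rw [norm_mul, norm_expKernel, hh]
      refine mul_le_mul (hb x ⟨hx.1.le, hx.2⟩) (le_trans ?_ hEH) (by positivity) hB0
      have : u * x + x ^ 2 ≤ 2 * u + 4 := by nlinarith [hx.1, hx.2]
      gcongr
    · rw [abs_of_nonneg (by linarith)]
      have : 0 ≤ B * Real.exp (2 * u + 4 - H ^ 2 / 2) := by positivity
      nlinarith
  have hb1 := hhor (-H) (by ring) hbot
  have hb2 := hhor H rfl htop
  have hb4 : ‖X4‖ ≤ B * Real.exp (u * a) * 6 := by
    have h1 : ‖X4‖ ≤ ∫ y : ℝ in (-H)..H, B * Real.exp (u * a + a ^ 2) * Real.exp (-1 * y ^ 2) := by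
      refine intervalIntegral.norm_integral_le_of_norm_le hHH ?_ ?_
      · filter_upwards with y hy
        rw [norm_mul, norm_expKernel, mul_assoc]
        exact mul_le_mul_of_nonneg_right (hleft y ⟨hy.1.le, hy.2⟩) (by positivity)
      · exact (by fun_prop : Continuous fun y : ℝ => B * Real.exp (u * a + a ^ 2) * Real.exp (-1 * y ^ 2)).intervalIntegrable _ _
    have h2 : ∫ y : ℝ in (-H)..H, Real.exp (-1 * y ^ 2) ≤ 2 := by
      rw [intervalIntegral.integral_of_le hHH]
      refine le_trans (setIntegral_le_integral (integrable_exp_neg_mul_sq one_pos) ?_)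
        integral_gaussian_one_lt
      exact Eventually.of_forall fun y => (Real.exp_pos _).le
    rw [intervalIntegral.integral_const_mul] at h1
    have h3 : Real.exp (u * a + a ^ 2) ≤ 3 * Real.exp (u * a) := by
      rw [Real.exp_add, mul_comm]
      refine mul_le_mul_of_nonneg_right ?_ (Real.exp_nonneg _)
      have : Real.exp (a ^ 2) ≤ Real.exp 1 := Real.exp_le_exp.mpr (by nlinarith)
      linarith [Real.exp_one_lt_d9]
    have h0 : 0 ≤ ∫ y : ℝ in (-H)..H, Real.exp (-1 * y ^ 2) :=
      intervalIntegral.integral_nonneg hHH fun y _ => (Real.exp_pos _).le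
    calc ‖X4‖ ≤ _ := h1
      _ ≤ B * (3 * Real.exp (u * a)) * 2 := by gcongr
      _ = _ := by ring
  have hb3 : ‖X3‖ ≤ ‖X4‖ + ‖X1‖ + ‖X2‖ := by
    have h1 : I * X3 = I * X4 - X1 + X2 := by linear_combination hrect
    have h2 := congrArg norm h1
    rw [norm_mul, norm_I, one_mul] at h2
    rw [h2]
    refine (norm_add_le _ _).trans (add_le_add_left ((norm_sub_le _ _).trans ?_) _)
    rw [norm_mul, norm_I, one_mul]
  -- For |y| ≥ H half of the Gaussian exponent is spent on e^{-H²/2}; the other half keeps the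
  -- integral finite, with √(2π) ≤ 3.
  have htail : ‖(∫ y, f y) - X3‖ ≤ B * Real.exp (2 * u + 4 - H ^ 2 / 2) * 3 := by
    have h1 : (∫ y, f y) - X3 = ∫ y in (Set.Ioc (-H) H)ᶜ, f y := by
      rw [hX3, intervalIntegral.integral_of_le hHH,
        ← integral_add_compl (measurableSet_Ioc (a := -H) (b := H)) hfint]
      ring
    have hgi : Integrable fun y : ℝ => B * Real.exp (2 * u + 4 - H ^ 2 / 2) * Real.exp (-(1 / 2) * y ^ 2) :=
      (integrable_exp_neg_mul_sq (by norm_num)).const_mul _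
    rw [h1]
    refine (norm_integral_le_of_norm_le hgi.integrableOn ?_).trans ?_
    · rw [ae_restrict_iff' measurableSet_Ioc.compl]
      filter_upwards with y hy
      have hy2 : H ^ 2 ≤ y ^ 2 := by
        rw [sq_le_sq, abs_of_nonneg hH, le_abs]
        by_contra hcon
        push Not at hcon
        exact hy ⟨by linarith [hcon.2], hcon.1.le⟩
      simp only [hf]
      rw [norm_mul, norm_expKernel, mul_assoc]
      refine mul_le_mul (hright y) ?_ (by positivity) hB0
      rw [← Real.exp_add, ← Real.exp_add]
      exact Real.exp_le_exp.mpr (by nlinarith)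
    · refine (setIntegral_le_integral hgi (Eventually.of_forall fun y => by positivity)).trans ?_
      rw [integral_const_mul, integral_gaussian]
      refine mul_le_mul_of_nonneg_left ?_ (by positivity)
      rw [Real.sqrt_le_left (by norm_num)]
      linarith [Real.pi_le_four]
  have h5 : ‖∫ y, f y‖ ≤ ‖(∫ y, f y) - X3‖ + ‖X3‖ := by
    simpa using norm_add_le ((∫ y, f y) - X3) X3
  have hpos : 0 ≤ B * Real.exp (u * a) := by positivity
  nlinarith

/-- A half strip around height `t` in which `ζ` has no zeros and `ζ'/ζ` is bounded by `B`. -/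
structure ZetaLogDerivBound (σ t H B : ℝ) : Prop where
  lt : H < t
  ne_zero : ∀ z : ℂ, σ ≤ z.re → |z.im - t| ≤ H → riemannZeta z ≠ 0
  bound : ∀ z : ℂ, σ ≤ z.re → |z.im - t| ≤ H → ‖logDeriv riemannZeta z‖ ≤ B
  bound_right : ∀ z : ℂ, 2 ≤ z.re → ‖logDeriv riemannZeta z‖ ≤ B

lemma differentiableAt_logDeriv_riemannZeta {z : ℂ} (h1 : z ≠ 1) (h0 : riemannZeta z ≠ 0) :
    DifferentiableAt ℂ (logDeriv riemannZeta) z := by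
  have h2 : DifferentiableOn ℂ (deriv riemannZeta) {1}ᶜ :=
    differentiableOn_riemannZeta.deriv isOpen_compl_singleton
  exact (h2.differentiableAt (isOpen_compl_singleton.mem_nhds h1)).div
    (differentiableAt_riemannZeta h1) h0

namespace ZetaLogDerivBound

variable {σ t H B : ℝ}

lemma differentiableAt (h : ZetaLogDerivBound σ t H B) {z : ℂ} (h1 : σ ≤ z.re)
    (h2 : |z.im - t| ≤ H) : DifferentiableAt ℂ (logDeriv riemannZeta) z := by
  refine differentiableAt_logDeriv_riemannZeta ?_ (h.ne_zero z h1 h2)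
  rintro rfl
  rw [one_im, zero_sub, abs_neg] at h2
  linarith [h.lt, le_abs_self t]

lemma nonneg (h : ZetaLogDerivBound σ t H B) : 0 ≤ B :=
  (norm_nonneg _).trans (h.bound_right 2 (by norm_num))

lemma continuous_line {s : ℂ} (hs : 0 ≤ s.re) :
    Continuous fun y : ℝ => logDeriv riemannZeta (s + ((2 : ℝ) + y * I)) := by
  rw [continuous_iff_continuousAt]
  intro y
  have hre : (s + ((2 : ℝ) + y * I)).re = s.re + 2 := by simp
  have h2 : DifferentiableAt ℂ (logDeriv riemannZeta) (s + ((2 : ℝ) + y * I)) := by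
    refine differentiableAt_logDeriv_riemannZeta ?_ ?_
    · intro h
      rw [h, one_re] at hre
      linarith
    · exact riemannZeta_ne_zero_of_one_lt_re (by rw [hre]; linarith)
  exact ContinuousAt.comp (f := fun y : ℝ => s + ((2 : ℝ) + y * I)) h2.continuousAt (by fun_prop)

/-- The contour moves to Re w = a and stops to the right of the pole of 1/w, so only the growth
e^{ua} appears. The height H + 1 in the hypothesis allows s itself to be off by 1. -/
lemma norm_smoothLambda_le (h : ZetaLogDerivBound σ t (H + 1) B) {u a : ℝ} {s : ℂ}
    (hH : 1 ≤ H) (hu : 0 ≤ u) (ha : 0 < a) (ha1 : a ≤ 1) (hs : 0 ≤ s.re) (hs2 : σ ≤ s.re + a)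
    (hst : |s.im - t| ≤ 1) :
    ‖smoothLambda u s‖ ≤ 2 * (B / a) * (Real.exp (u * a) + Real.exp (2 * u + 4 - H ^ 2 / 2)) := by
  have hB := h.nonneg
  have hnorm : ∀ w : ℂ, a ≤ ‖w‖ → ‖logDeriv riemannZeta (s + w)‖ ≤ B →
      ‖-logDeriv riemannZeta (s + w) / w‖ ≤ B / a := by
    intro w hw hb
    rw [norm_div, norm_neg]
    gcongr
  have him : ∀ w : ℂ, |w.im| ≤ H → |(s + w).im - t| ≤ H + 1 := by
    intro w hw
    rw [add_im, add_sub_right_comm]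
    exact (abs_add_le _ _).trans (by linarith)
  have hline : ∀ x y : ℝ, a ≤ x → a ≤ ‖(x : ℂ) + y * I‖ := by
    intro x y hx
    have := abs_le_norm_line x y
    rw [abs_of_nonneg (by linarith)] at this
    linarith
  have key := norm_integral_mul_expKernel_le (F := fun w => -logDeriv riemannZeta (s + w) / w)
    (a := a) (H := H) (B := B / a) (u := u) (by linarith) ha1 hu (by linarith) ?_ ?_ ?_ ?_ ?_ ?_
  · rw [smoothLambda_eq_integral u (by norm_num) (by linarith), norm_mul, norm_mul, norm_real,
      Real.norm_eq_abs, abs_of_pos Real.pi_pos] at key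
    simp only [RCLike.norm_ofNat] at key
    have h3 : 0 ≤ B / a * (Real.exp (u * a) + Real.exp (2 * u + 4 - H ^ 2 / 2)) := by positivity
    nlinarith [Real.pi_gt_three, norm_nonneg (smoothLambda u s)]
  · intro w hw
    obtain ⟨hw1, hw2⟩ := mem_reProdIm.mp hw
    have h1 := h.differentiableAt (z := s + w) (by rw [add_re]; linarith [hw1.1])
      (him w (abs_le.mpr hw2))
    refine (DifferentiableAt.div ?_ differentiableAt_id ?_).differentiableWithinAt
    · exact (DifferentiableAt.comp w h1 (differentiableAt_id.const_add s)).neg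
    · rintro rfl
      simp only [zero_re] at hw1
      linarith [hw1.1]
  · intro y hy
    refine hnorm _ (hline _ _ le_rfl) (h.bound _ (by simpa using hs2) (him _ (by simpa using abs_le.mpr hy)))
  · intro x hx
    refine hnorm _ (hline _ _ hx.1) (h.bound _ (by simp; linarith [hx.1]) (him _ ?_))
    simp [abs_of_nonneg (show 0 ≤ H by linarith)]
  · intro x hx
    refine hnorm _ (hline _ _ hx.1) (h.bound _ (by simp; linarith [hx.1]) (him _ ?_))
    simp [abs_of_nonneg (show 0 ≤ H by linarith)]
  · exact (continuous_line hs).neg.div (by fun_prop) (line_ne_zero two_ne_zero)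
  · intro y
    exact hnorm _ (hline _ _ (by linarith)) (h.bound_right _ (by simpa using hs))

/-- The contour crosses w = 0. Instead of collecting a residue, the value G(0) = (ζ'/ζ)(s) is
subtracted first: (G(w) - G(0))/w is holomorphic, and its integral over Re w = -δ is O(e^{-uδ}). The
subtracted part is an explicit multiple of `gaussCDF u`. -/
lemma norm_smoothLambda_add_logDeriv_le (h : ZetaLogDerivBound σ t (H + 1) B) (hσ : 0 ≤ σ)
    {u δ : ℝ} {s : ℂ} (hH : 1 ≤ H) (hu : 0 ≤ u) (hδ : 0 < δ) (hδ1 : δ ≤ 1) (hs2 : σ ≤ s.re - δ)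
    (hst : |s.im - t| ≤ 1) :
    ‖smoothLambda u s + logDeriv riemannZeta s‖
      ≤ 7 * (B / δ) * (Real.exp (-(u * δ)) + Real.exp (2 * u + 4 - H ^ 2 / 2)) := by
  have hB := h.nonneg
  have hs : 0 ≤ s.re := by linarith
  set G : ℂ → ℂ := fun w => logDeriv riemannZeta (s + w) with hG
  have him : ∀ w : ℂ, |w.im| ≤ H → |(s + w).im - t| ≤ H + 1 := by
    intro w hw
    rw [add_im, add_sub_right_comm]
    exact (abs_add_le _ _).trans (by linarith)
  have hG0 : ‖G 0‖ ≤ B := h.bound _ (by simp; linarith) (him 0 (by simp; linarith))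
  set F : ℂ → ℂ := fun w => -dslope G 0 w with hF
  have hFw : ∀ w : ℂ, w ≠ 0 → F w = -(G w - G 0) / w := by
    intro w hw
    simp only [hF]
    rw [dslope_of_ne _ hw, slope_def_field, sub_zero, neg_div]
  have hnorm : ∀ w : ℂ, δ ≤ ‖w‖ → ‖G w‖ ≤ B → ‖F w‖ ≤ 2 * B / δ := by
    intro w hw hb
    rw [hFw w (norm_pos_iff.mp (hδ.trans_le hw)), norm_div, norm_neg]
    have : ‖G w - G 0‖ ≤ 2 * B := (norm_sub_le _ _).trans (by linarith)
    gcongr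
  have hline : ∀ x y : ℝ, δ ≤ |x| → δ ≤ ‖(x : ℂ) + y * I‖ := fun x y hx =>
    hx.trans (abs_le_norm_line x y)
  have hline' : ∀ x y : ℝ, |y| = H → δ ≤ ‖(x : ℂ) + y * I‖ := by
    intro x y hy
    refine le_trans ?_ (abs_im_le_norm _)
    simp [hy]; linarith
  have key := norm_integral_mul_expKernel_le (F := F)
    (a := -δ) (H := H) (B := 2 * B / δ) (u := u) (by linarith) (by linarith) hu (by linarith)
    ?_ ?_ ?_ ?_ ?_ ?_
  · have hI : ∫ y : ℝ, F ((2 : ℝ) + y * I) * expKernel u ((2 : ℝ) + y * I)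
        = 2 * Real.pi * (smoothLambda u s + G 0 * gaussCDF u) := by
      have h1 : ∀ y : ℝ, F ((2 : ℝ) + y * I) * expKernel u ((2 : ℝ) + y * I) =
          (-logDeriv riemannZeta (s + ((2 : ℝ) + y * I)) / ((2 : ℝ) + y * I)) *
            expKernel u ((2 : ℝ) + y * I) +
          G 0 * ((1 / ((2 : ℝ) + y * I)) * expKernel u ((2 : ℝ) + y * I)) := by
        intro y
        rw [hFw _ (line_ne_zero two_ne_zero y)]
        simp only [hG]
        ring
      simp_rw [h1]
      rw [integral_add, integral_const_mul, smoothLambda_eq_integral u (by norm_num) (by linarith),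
        gaussCDF_eq_integral u (by norm_num)]
      · ring
      · refine integrable_expKernel_mul u 2 B ((continuous_line hs).neg.div (by fun_prop)
          (line_ne_zero two_ne_zero)) fun y => ?_
        rw [norm_div, norm_neg]
        have h2 := abs_le_norm_line 2 y
        rw [abs_of_pos two_pos] at h2
        refine (div_le_self (norm_nonneg _) (by linarith)).trans (h.bound_right _ (by simpa using hs))
      · refine (integrable_expKernel_mul u 2 1 (continuous_const.div (by fun_prop)
          (line_ne_zero two_ne_zero)) fun y => ?_).const_mul _
        have h2 := abs_le_norm_line 2 y
        rw [abs_of_pos two_pos] at h2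
        rw [Pi.div_apply, norm_div, norm_one]
        exact (div_le_one (by linarith)).mpr (by linarith)
    rw [hI, norm_mul, norm_mul, norm_real, Real.norm_eq_abs, abs_of_pos Real.pi_pos] at key
    simp only [RCLike.norm_ofNat] at key
    have hG0' : G 0 = logDeriv riemannZeta s := by simp [hG]
    -- The integral produces G(0) with weight `gaussCDF u` rather than 1; the deficit `gaussCDF
    -- (-u)` is exponentially small.
    have h2 : smoothLambda u s + logDeriv riemannZeta s =
        (smoothLambda u s + G 0 * gaussCDF u) + G 0 * (gaussCDF (-u) : ℝ) := by
      have := gaussCDF_add_neg u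
      rw [← hG0', add_assoc, ← mul_add, ← ofReal_add, this]; simp
    have h3 : ‖G 0 * (gaussCDF (-u) : ℝ)‖ ≤ 3 * (B / δ) * Real.exp (-(u * δ)) := by
      rw [norm_mul, norm_real, Real.norm_eq_abs, abs_of_nonneg (gaussCDF_nonneg _)]
      have h4 := gaussCDF_le (-u) one_pos
      rw [mul_one, one_pow, div_one, Real.exp_add] at h4
      have h5 : Real.exp (-u) ≤ Real.exp (-(u * δ)) := Real.exp_le_exp.mpr (by nlinarith)
      have h6 : gaussCDF (-u) ≤ 3 * Real.exp (-(u * δ)) := by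
        nlinarith [Real.exp_one_lt_d9, Real.exp_pos (-u)]
      have h7 : B ≤ B / δ := by rw [le_div_iff₀ hδ]; nlinarith
      calc _ ≤ (B / δ) * (3 * Real.exp (-(u * δ))) := by
            refine mul_le_mul (hG0.trans h7) h6 (gaussCDF_nonneg _) (by positivity)
        _ = _ := by ring
    rw [h2]
    refine (norm_add_le _ _).trans ?_
    rw [mul_neg] at key
    have h8 : 0 ≤ B / δ * Real.exp (2 * u + 4 - H ^ 2 / 2) := by positivity
    have h9 : 0 ≤ B / δ * Real.exp (-(u * δ)) := by positivity
    have h10 : 2 * B / δ = 2 * (B / δ) := by ring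
    rw [h10] at key
    nlinarith [Real.pi_gt_three, norm_nonneg (smoothLambda u s + G 0 * gaussCDF u)]
  · have hnhds : Set.Icc (-δ) 2 ×ℂ Set.Icc (-H) H ∈ 𝓝 (0 : ℂ) := by
      refine mem_of_superset ((isOpen_Ioo (a := -δ) (b := 2)).reProdIm
        (isOpen_Ioo (a := -H) (b := H)) |>.mem_nhds ?_) ?_
      · exact mem_reProdIm.mpr ⟨⟨by simpa using hδ, by simp⟩, by simp; linarith, by simp; linarith⟩
      · intro z hz
        obtain ⟨h1, h2⟩ := mem_reProdIm.mp hz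
        exact mem_reProdIm.mpr ⟨⟨h1.1.le, h1.2.le⟩, h2.1.le, h2.2.le⟩
    refine ((differentiableOn_dslope hnhds).mpr ?_).neg
    intro w hw
    obtain ⟨hw1, hw2⟩ := mem_reProdIm.mp hw
    have h1 := h.differentiableAt (z := s + w) (by rw [add_re]; linarith [hw1.1])
      (him w (abs_le.mpr hw2))
    exact (DifferentiableAt.comp w h1 (differentiableAt_id.const_add s)).differentiableWithinAt
  · intro y hy
    refine hnorm _ (hline _ _ (by rw [abs_neg, abs_of_pos hδ])) (h.bound _ (by simp; linarith)
      (him _ (by simpa using abs_le.mpr hy)))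
  · intro x hx
    refine hnorm _ (hline' _ _ (abs_of_nonneg (by linarith))) (h.bound _ (by simp; linarith [hx.1]) (him _ ?_))
    simp [abs_of_nonneg (show 0 ≤ H by linarith)]
  · intro x hx
    refine hnorm _ (hline' _ _ (by rw [abs_neg, abs_of_nonneg (by linarith)]))
      (h.bound _ (by simp; linarith [hx.1]) (him _ ?_))
    simp [abs_of_nonneg (show 0 ≤ H by linarith)]
  · have : (fun y : ℝ => F ((2 : ℝ) + y * I)) = fun y : ℝ =>
        -(logDeriv riemannZeta (s + ((2 : ℝ) + y * I)) - G 0) / ((2 : ℝ) + y * I) :=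
      funext fun y => hFw _ (line_ne_zero two_ne_zero y)
    rw [this]
    exact ((continuous_line hs).sub continuous_const).neg.div (by fun_prop)
      (line_ne_zero two_ne_zero)
  · intro y
    exact hnorm _ (hline _ _ (by norm_num; linarith)) (h.bound_right _ (by simpa using hs))

end ZetaLogDerivBound

/-! ### One-sided power sums and higher derivatives. -/

lemma norm_pow_sub_one_le {q : ℂ} (hq : ‖q‖ ≤ 1) (J : ℕ) : ‖q ^ J - 1‖ ≤ J * ‖q - 1‖ := by
  rw [← geom_sum_mul, norm_mul]
  gcongr
  refine (norm_sum_le _ _).trans ?_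
  simpa using Finset.sum_le_card_nsmul (Finset.range J) (fun i => ‖q ^ i‖) 1 (fun i _ => by
    rw [norm_pow]; exact pow_le_one₀ (norm_nonneg _) hq)

/-- Powers of a complex number whose argument is small compared with `1 / J`. -/
lemma re_inv_pow_ge {X Y : ℝ} {J : ℕ} (hX : 0 < X) (hY : J * |Y| ≤ X / 3) :
    2 / 3 * (X⁻¹) ^ J ≤ (((X : ℂ) + Y * I)⁻¹ ^ J).re := by
  -- After X is scaled out, q lies within |Y|/X of 1 in the unit disc, so q^J lies within J|Y|/X ≤
  -- 1/3 of 1.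
  set q : ℂ := (1 + (Y / X : ℝ) * I)⁻¹ with hq
  have hXc : (X : ℂ) ≠ 0 := by exact_mod_cast hX.ne'
  have hne : (1 + (Y / X : ℝ) * I : ℂ) ≠ 0 := by
    have := line_ne_zero one_ne_zero (Y / X)
    simpa using this
  have h1 : (1 : ℝ) ≤ ‖(1 + (Y / X : ℝ) * I : ℂ)‖ := by
    simpa using abs_le_norm_line 1 (Y / X)
  have hqn : ‖q‖ ≤ 1 := by
    rw [hq, norm_inv]
    exact inv_le_one_of_one_le₀ h1
  have hq1 : ‖q - 1‖ ≤ |Y| / X := by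
    have : q - 1 = -((Y / X : ℝ) * I) * q := by
      rw [hq]; field_simp; ring
    rw [this, norm_mul, norm_neg, norm_mul, norm_I, mul_one, norm_real, Real.norm_eq_abs, abs_div,
      abs_of_pos hX]
    exact mul_le_of_le_one_right (by positivity) hqn
  have h2 := norm_pow_sub_one_le hqn J
  have h3 : (J : ℝ) * ‖q - 1‖ ≤ 1 / 3 := by
    calc (J : ℝ) * ‖q - 1‖ ≤ J * (|Y| / X) := by gcongr
      _ = J * |Y| / X := by ring
      _ ≤ 1 / 3 := by rw [div_le_iff₀ hX]; linarith
  have h4 : 2 / 3 ≤ (q ^ J).re := by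
    have := (abs_le.mp ((abs_re_le_norm (q ^ J - 1)).trans (h2.trans h3))).1
    rw [sub_re, one_re] at this
    linarith
  have h5 : ((X : ℂ) + Y * I)⁻¹ ^ J = ((X⁻¹ ^ J : ℝ) : ℂ) * q ^ J := by
    rw [hq]
    push_cast
    rw [← mul_pow, ← mul_inv]
    congr 2
    field_simp
  rw [h5, re_ofReal_mul, mul_comm]
  have : 0 < X⁻¹ ^ J := by positivity
  nlinarith

/-- **A one-sided power sum estimate.** -/
lemma le_norm_sum_inv_pow {Z : Multiset ℂ} {s₀ ρ₀ : ℂ} {J : ℕ} {p D : ℝ} (hp : 0 < p) (hD : 0 < D)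
    (hρ₀ : ρ₀ ∈ Z) (h₀ : ρ₀.im - s₀.im = p) (h₀' : J * |s₀.re - ρ₀.re| ≤ p / 3)
    (hZ : ∀ ρ ∈ Z, (p ≤ ρ.im - s₀.im ∧ J * |s₀.re - ρ.re| ≤ p / 3) ∨ D ≤ ‖s₀ - ρ‖) :
    2 / 3 * (p⁻¹) ^ J - Multiset.card Z * (D⁻¹) ^ J
      ≤ ‖(Z.map fun ρ => ((s₀ - ρ)⁻¹) ^ J).sum‖ := by
  set X : ℂ → ℝ := fun ρ => ρ.im - s₀.im with hX
  set Y : ℂ → ℝ := fun ρ => s₀.re - ρ.re with hY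
  -- Rotating by i turns height above s₀ into the real part X and horizontal offset into Y. It
  -- changes the sum of J-th powers only by a factor of modulus one.
  have hXY : ∀ ρ, I * (s₀ - ρ) = (X ρ : ℂ) + Y ρ * I := by
    intro ρ
    apply Complex.ext <;> simp [hX, hY]
  have hpow : ∀ ρ, ((X ρ : ℂ) + Y ρ * I)⁻¹ ^ J = (I⁻¹) ^ J * ((s₀ - ρ)⁻¹) ^ J := by
    intro ρ
    rw [← hXY, mul_inv, mul_pow]
  have hnn : ∀ ρ ∈ Z, -(D⁻¹) ^ J ≤ (((X ρ : ℂ) + Y ρ * I)⁻¹ ^ J).re := by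
    intro ρ hρ
    rcases hZ ρ hρ with ⟨h1, h2⟩ | h1
    · have hx : 0 < X ρ := hp.trans_le h1
      refine le_trans ?_ (re_inv_pow_ge hx (h2.trans (by gcongr)))
      have : 0 ≤ (D⁻¹) ^ J := by positivity
      have : 0 ≤ (X ρ)⁻¹ ^ J := by positivity
      linarith
    · rw [← hXY]
      refine (neg_le_neg ?_).trans (neg_le_of_abs_le (abs_re_le_norm _))
      rw [norm_pow, norm_inv, norm_mul, norm_I, one_mul]
      gcongr
  obtain ⟨Z', rfl⟩ := Multiset.exists_cons_of_mem hρ₀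
  have hmain : ‖((ρ₀ ::ₘ Z').map fun ρ => ((s₀ - ρ)⁻¹) ^ J).sum‖ =
      ‖((ρ₀ ::ₘ Z').map fun ρ => ((X ρ : ℂ) + Y ρ * I)⁻¹ ^ J).sum‖ := by
    simp_rw [hpow]
    rw [Multiset.sum_map_mul_left, norm_mul, norm_pow, norm_inv, norm_I, inv_one, one_pow, one_mul]
  rw [hmain]
  refine le_trans ?_ (re_le_norm _)
  rw [Multiset.map_cons, Multiset.sum_cons, add_re, Multiset.card_cons]
  have h1 := re_inv_pow_ge (X := X ρ₀) (Y := Y ρ₀) (by rw [hX]; simpa [h₀] using hp)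
    (by simpa only [hX, hY, h₀] using h₀')
  have h2 : X ρ₀ = p := h₀
  have h3 : -((Multiset.card Z' : ℝ) * (D⁻¹) ^ J) ≤
      ((Z'.map fun ρ => ((X ρ : ℂ) + Y ρ * I)⁻¹ ^ J).sum).re := by
    have hnn' : ∀ ρ ∈ Z', -(D⁻¹) ^ J ≤ (((X ρ : ℂ) + Y ρ * I)⁻¹ ^ J).re := fun ρ hρ =>
      hnn ρ (Multiset.mem_cons_of_mem hρ)
    clear hmain hnn hZ hρ₀ 
    induction Z' using Multiset.induction_on with
    | empty => simp
    | cons a Z ih =>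
      have h5 := ih (fun ρ hρ => hnn' ρ (Multiset.mem_cons_of_mem hρ))
      have h6 := hnn' a (Multiset.mem_cons_self a Z)
      rw [Multiset.map_cons, Multiset.sum_cons, add_re, Multiset.card_cons]
      push_cast
      linarith
  rw [h2] at h1
  have : 0 ≤ (D⁻¹) ^ J := by positivity
  rw [h2]
  push_cast
  linarith

lemma iteratedDeriv_one_div_sub (n : ℕ) (ρ s₀ : ℂ) :
    iteratedDeriv n (fun s => 1 / (s - ρ)) s₀ = (-1) ^ n * n.factorial * ((s₀ - ρ)⁻¹) ^ (n + 1) := by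
  have h1 : (fun s : ℂ => 1 / (s - ρ)) = fun s => (Inv.inv : ℂ → ℂ) (s - ρ) := by
    ext s; rw [one_div]
  rw [h1, iteratedDeriv_comp_sub_const, iteratedDeriv_eq_iterate]
  simp only
  rw [iter_deriv_inv, show (-1 - (n : ℤ)) = -((n + 1 : ℕ) : ℤ) by push_cast; ring, zpow_neg,
    zpow_natCast, inv_pow]

lemma iteratedDeriv_sum_one_div_sub (n : ℕ) (Z : Multiset ℂ) (s₀ : ℂ) (h : ∀ ρ ∈ Z, s₀ ≠ ρ) :
    ContDiffAt ℂ n (fun s => (Z.map fun ρ => 1 / (s - ρ)).sum) s₀ ∧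
    iteratedDeriv n (fun s => (Z.map fun ρ => 1 / (s - ρ)).sum) s₀ =
      (-1) ^ n * n.factorial * (Z.map fun ρ => ((s₀ - ρ)⁻¹) ^ (n + 1)).sum := by
  induction Z using Multiset.induction_on with
  | empty => 
    simp only [Multiset.map_zero, Multiset.sum_zero, mul_zero]
    exact ⟨contDiffAt_const, by simp⟩
  | cons a Z ih =>
    obtain ⟨h1, h2⟩ := ih fun ρ hρ => h ρ (Multiset.mem_cons_of_mem hρ)
    have h3 : ContDiffAt ℂ n (fun s => 1 / (s - a)) s₀ :=
      contDiffAt_const.div (contDiffAt_id.sub contDiffAt_const)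
        (sub_ne_zero.mpr (h a (Multiset.mem_cons_self a Z)))
    simp only [Multiset.map_cons, Multiset.sum_cons]
    refine ⟨h3.add h1, ?_⟩
    rw [iteratedDeriv_fun_add h3 h1, h2, iteratedDeriv_one_div_sub]
    ring

lemma norm_iteratedDeriv_le_of_closedBall {f : ℂ → ℂ} {c : ℂ} {R C : ℝ} (n : ℕ) (hR : 0 < R)
    (hf : ∀ z ∈ closedBall c R, DifferentiableAt ℂ f z) (hC : ∀ z ∈ closedBall c R, ‖f z‖ ≤ C) :
    ‖iteratedDeriv n f c‖ ≤ n.factorial * C / R ^ n := by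
  refine norm_iteratedDeriv_le_of_forall_mem_sphere_norm_le n hR ?_
    (fun z hz => hC z (sphere_subset_closedBall hz))
  refine DifferentiableOn.diffContOnCl ?_
  rw [closure_ball _ hR.ne']
  exact fun z hz => (hf z hz).differentiableWithinAt

lemma contDiffAt_of_ball {f : ℂ → ℂ} {c : ℂ} {R : ℝ} (n : ℕ) (hR : 0 < R)
    (hf : ∀ z ∈ ball c R, DifferentiableAt ℂ f z) : ContDiffAt ℂ n f c := by
  have h1 : DifferentiableOn ℂ f (ball c R) := fun z hz => (hf z hz).differentiableWithinAt
  exact (h1.contDiffOn isOpen_ball).contDiffAt (ball_mem_nhds c hR)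

/-! ### ζ'/ζ in the neighbourhood of a half-isolated zero. -/

lemma exists_norm_logDeriv_riemannZeta_le_of_two_le_re :
    ∃ C : ℝ, ∀ z : ℂ, 2 ≤ z.re → ‖logDeriv riemannZeta z‖ ≤ C := by
  have hs := (ArithmeticFunction.LSeriesSummable_vonMangoldt (s := 2) (by norm_num)).norm
  refine ⟨∑' n, ‖LSeries.term (fun n => (ArithmeticFunction.vonMangoldt n : ℂ)) 2 n‖, fun z hz => ?_⟩
  have h := ArithmeticFunction.LSeries_vonMangoldt_eq_deriv_riemannZeta_div (s := z) (by linarith)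
  have h2 : ‖logDeriv riemannZeta z‖ = ‖LSeries (fun n => (ArithmeticFunction.vonMangoldt n : ℂ)) z‖ := by
    rw [h, logDeriv_apply, neg_div, norm_neg]
  rw [h2]
  refine tsum_of_norm_bounded hs.hasSum fun n => ?_
  exact LSeries.norm_term_le_of_re_le_re _ (by simpa using hz) n

/-- `K` is an admissible constant in Landau's local formula for `ζ'/ζ`, and bounds `ζ'/ζ` to the
right of `Re s = 2`. -/
structure IsLandauConstant (K : ℝ) : Prop where
  one_le : 1 ≤ K
  bound_right : ∀ z : ℂ, 2 ≤ z.re → ‖logDeriv riemannZeta z‖ ≤ K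
  exists_eq : ∀ τ : ℝ, 10 ≤ τ → ∃ (Z : Multiset ℂ) (g : ℂ → ℂ),
      (∀ ρ ∈ Z, riemannZeta ρ = 0 ∧ ‖ρ - (2 + τ * I)‖ ≤ 8 / 5) ∧
      (∀ ρ, riemannZeta ρ = 0 → ‖ρ - (2 + τ * I)‖ ≤ 8 / 5 → ρ ∈ Z) ∧
      (Multiset.card Z : ℝ) ≤ K * Real.log τ ∧
      DifferentiableOn ℂ g (ball (2 + τ * I) (31 / 20)) ∧
      (∀ s ∈ ball (2 + τ * I) (31 / 20), ‖g s‖ ≤ K * Real.log τ) ∧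
      ∀ s ∈ ball (2 + τ * I) (31 / 20), riemannZeta s ≠ 0 →
        logDeriv riemannZeta s = (Z.map fun ρ => 1 / (s - ρ)).sum + g s

theorem exists_isLandauConstant : ∃ K : ℝ, IsLandauConstant K := by
  obtain ⟨K, hK1, hK⟩ := exists_logDeriv_riemannZeta_local
  obtain ⟨C, hC⟩ := exists_norm_logDeriv_riemannZeta_le_of_two_le_re
  refine ⟨max K C, hK1.trans (le_max_left _ _), fun z hz => (hC z hz).trans (le_max_right _ _), ?_⟩
  intro τ hτ
  obtain ⟨Z, g, h1, h2, h3, h4, h5, h6⟩ := hK τ hτ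
  have hlog : 0 ≤ Real.log τ := Real.log_nonneg (by linarith)
  have hle : K * Real.log τ ≤ max K C * Real.log τ := by gcongr; exact le_max_left _ _
  exact ⟨Z, g, h1, h2, h3.trans hle, h4, fun s hs => (h5 s hs).trans hle, h6⟩

lemma norm_sub_le_of_re_im {z w : ℂ} {a b : ℝ} (h1 : |z.re - w.re| ≤ a) (h2 : |z.im - w.im| ≤ b) :
    ‖z - w‖ ≤ a + b := by
  refine (norm_le_abs_re_add_abs_im _).trans ?_
  rw [sub_re, sub_im]
  linarith

lemma mem_ball_of_re {z : ℂ} (h1 : 1 / 2 ≤ z.re) (h2 : z.re ≤ 2) :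
    z ∈ ball (2 + (z.im : ℝ) * I : ℂ) (31 / 20) := by
  rw [mem_ball, dist_eq_norm]
  refine (norm_sub_le_of_re_im (a := 3 / 2) (b := 0) ?_ ?_).trans_lt (by norm_num)
  · simp only [add_re, re_ofNat, mul_re, ofReal_re, I_re, mul_zero, ofReal_im, I_im, mul_one,
      sub_self, add_zero]
    rw [abs_le]; constructor <;> linarith
  · simp

/-- The zeros near a half-isolated zero. -/
lemma IsYHalfIsolatedZero.cases {Y L ℓ M2 : ℝ} {ρ₀ : ℂ} (h : IsYHalfIsolatedZero Y ρ₀)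
    (hγ : 0 < ρ₀.im) (hL : L = Real.log ρ₀.im) (hℓ : ℓ = Real.log Y) (hM2 : M2 = (Real.log L) ^ 2)
    {ρ : ℂ} (hρ : riemannZeta ρ = 0) (hd : ‖ρ - ρ₀‖ ≤ L ^ 2) :
    (|ρ.re - ρ₀.re| ≤ 1 / (10 * ℓ) ∧ ρ₀.im ≤ ρ.im) ∨ ρ.re ≤ ρ₀.re - M2 / ℓ := by
  subst hL hℓ hM2
  have := h.2.2 ρ hρ
  rw [abs_of_pos hγ] at this
  exact this hd

lemma re_lt_one_of_riemannZeta_eq_zero {ρ : ℂ} (h : riemannZeta ρ = 0) : ρ.re < 1 := by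
  by_contra hcon
  exact riemannZeta_ne_zero_of_one_le_re (not_lt.mp hcon) h

/-- In both alternatives of the definition a nearby zero has real part at most β₀ + 1/(10ℓ), so
every point of the strip is at distance at least 1/(3ℓ) from all of them. The local formula has at
most 2KL zeros, each contributing at most 3ℓ, and a remainder of at most 2KL; the total is at most
8KLℓ. -/
lemma zetaLogDerivBound_of_halfIsolated {K : ℝ} (hK : IsLandauConstant K)
    {Y L ℓ M2 η : ℝ} {ρ₀ : ℂ} (h : IsYHalfIsolatedZero Y ρ₀)
    (hγ : 0 < ρ₀.im) (hL : L = Real.log ρ₀.im) (hℓ : ℓ = Real.log Y) (hM2 : M2 = (Real.log L) ^ 2)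
    (hβ : 1 / 2 ≤ ρ₀.re) (hL20 : 20 ≤ L) (hℓ1 : 1 ≤ ℓ) (hη : 2 ≤ η) :
    ZetaLogDerivBound (ρ₀.re + η / (4 * ℓ)) ρ₀.im (L + 1) (8 * K * L * ℓ) := by
  have hK1 := hK.one_le
  have hK2 := hK.bound_right
  have hγL : 4 * L ≤ ρ₀.im := by
    have h1 : ρ₀.im = Real.exp L := by rw [hL, Real.exp_log hγ]
    have h2 := Real.quadratic_le_exp_of_nonneg (show 0 ≤ L by linarith)
    rw [h1]
    nlinarith
  have hM20 : 0 ≤ M2 := by rw [hM2]; positivity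
  have hzero : ∀ ρ : ℂ, riemannZeta ρ = 0 → 0 ≤ ρ.re → |ρ.im - ρ₀.im| ≤ L + 3 →
      ρ.re ≤ ρ₀.re + 1 / (10 * ℓ) := by
    intro ρ h1 h2 h3
    have h4 := re_lt_one_of_riemannZeta_eq_zero h1
    have h5 := re_lt_one_of_riemannZeta_eq_zero h.2.1
    have h6 : ‖ρ - ρ₀‖ ≤ L ^ 2 := by
      refine (norm_sub_le_of_re_im (a := 1) (abs_le.mpr ⟨by linarith, by linarith⟩) h3).trans ?_
      nlinarith
    have h7 : 0 ≤ 1 / (10 * ℓ) := by positivity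
    rcases h.cases hγ hL hℓ hM2 h1 h6 with ⟨h8, -⟩ | h8
    · linarith [(abs_le.mp h8).2]
    · have : 0 ≤ M2 / ℓ := by positivity
      linarith
  -- η ≥ 2 gives η/4 - 1/10 ≥ 2/5 > 1/3.
  have hgap : 1 / (3 * ℓ) ≤ η / (4 * ℓ) - 1 / (10 * ℓ) := by
    have h1 : η / (4 * ℓ) - 1 / (10 * ℓ) - 1 / (3 * ℓ) = (η / 4 - 1 / 10 - 1 / 3) / ℓ := by
      field_simp
    have h2 : 0 ≤ (η / 4 - 1 / 10 - 1 / 3) / ℓ := div_nonneg (by linarith) (by linarith)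
    linarith
  have hgap0 : 0 < 1 / (3 * ℓ) := by positivity
  have hη0 : 0 < η / (4 * ℓ) := by positivity
  have hne : ∀ z : ℂ, ρ₀.re + η / (4 * ℓ) ≤ z.re → |z.im - ρ₀.im| ≤ L + 1 → riemannZeta z ≠ 0 := by
    intro z h1 h2 h3
    have := hzero z h3 (by linarith) (by linarith)
    linarith
  have hKL : K ≤ 8 * K * L * ℓ := by
    have : 1 ≤ 8 * (L * ℓ) := by nlinarith
    nlinarith
  refine ⟨by linarith, hne, fun z h1 h2 => ?_, fun z hz => (hK2 z hz).trans hKL⟩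
  rcases le_total 2 z.re with h3 | h3
  · exact (hK2 z h3).trans hKL
  have hz2 := abs_le.mp h2
  obtain ⟨Z, g, a1, a2, a3, a4, a5, a6⟩ := hK.exists_eq z.im (by linarith)
  have hzb := mem_ball_of_re (by linarith) h3
  rw [a6 z hzb (hne z h1 h2)]
  have hlog : Real.log z.im ≤ 2 * L := by
    have h4 : z.im ≤ ρ₀.im * ρ₀.im := by nlinarith
    have h5 := Real.log_le_log (by linarith) h4
    rw [Real.log_mul hγ.ne' hγ.ne', ← hL] at h5
    linarith
  have hsum : ‖(Z.map fun ρ => 1 / (z - ρ)).sum‖ ≤ Multiset.card Z * (3 * ℓ) := by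
    refine (norm_multiset_sum_le _).trans ?_
    rw [Multiset.map_map]
    have := Multiset.sum_map_le_sum_map (s := Z) (norm ∘ fun ρ => 1 / (z - ρ)) (fun _ => 3 * ℓ)
      (fun ρ hρ => ?_)
    · simpa using this
    · obtain ⟨b1, b2⟩ := a1 ρ hρ
      have b3 := (abs_le.mp ((abs_re_le_norm _).trans b2))
      have b4 := (abs_le.mp ((abs_im_le_norm _).trans b2))
      simp at b3 b4
      have b5 := hzero ρ b1 (by linarith) (abs_le.mpr ⟨by linarith, by linarith⟩)
      have b6 : 1 / (3 * ℓ) ≤ ‖z - ρ‖ := by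
        refine le_trans ?_ ((le_abs_self _).trans (abs_re_le_norm (z - ρ)))
        rw [sub_re]; linarith
      simp only [Function.comp, norm_div, norm_one]
      rw [div_le_iff₀ (by linarith)]
      rw [div_le_iff₀ (by positivity)] at b6
      linarith
  have hg := a5 z hzb
  have hl0 : 0 ≤ Real.log z.im := Real.log_nonneg (by linarith)
  calc _ ≤ (Multiset.card Z : ℝ) * (3 * ℓ) + K * Real.log z.im := (norm_add_le _ _).trans (by linarith)
    _ ≤ (K * (2 * L)) * (3 * ℓ) + K * (2 * L) := by
        gcongr
        exact a3.trans (by gcongr)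
    _ ≤ 8 * K * L * ℓ := by
        have : 0 ≤ K * L * (ℓ - 1) := by
          have : 0 ≤ ℓ - 1 := by linarith
          positivity
        nlinarith

/-- The zeros near a half-isolated zero force a large derivative of `ζ'/ζ` at a nearby point. -/
lemma norm_iteratedDeriv_logDeriv_ge {K : ℝ} (hK : IsLandauConstant K)
    {Y L ℓ M2 η p : ℝ} {n : ℕ} {ρ₀ s₀ : ℂ} (h : IsYHalfIsolatedZero Y ρ₀)
    (hγ : 0 < ρ₀.im) (hL : L = Real.log ρ₀.im) (hℓ : ℓ = Real.log Y) (hM2 : M2 = (Real.log L) ^ 2)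
    (hβ : 1 / 2 ≤ ρ₀.re) (hL20 : 20 ≤ L) (hℓ1 : 1 ≤ ℓ) (hη : 2 ≤ η)
    (hM20 : 0 < M2) (hp : p = 4 * (n + 1) * η / ℓ) (hp1 : p ≤ 1 / 100)
    (hs₀ : s₀ = ρ₀ + ((η / ℓ : ℝ) - (p : ℝ) * I)) :
    2 / 3 * (p⁻¹) ^ (n + 1) - 2 * K * L * ((M2 / ℓ)⁻¹) ^ (n + 1) ≤
      ‖iteratedDeriv n (logDeriv riemannZeta) s₀‖ / n.factorial + 2 * K * L * 50 ^ n := by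
  have hB := zetaLogDerivBound_of_halfIsolated hK h hγ hL hℓ hM2 hβ hL20 hℓ1 hη
  have hK1 := hK.one_le
  have hp0 : 0 < p := by rw [hp]; positivity
  have hγL : 4 * L ≤ ρ₀.im := by
    have h1 : ρ₀.im = Real.exp L := by rw [hL, Real.exp_log hγ]
    have h2 := Real.quadratic_le_exp_of_nonneg (show 0 ≤ L by linarith)
    rw [h1]
    nlinarith
  have hre : s₀.re = ρ₀.re + η / ℓ := by rw [hs₀]; simp
  have him : s₀.im = ρ₀.im - p := by rw [hs₀]; simp; ring
  -- This fixes p: the power sum estimate tolerates horizontal offsets up to p/(3(n+1)) = (4/3)η/ℓ.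
  -- The shift η/ℓ uses most of that, and the rest covers the scatter 1/(10ℓ) ≤ η/(20ℓ) of the zeros
  -- of the first kind.
  have hηℓ : 4 * ((n + 1 : ℝ) * (η / ℓ)) = p := by rw [hp]; ring
  have hηℓ0 : 0 < η / ℓ := by positivity
  have hηℓ1 : 4 * (η / ℓ) ≤ p := by
    rw [← hηℓ]
    have : 0 ≤ (n : ℝ) * (η / ℓ) := by positivity
    nlinarith
  have hβ1 := re_lt_one_of_riemannZeta_eq_zero h.2.1
  set r : ℝ := η / (4 * ℓ) with hr
  have hr0 : 0 < r := by positivity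
  have hr4 : η / ℓ = 4 * r := by rw [hr]; field_simp
  obtain ⟨Z, g, a1, a2, a3, a4, a5, a6⟩ := hK.exists_eq s₀.im (by rw [him]; linarith)
  -- 1/2 ≤ Re s₀ ≤ 2 puts s₀ within 3/2 of the centre, and 3/2 + 1/50 < 31/20.
  have hsb : ball s₀ (1 / 50) ⊆ ball (2 + (s₀.im : ℝ) * I : ℂ) (31 / 20) := by
    intro z hz
    rw [mem_ball, dist_eq_norm] at hz ⊢
    have h1 : ‖s₀ - (2 + (s₀.im : ℝ) * I)‖ ≤ 3 / 2 + 0 := by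
      refine norm_sub_le_of_re_im ?_ (by simp)
      simp only [add_re, re_ofNat, mul_re, ofReal_re, I_re, mul_zero, ofReal_im, I_im, mul_one,
        sub_self, add_zero]
      rw [abs_le]; constructor <;> linarith
    have h2 := norm_add_le (z - s₀) (s₀ - (2 + (s₀.im : ℝ) * I))
    rw [sub_add_sub_cancel] at h2
    linarith
  have hnez : ∀ z ∈ ball s₀ r, riemannZeta z ≠ 0 := by
    intro z hz
    rw [mem_ball, dist_eq_norm] at hz
    have h1 := abs_le.mp ((abs_re_le_norm (z - s₀)).trans hz.le)
    have h2 := abs_le.mp ((abs_im_le_norm (z - s₀)).trans hz.le)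
    rw [sub_re, hre] at h1
    rw [sub_im, him] at h2
    exact hB.ne_zero z (by linarith) (abs_le.mpr ⟨by linarith, by linarith⟩)
  have hr50 : r ≤ 1 / 50 := by linarith
  have hs₀b : s₀ ∈ ball s₀ r := mem_ball_self hr0
  have hs₀ρ : ∀ ρ ∈ Z, s₀ ≠ ρ := by
    rintro ρ hρ rfl
    exact hnez s₀ hs₀b (a1 s₀ hρ).1
  have hlog : Real.log s₀.im ≤ 2 * L := by
    have h5 := Real.log_le_log (by rw [him]; linarith) (show s₀.im ≤ ρ₀.im by rw [him]; linarith)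
    rw [← hL] at h5
    linarith
  -- the power sum is bounded below
  have hρ₀Z : ρ₀ ∈ Z := by
    refine a2 ρ₀ h.2.1 ?_
    have := norm_sub_le_of_re_im (z := ρ₀) (w := 2 + (s₀.im : ℝ) * I) (a := 3 / 2) (b := 1 / 100)
      (by simp; rw [abs_le]; constructor <;> linarith)
      (by simp [him]; rw [abs_of_pos hp0]; linarith)
    linarith
  have hps := le_norm_sum_inv_pow (Z := Z) (s₀ := s₀) (ρ₀ := ρ₀) (J := n + 1) (p := p) (D := M2 / ℓ)
    hp0 (by positivity) hρ₀Z (by rw [him]; ring)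
    (by rw [hre, add_sub_cancel_left, abs_of_pos hηℓ0]; push_cast; linarith) (by
      intro ρ hρ
      obtain ⟨b1, b2⟩ := a1 ρ hρ
      have b3 := (abs_le.mp ((abs_re_le_norm _).trans b2))
      have b4 := (abs_le.mp ((abs_im_le_norm _).trans b2))
      simp [him] at b3 b4
      have b5 : ‖ρ - ρ₀‖ ≤ L ^ 2 := by
        refine (norm_sub_le_of_re_im (a := 2) (b := 3) (abs_le.mpr ⟨by linarith, ?_⟩)
          (abs_le.mpr ⟨by linarith, by linarith⟩)).trans (by nlinarith)
        linarith [re_lt_one_of_riemannZeta_eq_zero b1]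
      rcases h.cases hγ hL hℓ hM2 b1 b5 with ⟨c1, c2⟩ | c1
      · left
        refine ⟨by rw [him]; linarith, ?_⟩
        have c3 := abs_le.mp c1
        have c4 : 1 / (10 * ℓ) ≤ η / ℓ / 20 := by
          rw [div_div, div_le_div_iff₀ (by positivity) (by positivity)]
          nlinarith
        have c5 : |s₀.re - ρ.re| ≤ 4 / 3 * (η / ℓ) := by
          rw [hre, abs_le]; constructor <;> linarith
        calc ((n + 1 : ℕ) : ℝ) * |s₀.re - ρ.re| ≤ (n + 1 : ℕ) * (4 / 3 * (η / ℓ)) := by gcongr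
          _ = p / 3 := by push_cast; linarith
      · right
        refine le_trans ?_ ((le_abs_self _).trans (abs_re_le_norm (s₀ - ρ)))
        rw [sub_re, hre]; linarith)
  -- derivatives of both sides of the local formula
  obtain ⟨d1, d2⟩ := iteratedDeriv_sum_one_div_sub n Z s₀ hs₀ρ
  have hgd : ∀ z ∈ ball s₀ (1 / 50), DifferentiableAt ℂ g z := fun z hz =>
    a4.differentiableAt (isOpen_ball.mem_nhds (hsb hz))
  have hgc : ContDiffAt ℂ n g s₀ := contDiffAt_of_ball n (by norm_num) hgd
  have hgn : ‖iteratedDeriv n g s₀‖ ≤ n.factorial * (K * (2 * L)) * 50 ^ n := by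
    have hb : ∀ ε ∈ Set.Ioo (0 : ℝ) (1 / 50), ‖iteratedDeriv n g s₀‖ ≤ n.factorial * (K * (2 * L)) / ε ^ n := by
      intro ε hε
      refine norm_iteratedDeriv_le_of_closedBall n hε.1 (fun z hz => hgd z ?_) (fun z hz => ?_)
      · exact closedBall_subset_ball hε.2 hz
      · exact (a5 z (hsb (closedBall_subset_ball hε.2 hz))).trans (by gcongr)
    -- g is controlled only on an open disc, so Cauchy's estimate is used for smaller radii and
    -- passed to the limit 1/50.
    have hlim : Tendsto (fun ε : ℝ => n.factorial * (K * (2 * L)) / ε ^ n) (𝓝[<] (1 / 50))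
        (𝓝 (n.factorial * (K * (2 * L)) / (1 / 50) ^ n)) := by
      refine ((continuousAt_const.div (continuousAt_id.pow n) (by simp)).tendsto).mono_left
        nhdsWithin_le_nhds
    have := ge_of_tendsto hlim (by
      filter_upwards [Ioo_mem_nhdsLT (show (0 : ℝ) < 1 / 50 by norm_num)] with ε hε using hb ε hε)
    refine this.trans (le_of_eq ?_)
    rw [one_div, inv_pow, div_inv_eq_mul]
  have heq : logDeriv riemannZeta =ᶠ[𝓝 s₀] fun s => (Z.map fun ρ => 1 / (s - ρ)).sum + g s := by
    filter_upwards [isOpen_ball.mem_nhds hs₀b] with z hz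
    exact a6 z (hsb (ball_subset_ball hr50 hz)) (hnez z hz)
  have hder := heq.iteratedDeriv_eq n
  rw [iteratedDeriv_fun_add d1 hgc, d2] at hder
  have hfac : (0 : ℝ) < n.factorial := by exact_mod_cast n.factorial_pos
  have hnorm : n.factorial * ‖(Z.map fun ρ => ((s₀ - ρ)⁻¹) ^ (n + 1)).sum‖ ≤
      ‖iteratedDeriv n (logDeriv riemannZeta) s₀‖ + ‖iteratedDeriv n g s₀‖ := by
    have h1 : (-1) ^ n * n.factorial * (Z.map fun ρ => ((s₀ - ρ)⁻¹) ^ (n + 1)).sum =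
        iteratedDeriv n (logDeriv riemannZeta) s₀ - iteratedDeriv n g s₀ := by rw [hder]; ring
    have h2 := congrArg norm h1
    rw [norm_mul, norm_mul, norm_pow, norm_neg, norm_one, one_pow, one_mul, Complex.norm_natCast] at h2
    rw [h2]
    exact norm_sub_le _ _
  have hcard : (Multiset.card Z : ℝ) * ((M2 / ℓ)⁻¹) ^ (n + 1) ≤ 2 * K * L * ((M2 / ℓ)⁻¹) ^ (n + 1) := by
    refine mul_le_mul_of_nonneg_right (a3.trans ?_) (by positivity)
    nlinarith
  have h3 : ‖(Z.map fun ρ => ((s₀ - ρ)⁻¹) ^ (n + 1)).sum‖ ≤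
      ‖iteratedDeriv n (logDeriv riemannZeta) s₀‖ / n.factorial + 2 * K * L * 50 ^ n := by
    rw [← mul_le_mul_iff_right₀ hfac, mul_add, mul_div_cancel₀ _ hfac.ne']
    refine hnorm.trans ?_
    linarith
  linarith

/-! ### Detection of half-isolated zeros by blocks of primes. -/

lemma pow_mul_div_pow_left (n : ℕ) {p r B X : ℝ} (hr : 0 < r) (hp : p = 16 * (n + 1) * r) :
    p ^ (n + 1) * ((7 * (B / (2 * r)) * X) / r ^ n) =
      56 * B * (n + 1) * (16 * (n + 1)) ^ n * X := by
  have h1 : p ^ n / r ^ n = (16 * (n + 1)) ^ n := by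
    rw [← div_pow, hp, mul_div_cancel_right₀ _ hr.ne']
  have h2 : p / r = 16 * (n + 1) := by rw [hp, mul_div_cancel_right₀ _ hr.ne']
  calc _ = 7 * B / 2 * (p / r) * (p ^ n / r ^ n) * X := by rw [pow_succ]; ring
    _ = _ := by rw [h1, h2]; ring

lemma pow_mul_div_pow_two_mul (n : ℕ) {p B X : ℝ} (hp : 0 < p) :
    p ^ (n + 1) * ((2 * (B / (4 * p)) * X) / (2 * p) ^ n) = B / 2 * (1 / 2) ^ n * X := by
  have h1 : p ^ n / (2 * p) ^ n = (1 / 2) ^ n := by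
    rw [← div_pow]; congr 1; field_simp
  have h2 : p / p = 1 := div_self hp.ne'
  calc _ = B / 2 * (p / p) * (p ^ n / (2 * p) ^ n) * X := by rw [pow_succ]; ring
    _ = _ := by rw [h1, h2]; ring

set_option maxHeartbeats 800000 in
/-- **Detection of half-isolated zeros**, in terms of free parameters. -/
theorem exists_large_smoothLambda_sub {K : ℝ} (hK : IsLandauConstant K)
    {Y L ℓ M2 η p E : ℝ} {n u₁ u₂ : ℕ} {ρ₀ : ℂ} (h : IsYHalfIsolatedZero Y ρ₀)
    (hγ : 0 < ρ₀.im) (hL : L = Real.log ρ₀.im) (hℓ : ℓ = Real.log Y) (hM2 : M2 = (Real.log L) ^ 2)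
    (hβ : 1 / 2 ≤ ρ₀.re) (hL20 : 20 ≤ L) (hℓ1 : 1 ≤ ℓ) (hη : 2 ≤ η)
    (hM20 : 0 < M2) (hp : p = 4 * (n + 1) * η / ℓ) (hp1 : p ≤ 1 / 100) (hu : u₁ < u₂)
    (hE : E = Real.exp (2 * u₂ + 4 - L ^ 2 / 2))
    (h1 : 2 * K * L * (p * ℓ / M2) ^ (n + 1) ≤ 1 / 10)
    (h2 : 2 * K * L * p * (50 * p) ^ n ≤ 1 / 10)
    (h3 : 4 * K * L * ℓ * (1 / 2) ^ n * (Real.exp (u₁ * (4 * p)) + E) ≤ 1 / 10)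
    (h4 : 448 * K * L * ℓ * (n + 1) * (16 * (n + 1)) ^ n *
      (Real.exp (-(u₂ * (η / (2 * ℓ)))) + E) ≤ 1 / 10) :
    ∃ u ∈ Finset.Ico u₁ u₂, ∃ s : ℂ, ρ₀.re ≤ s.re ∧ s.re ≤ 2 ∧ |s.im - ρ₀.im| ≤ 1 ∧
      1 / (10 * u₂ * (16 * (n + 1)) ^ (n + 1)) ≤ ‖smoothLambda (u + 1 : ℕ) s - smoothLambda u s‖ := by
  -- If all the blocks were below V, the sum of at most u₂ of them would have too small an n-th
  -- derivative at s₀ to account for the zeros.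
  by_contra hcon
  push Not at hcon
  set V : ℝ := 1 / (10 * u₂ * (16 * (n + 1)) ^ (n + 1)) with hV
  have hB := zetaLogDerivBound_of_halfIsolated hK h hγ hL hℓ hM2 hβ hL20 hℓ1 hη
  set B : ℝ := 8 * K * L * ℓ with hBdef
  have hK1 := hK.one_le
  have hB0 : 0 ≤ B := hB.nonneg
  have hp0 : 0 < p := by rw [hp]; positivity
  have hE0 : 0 < E := by rw [hE]; positivity
  have hηℓ : 4 * ((n + 1 : ℝ) * (η / ℓ)) = p := by rw [hp]; ring
  have hηℓ0 : 0 < η / ℓ := by positivity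
  have hηℓ1 : 4 * (η / ℓ) ≤ p := by
    rw [← hηℓ]
    have : 0 ≤ (n : ℝ) * (η / ℓ) := by positivity
    nlinarith
  have hβ1 := re_lt_one_of_riemannZeta_eq_zero h.2.1
  have hu₂ : (1 : ℝ) ≤ u₂ := by exact_mod_cast Nat.one_le_of_lt hu
  set s₀ : ℂ := ρ₀ + ((η / ℓ : ℝ) - (p : ℝ) * I) with hs₀
  have hmain := norm_iteratedDeriv_logDeriv_ge hK h hγ hL hℓ hM2 hβ hL20 hℓ1 hη hM20 hp hp1 hs₀
  have hre : s₀.re = ρ₀.re + η / ℓ := by rw [hs₀]; simp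
  have him : s₀.im = ρ₀.im - p := by rw [hs₀]; simp; ring
  set r : ℝ := η / (4 * ℓ) with hr
  have hr0 : 0 < r := by positivity
  have hr4 : η / ℓ = 4 * r := by rw [hr]; field_simp
  have hr2 : η / (2 * ℓ) = 2 * r := by rw [hr]; field_simp; norm_num
  have hpr : p = 16 * (n + 1) * r := by rw [← hηℓ, hr4]; ring
  have hball : ∀ R : ℝ, ∀ z ∈ closedBall s₀ R, |z.re - s₀.re| ≤ R ∧ |z.im - s₀.im| ≤ R := by
    intro R z hz
    rw [mem_closedBall, dist_eq_norm] at hz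
    rw [← sub_re, ← sub_im]
    exact ⟨(abs_re_le_norm _).trans hz, (abs_im_le_norm _).trans hz⟩
  have hballr : ∀ z ∈ closedBall s₀ r, ρ₀.re + 3 * r ≤ z.re ∧ z.re ≤ 2 ∧ |z.im - ρ₀.im| ≤ 1 := by
    intro z hz
    obtain ⟨b1, b2⟩ := hball r z hz
    rw [abs_le, hre] at b1
    rw [abs_le, him] at b2
    refine ⟨by linarith, by linarith, abs_le.mpr ⟨by linarith, by linarith⟩⟩
  -- the three pieces of `ζ'/ζ`
  set A1 : ℂ → ℂ := smoothLambda u₁ with hA1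
  set W : ℂ → ℂ := fun s => smoothLambda u₂ s - smoothLambda u₁ s with hW
  set R : ℂ → ℂ := fun s => smoothLambda u₂ s + logDeriv riemannZeta s with hR
  have hGd : ∀ z ∈ closedBall s₀ r, DifferentiableAt ℂ (logDeriv riemannZeta) z := by
    intro z hz
    obtain ⟨b1, b2, b3⟩ := hballr z hz
    exact hB.differentiableAt (by linarith) (by linarith)
  have hRd : ∀ z ∈ closedBall s₀ r, DifferentiableAt ℂ R z := fun z hz =>
    (differentiable_smoothLambda _ z).add (hGd z hz)
  have hWd : Differentiable ℂ W := (differentiable_smoothLambda _).sub (differentiable_smoothLambda _)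
  have hA1d : Differentiable ℂ A1 := differentiable_smoothLambda _
  have c1 : ContDiffAt ℂ n R s₀ :=
    contDiffAt_of_ball n hr0 fun z hz => hRd z (ball_subset_closedBall hz)
  have c2 : ContDiffAt ℂ n W s₀ := contDiffAt_of_ball n hr0 fun z _ => hWd z
  have c3 : ContDiffAt ℂ n A1 s₀ := contDiffAt_of_ball n hr0 fun z _ => hA1d z
  have c12 : ContDiffAt ℂ n (R - W) s₀ := c1.sub c2
  have hsplit : logDeriv riemannZeta = (R - W) - A1 := by
    ext s; simp [hR, hW, hA1]
  have hder : ‖iteratedDeriv n (logDeriv riemannZeta) s₀‖ ≤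
      ‖iteratedDeriv n R s₀‖ + ‖iteratedDeriv n W s₀‖ + ‖iteratedDeriv n A1 s₀‖ := by
    rw [hsplit, iteratedDeriv_sub c12 c3, iteratedDeriv_sub c1 c2]
    exact (norm_sub_le _ _).trans (add_le_add_left (norm_sub_le _ _) _)
  -- The short truncation is entire, so Cauchy's estimate may use the radius 2p, twice the distance
  -- scale of the zeros; this is the source of the gain (1/2)^n.
  have e1 : ‖iteratedDeriv n A1 s₀‖ ≤
      n.factorial * (2 * (B / (4 * p)) * (Real.exp (u₁ * (4 * p)) + E)) / (2 * p) ^ n := by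
    refine norm_iteratedDeriv_le_of_closedBall n (by positivity) (fun z _ => hA1d z) fun z hz => ?_
    obtain ⟨b1, b2⟩ := hball _ z hz
    rw [abs_le, hre] at b1
    rw [abs_le, him] at b2
    have := hB.norm_smoothLambda_le (u := u₁) (a := 4 * p) (s := z) (by linarith) (by positivity)
      (by positivity) (by linarith) (by linarith) (by linarith)
      (abs_le.mpr ⟨by linarith, by linarith⟩)
    refine this.trans ?_
    have hu12 : (u₁ : ℝ) ≤ u₂ := by exact_mod_cast hu.le
    have : Real.exp (2 * u₁ + 4 - L ^ 2 / 2) ≤ E := by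
      rw [hE]; gcongr
    gcongr
  -- The remainder is controlled only to the right of the zeros, so the radius is r = p/(16(n+1)),
  -- at a cost of (16(n+1))^n. The decay e^{-2ru₂} must pay for it.
  have e2 : ‖iteratedDeriv n R s₀‖ ≤
      n.factorial * (7 * (B / (2 * r)) * (Real.exp (-(u₂ * (2 * r))) + E)) / r ^ n := by
    refine norm_iteratedDeriv_le_of_closedBall n hr0 hRd fun z hz => ?_
    obtain ⟨b1, b2, b3⟩ := hballr z hz
    have := hB.norm_smoothLambda_add_logDeriv_le (by linarith) (u := u₂) (δ := 2 * r) (s := z)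
      (by linarith) (by positivity) (by positivity) (by linarith) (by linarith) b3
    rw [← hE] at this
    exact this
  have e3 : ‖iteratedDeriv n W s₀‖ ≤ n.factorial * (u₂ * V) / r ^ n := by
    refine norm_iteratedDeriv_le_of_closedBall n hr0 (fun z _ => hWd z) fun z hz => ?_
    obtain ⟨b1, b2, b3⟩ := hballr z hz
    have htel : W z = ∑ u ∈ Finset.Ico u₁ u₂, (smoothLambda (u + 1 : ℕ) z - smoothLambda u z) :=
      (Finset.sum_Ico_sub (fun u : ℕ => smoothLambda u z) hu.le).symm
    rw [htel]
    refine (norm_sum_le _ _).trans ((Finset.sum_le_card_nsmul _ _ V fun u hu' =>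
      (hcon u hu' z (by linarith) b2 b3).le).trans ?_)
    rw [Nat.card_Ico, nsmul_eq_mul]
    have : ((u₂ - u₁ : ℕ) : ℝ) ≤ u₂ := by exact_mod_cast Nat.sub_le _ _
    gcongr
  have hfac : (0 : ℝ) < n.factorial := by exact_mod_cast n.factorial_pos
  have hdiv : ‖iteratedDeriv n (logDeriv riemannZeta) s₀‖ / n.factorial ≤
      (7 * (B / (2 * r)) * (Real.exp (-(u₂ * (2 * r))) + E)) / r ^ n + (u₂ * V) / r ^ n +
      (2 * (B / (4 * p)) * (Real.exp (u₁ * (4 * p)) + E)) / (2 * p) ^ n := by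
    rw [div_le_iff₀ hfac]
    refine hder.trans (le_of_le_of_eq (add_le_add (add_le_add e2 e3) e1) ?_)
    ring
  have hpJ : 0 < p ^ (n + 1) := by positivity
  -- Multiplied by p^{n+1}, the main term becomes 2/3 and each of the five error terms is at most
  -- 1/10.
  have hfin := mul_le_mul_of_nonneg_left (hmain.trans (add_le_add_left hdiv _)) hpJ.le
  -- rewrite each of the terms
  have t0 : p ^ (n + 1) * (2 / 3 * p⁻¹ ^ (n + 1) - 2 * K * L * (M2 / ℓ)⁻¹ ^ (n + 1)) =
      2 / 3 - 2 * K * L * (p * ℓ / M2) ^ (n + 1) := by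
    have : p ^ (n + 1) * p⁻¹ ^ (n + 1) = 1 := by rw [← mul_pow, mul_inv_cancel₀ hp0.ne', one_pow]
    have h' : p ^ (n + 1) * (M2 / ℓ)⁻¹ ^ (n + 1) = (p * ℓ / M2) ^ (n + 1) := by
      rw [← mul_pow, inv_div]; ring
    rw [← h']
    linear_combination 2 / 3 * this
  have hrn : p ^ n / r ^ n = (16 * (n + 1)) ^ n := by
    rw [← div_pow, hpr, mul_div_cancel_right₀ _ hr0.ne']
  have t1 : p ^ (n + 1) * ((7 * (B / (2 * r)) * (Real.exp (-(u₂ * (2 * r))) + E)) / r ^ n) =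
      448 * K * L * ℓ * (n + 1) * (16 * (n + 1)) ^ n * (Real.exp (-(u₂ * (η / (2 * ℓ)))) + E) := by
    rw [hr2, pow_mul_div_pow_left n hr0 hpr, hBdef]
    ring
  have t2 : p ^ (n + 1) * ((u₂ * V) / r ^ n) ≤ 1 / 10 := by
    have : p ^ (n + 1) * ((u₂ * V) / r ^ n) = p * (p ^ n / r ^ n) * (u₂ * V) := by ring
    rw [this, hrn, hV]
    have h6 : (0 : ℝ) < (16 * (n + 1)) ^ n := by positivity
    have h7 : p * (16 * (n + 1)) ^ n * (u₂ * (1 / (10 * u₂ * (16 * (n + 1)) ^ (n + 1)))) =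
        p / (160 * (n + 1)) := by
      rw [pow_succ]; field_simp; ring
    rw [h7, div_le_div_iff₀ (by positivity) (by norm_num)]
    have : (0 : ℝ) ≤ n := Nat.cast_nonneg n
    linarith
  have t3 : p ^ (n + 1) * ((2 * (B / (4 * p)) * (Real.exp (u₁ * (4 * p)) + E)) / (2 * p) ^ n) =
      4 * K * L * ℓ * (1 / 2) ^ n * (Real.exp (u₁ * (4 * p)) + E) := by
    rw [pow_mul_div_pow_two_mul n hp0, hBdef]
    ring
  have t4 : p ^ (n + 1) * (2 * K * L * 50 ^ n) = 2 * K * L * p * (50 * p) ^ n := by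
    rw [mul_pow]; ring
  rw [t0, mul_add, mul_add, mul_add, t1, t3, t4] at hfin
  linarith

lemma pow_le_exp_neg {x c y : ℝ} {m : ℕ} (hx : 0 ≤ x) (hxc : x ≤ Real.exp (-c)) (hy : y ≤ c * m) :
    x ^ m ≤ Real.exp (-y) := by
  calc x ^ m ≤ Real.exp (-c) ^ m := pow_le_pow_left₀ hx hxc m
    _ = Real.exp (-(c * m)) := by rw [← Real.exp_nat_mul]; congr 1; ring
    _ ≤ Real.exp (-y) := Real.exp_le_exp.mpr (by linarith)

set_option maxHeartbeats 1600000 in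
/-- The choice of parameters in the detection of half-isolated zeros. -/
lemma exists_detection_parameters {K ε M L ℓ a : ℝ} (hK1 : 1 ≤ K) (hε : 0 < ε) (hε1 : ε ≤ 1)
    (ha : a ^ 2 = M) (haK : K ≤ a) (ha1 : 10000 ≤ a) (haε : 1000 ≤ ε * a)
    (hQ : Real.log (128 * M) ≤ ε / 100 * a) (hL : L = Real.exp M) (hℓ1 : M ^ 3 ≤ ℓ)
    (hℓ2 : ℓ ≤ L / M) :
    ∃ n u₁ u₂ : ℕ, ∃ p E : ℝ, p = 4 * (n + 1) * a / ℓ ∧ p ≤ 1 / 100 ∧ u₁ < u₂ ∧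
      E = Real.exp (2 * u₂ + 4 - L ^ 2 / 2) ∧
      2 * K * L * (p * ℓ / M ^ 2) ^ (n + 1) ≤ 1 / 10 ∧
      2 * K * L * p * (50 * p) ^ n ≤ 1 / 10 ∧
      4 * K * L * ℓ * (1 / 2) ^ n * (Real.exp (u₁ * (4 * p)) + E) ≤ 1 / 10 ∧
      448 * K * L * ℓ * (n + 1) * (16 * (n + 1)) ^ n *
        (Real.exp (-(u₂ * (a / (2 * ℓ)))) + E) ≤ 1 / 10 ∧
      (∀ u : ℕ, u₁ ≤ u → u < u₂ → M ≤ ε * u ∧ u ≤ ε * L ∧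
        Real.exp (-(ε * u)) ≤ 1 / (10 * u₂ * (16 * (n + 1)) ^ (n + 1))) := by
  have ha0 : 0 < a := by linarith
  have hM0 : 0 < M := by rw [← ha]; positivity
  have haM : a ≤ M := by rw [← ha]; exact le_self_pow₀ (by linarith) two_ne_zero
  have hM1 : 100000000 ≤ M := by rw [← ha]; nlinarith
  have hML : M ≤ L := by rw [hL]; linarith [Real.add_one_le_exp M]
  have hL0 : 0 < L := by linarith
  have ha3L : a ^ 3 ≤ L := by
    have h1 := Real.quadratic_le_exp_of_nonneg hM0.le
    rw [hL]
    refine le_trans ?_ h1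
    have h2 : 2 * a ^ 3 ≤ a * a ^ 3 := by gcongr; linarith
    have h3 : M ^ 2 = a * a ^ 3 := by rw [← ha]; ring
    linarith
  have hℓM : M ^ 3 ≤ ℓ := hℓ1
  have hℓ0 : 0 < ℓ := (pow_pos hM0 3).trans_le hℓ1
  have hℓ2' : ℓ * M ≤ L := (le_div_iff₀ hM0).mp hℓ2
  have hKLℓ : K * L * ℓ ≤ L ^ 2 := by
    calc K * L * ℓ ≤ M * L * ℓ := by gcongr; linarith
      _ = (ℓ * M) * L := by ring
      _ ≤ L * L := by gcongr
      _ = L ^ 2 := by ring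
  have hL6 : Real.exp (-(6 * M)) = (L ^ 6)⁻¹ := by
    rw [Real.exp_neg, hL, ← Real.exp_nat_mul]; norm_num
  have hL3 : Real.exp (-(3 * M)) = (L ^ 3)⁻¹ := by
    rw [Real.exp_neg, hL, ← Real.exp_nat_mul]; norm_num
  have hexp1 : 3 / 10 ≤ Real.exp (-1) := by
    have := Real.exp_neg_one_gt_d9; linarith
  have hmul : ∀ x : ℝ, x ≤ Real.exp (-(6 * M)) → L ^ 2 * x ≤ 1 / 10 ^ 8 := by
    intro x hx
    rw [hL6] at hx
    calc L ^ 2 * x ≤ L ^ 2 * (L ^ 6)⁻¹ := by gcongr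
      _ = 1 / L ^ 4 := by field_simp
      _ ≤ 1 / 10 ^ 8 := by
        have : (10 : ℝ) ^ 8 ≤ L ^ 4 := by
          calc (10 : ℝ) ^ 8 = (10 ^ 2) ^ 4 := by norm_num
            _ ≤ L ^ 4 := by gcongr; linarith
        exact one_div_le_one_div_of_le (by norm_num) this
  -- the number of derivatives
  obtain ⟨n, hn1, hn2⟩ : ∃ n : ℕ, 6 * M ≤ n ∧ (n : ℝ) < 6 * M + 1 :=
    ⟨_, Nat.le_ceil _, Nat.ceil_lt_add_one (by positivity)⟩
  obtain ⟨J, hJ⟩ : ∃ J : ℝ, J = n + 1 := ⟨_, rfl⟩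
  have hJM : J ≤ 7 * M := by linarith
  have hJ1 : 6 * M ≤ J := by linarith
  have hJ0 : 0 < J := by linarith
  -- With η = a = √M, the ratio pℓ/M² is at most 28/a. The n + 1 > 6M powers then push the distant
  -- zeros below L^{-6}, while ℓ ≥ M³ makes p itself small.
  obtain ⟨p, hp⟩ : ∃ p : ℝ, p = 4 * J * a / ℓ := ⟨_, rfl⟩
  have hp0 : 0 < p := by rw [hp]; positivity
  have hpa : p ≤ 28 / a ^ 3 := by
    rw [hp, div_le_div_iff₀ hℓ0 (by positivity)]
    calc 4 * J * a * a ^ 3 = 4 * J * (a ^ 2) ^ 2 := by ring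
      _ ≤ 4 * (7 * M) * M ^ 2 := by rw [ha]; gcongr
      _ = 28 * M ^ 3 := by ring
      _ ≤ 28 * ℓ := by gcongr
  have hp4 : p ≤ 1 / 1000 := by
    refine hpa.trans ?_
    rw [div_le_div_iff₀ (by positivity) (by norm_num)]
    linarith [pow_le_pow_left₀ (by norm_num) ha1 3]
  obtain ⟨Q, hQd⟩ : ∃ Q : ℝ, Q = Real.log (16 * J) := ⟨_, rfl⟩
  have hQ1 : 2 ≤ Q := by
    rw [hQd, Real.le_log_iff_exp_le (by positivity)]
    have h1 := Real.exp_one_lt_d9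
    have : Real.exp 2 = Real.exp 1 ^ 2 := by rw [← Real.exp_nat_mul]; norm_num
    rw [this]
    have h2 : Real.exp 1 ^ 2 ≤ 3 ^ 2 := by gcongr; linarith
    linarith
  have hQ2 : Q ≤ ε / 100 * a := by
    rw [hQd]
    refine le_trans (Real.log_le_log (by positivity) ?_) hQ
    linarith
  -- Here 4pu₁ is about 0.16 J, so the growth e^{4pu₁} loses to the factor 2^{-n}.
  obtain ⟨u₁, hu₁1, hu₁2⟩ : ∃ u₁ : ℕ, ℓ / (100 * a) ≤ u₁ ∧ (u₁ : ℝ) < ℓ / (100 * a) + 1 :=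
    ⟨_, Nat.le_ceil _, Nat.ceil_lt_add_one (by positivity)⟩
  -- Chosen so that exp(-u₂a/(2ℓ)) ≤ exp(-2JQ) = (16J)^{-2J}, which beats the Cauchy loss (16J)^J
  -- with (16J)^J to spare.
  obtain ⟨u₂, hu₂1, hu₂2⟩ : ∃ u₂ : ℕ, 4 * ℓ * (J * Q) / a ≤ u₂ ∧
      (u₂ : ℝ) < 4 * ℓ * (J * Q) / a + 1 :=
    ⟨_, Nat.le_ceil _, Nat.ceil_lt_add_one (by positivity)⟩
  have hℓa : 1 ≤ ℓ / a := by
    rw [le_div_iff₀ ha0]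
    rw [one_mul]
    exact haM.trans ((le_self_pow₀ (by linarith) three_ne_zero).trans hℓ1)
  have hu12 : (u₁ : ℝ) < u₂ := by
    have h1 : ℓ / (100 * a) = ℓ / a / 100 := by field_simp
    have h2 : 4 * ℓ * (J * Q) / a = 4 * (ℓ / a) * (J * Q) := by ring
    have h3 : 1 ≤ J * Q := one_le_mul_of_one_le_of_one_le (by linarith) (by linarith)
    have h4 : 4 * (ℓ / a) ≤ 4 * (ℓ / a) * (J * Q) := le_mul_of_one_le_right (by positivity) h3
    linarith
  have hJQ : J * Q ≤ 7 * M * (ε / 100 * a) := by gcongr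
  have hJQa : J * Q ≤ a ^ 3 := by
    calc J * Q ≤ 7 * M * (ε / 100 * a) := hJQ
      _ = 7 / 100 * ε * a ^ 3 := by rw [← ha]; ring
      _ ≤ a ^ 3 := mul_le_of_le_one_left (by positivity) (by linarith)
  -- The upper limit on log Y is used here, in the form ℓM ≤ L; it keeps the blocks short.
  have hu₂L : (u₂ : ℝ) ≤ ε * L := by
    have h1 : 4 * ℓ * (J * Q) / a ≤ 28 / 100 * ε * L := by
      rw [div_le_iff₀ ha0]
      calc 4 * ℓ * (J * Q) ≤ 4 * ℓ * (7 * M * (ε / 100 * a)) := by gcongr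
        _ = 28 / 100 * ε * (ℓ * M) * a := by ring
        _ ≤ 28 / 100 * ε * L * a := by gcongr
    have h2 : 1000 ≤ ε * L := haε.trans (by gcongr; linarith)
    linarith
  obtain ⟨E, hE⟩ : ∃ E : ℝ, E = Real.exp (2 * u₂ + 4 - L ^ 2 / 2) := ⟨_, rfl⟩
  have hE0 : 0 < E := by rw [hE]; positivity
  have hE2 : E ≤ Real.exp (-(2 * (J * Q))) := by
    rw [hE]
    refine Real.exp_le_exp.mpr ?_
    have h1 : ε * L ≤ L := mul_le_of_le_one_left hL0.le hε1
    have h2 : 12 * L ≤ L ^ 2 := by rw [pow_two]; gcongr; linarith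
    linarith
  have hJQ0 : 0 < J * Q := by positivity
  have h16 : Real.exp (-(2 * (J * Q))) = ((16 * J) ^ (n + 1) * (16 * J) ^ (n + 1))⁻¹ := by
    rw [Real.exp_neg, ← pow_add]
    have : Real.exp (2 * (J * Q)) = Real.exp Q ^ (n + 1 + (n + 1)) := by
      rw [← Real.exp_nat_mul]; congr 1; push_cast; rw [hJ]; ring
    rw [this, hQd, Real.exp_log (by positivity)]
  have hE1 : E ≤ 1 := hE2.trans (Real.exp_le_one_iff.mpr (by linarith))
  refine ⟨n, u₁, u₂, p, E, by rw [hp, hJ], by linarith, by exact_mod_cast hu12, hE, ?_, ?_, ?_, ?_, ?_⟩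
  · have hx : p * ℓ / M ^ 2 ≤ Real.exp (-1) := by
      refine le_trans ?_ hexp1
      rw [hp, div_mul_cancel₀ _ hℓ0.ne', div_le_div_iff₀ (by positivity) (by norm_num)]
      calc 4 * J * a * 10 ≤ 4 * (7 * M) * a * 10 := by gcongr
        _ = (280 * a) * M := by ring
        _ ≤ (3 * M) * M := by
          refine mul_le_mul_of_nonneg_right ?_ hM0.le
          rw [← ha, pow_two, ← mul_assoc]
          exact mul_le_mul_of_nonneg_right (by linarith) ha0.le
        _ = 3 * M ^ 2 := by ring
    have h1 := hmul _ (pow_le_exp_neg (m := n + 1) (y := 6 * M) (by positivity) hx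
      (by push_cast; linarith))
    have h2 : 2 * K * L ≤ 2 * L ^ 2 := by
      rw [pow_two, ← mul_assoc]; gcongr; linarith
    calc _ ≤ 2 * L ^ 2 * (p * ℓ / M ^ 2) ^ (n + 1) := by gcongr
      _ = 2 * (L ^ 2 * (p * ℓ / M ^ 2) ^ (n + 1)) := by ring
      _ ≤ 1 / 10 := by linarith
  · have h1 := hmul _ (pow_le_exp_neg (x := 50 * p) (m := n) (y := 6 * M) (c := 1) (by positivity)
      (by linarith) (by linarith))
    have h2 : 2 * K * L * p ≤ 2 * L ^ 2 := by
      have : 2 * K * L ≤ 2 * L ^ 2 := by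
        rw [pow_two, ← mul_assoc]; gcongr; linarith
      have h3 : 2 * K * L * p ≤ 2 * K * L := mul_le_of_le_one_right (by positivity) (by linarith)
      linarith
    calc _ ≤ 2 * L ^ 2 * (50 * p) ^ n := by gcongr
      _ = 2 * (L ^ 2 * (50 * p) ^ n) := by ring
      _ ≤ 1 / 10 := by linarith
  · have h1 : (u₁ : ℝ) * (4 * p) ≤ 16 / 100 * n + 1 := by
      calc (u₁ : ℝ) * (4 * p) ≤ (ℓ / (100 * a) + 1) * (4 * p) := by gcongr
        _ = 16 / 100 * J + 4 * p := by rw [hp]; field_simp; ring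
        _ ≤ 16 / 100 * n + 1 := by rw [hJ]; linarith
    have h2 : (1 / 2 : ℝ) ^ n ≤ Real.exp (-(66 / 100 * n)) := by
      refine pow_le_exp_neg (c := 66 / 100) (by norm_num) ?_ le_rfl
      rw [← Real.log_le_iff_le_exp (by norm_num), one_div, Real.log_inv]
      linarith [Real.log_two_gt_d9]
    have h3 : Real.exp (u₁ * (4 * p)) + E ≤ 2 * Real.exp (16 / 100 * n + 1) := by
      have := Real.exp_le_exp.mpr h1
      have h4 : 1 ≤ Real.exp (16 / 100 * n + 1) := Real.one_le_exp (by positivity)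
      linarith
    have h5 : Real.exp (-(66 / 100 * n)) * Real.exp (16 / 100 * n + 1) ≤
        3 * Real.exp (-(3 * M)) := by
      rw [← Real.exp_add]
      have : Real.exp (-(66 / 100 * n) + (16 / 100 * n + 1)) ≤ Real.exp (1 + -(3 * M)) :=
        Real.exp_le_exp.mpr (by linarith)
      rw [Real.exp_add 1] at this
      refine this.trans ?_
      gcongr
      linarith [Real.exp_one_lt_d9]
    calc _ = 4 * (K * L * ℓ) * ((1 / 2) ^ n * (Real.exp (u₁ * (4 * p)) + E)) := by ring
      _ ≤ 4 * L ^ 2 * (Real.exp (-(66 / 100 * n)) * (2 * Real.exp (16 / 100 * n + 1))) := by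
        gcongr
      _ = 8 * L ^ 2 * (Real.exp (-(66 / 100 * n)) * Real.exp (16 / 100 * n + 1)) := by ring
      _ ≤ 8 * L ^ 2 * (3 * (L ^ 3)⁻¹) := by rw [← hL3]; gcongr
      _ = 24 / L := by field_simp; norm_num
      _ ≤ 1 / 10 := by
        rw [div_le_div_iff₀ hL0 (by norm_num)]; linarith
  · rw [← hJ]
    have h1 : Real.exp (-(u₂ * (a / (2 * ℓ)))) ≤ Real.exp (-(2 * (J * Q))) := by
      refine Real.exp_le_exp.mpr (neg_le_neg ?_)
      calc 2 * (J * Q) = 4 * ℓ * (J * Q) / a * (a / (2 * ℓ)) := by field_simp; norm_num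
        _ ≤ _ := by gcongr
    have h16p : 0 < (16 * J) ^ (n + 1) := by positivity
    have h2 : J * (16 * J) ^ n ≤ (16 * J) ^ (n + 1) := by
      rw [pow_succ, mul_comm]
      gcongr
      linarith
    have h3 : ((16 * J) ^ (n + 1))⁻¹ ≤ Real.exp (-(6 * M)) := by
      rw [← inv_pow]
      refine pow_le_exp_neg (c := 1) (by positivity) (le_trans ?_ hexp1) (by push_cast; linarith)
      rw [inv_le_comm₀ (by positivity) (by norm_num)]
      linarith
    have h4 := hmul _ h3
    calc _ = 448 * (K * L * ℓ) * (J * (16 * J) ^ n) * (Real.exp (-(u₂ * (a / (2 * ℓ)))) + E) := by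
          ring
      _ ≤ 448 * L ^ 2 * (16 * J) ^ (n + 1) *
          (Real.exp (-(2 * (J * Q))) + Real.exp (-(2 * (J * Q)))) := by gcongr
      _ = 896 * (L ^ 2 * ((16 * J) ^ (n + 1))⁻¹) := by
        rw [h16]; field_simp; norm_num
      _ ≤ 1 / 10 := by linarith
  · intro u h1 h2
    rw [← hJ]
    have h1' : (u₁ : ℝ) ≤ u := by exact_mod_cast h1
    have h2' : (u : ℝ) ≤ u₂ := by exact_mod_cast h2.le
    -- The lower limit ℓ ≥ M³ = a⁶ gives u ≥ a⁵/100, hence εu ≥ 10a⁴. This dominates both M and JQ ≤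
    -- a³, so e^{-εu} lies below the detection threshold.
    have hu : a ^ 5 / 100 ≤ u := by
      refine le_trans ?_ (hu₁1.trans h1')
      rw [div_le_div_iff₀ (by norm_num) (by positivity)]
      calc a ^ 5 * (100 * a) = (a ^ 2) ^ 3 * 100 := by ring
        _ ≤ ℓ * 100 := by rw [ha]; gcongr
    have hεu : 10 * a ^ 4 ≤ ε * u := by
      calc 10 * a ^ 4 = 1000 * (a ^ 4 / 100) := by ring
        _ ≤ ε * a * (a ^ 4 / 100) := by gcongr
        _ = ε * (a ^ 5 / 100) := by ring
        _ ≤ ε * u := by gcongr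
    have ha34 : a ^ 3 ≤ a ^ 4 := pow_le_pow_right₀ (by linarith) (by norm_num)
    have ha24 : a ^ 2 ≤ a ^ 4 := pow_le_pow_right₀ (by linarith) (by norm_num)
    refine ⟨by linarith, h2'.trans hu₂L, ?_⟩
    rw [one_div, Real.exp_neg]
    have hu₂0 : (0 : ℝ) < u₂ := lt_of_le_of_lt (Nat.cast_nonneg _) hu12
    refine inv_anti₀ (by positivity) ?_
    have h16 : (16 * J) ^ (n + 1) = Real.exp (J * Q) := by
      have : Real.exp (J * Q) = Real.exp Q ^ (n + 1) := by
        rw [← Real.exp_nat_mul]; congr 1; push_cast; rw [hJ]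
      rw [this, hQd, Real.exp_log (by positivity)]
    have h10 : (10 : ℝ) ≤ Real.exp M := by linarith
    have hu₂e : (u₂ : ℝ) ≤ Real.exp M := by
      rw [← hL]; exact hu₂L.trans (mul_le_of_le_one_left hL0.le hε1)
    calc 10 * (u₂ : ℝ) * (16 * J) ^ (n + 1) ≤ Real.exp M * Real.exp M * Real.exp (J * Q) := by
          rw [h16]; gcongr
      _ = Real.exp (M + M + J * Q) := by rw [Real.exp_add, Real.exp_add]
      _ ≤ Real.exp (ε * u) := Real.exp_le_exp.mpr (by linarith)

/-- **Detection of half-isolated zeros.** -/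
theorem exists_large_smoothLambda_of_isHalfIsolatedZero {ε : ℝ} (hε : 0 < ε) (hε1 : ε ≤ 1) :
    ∃ G : ℝ, ∀ ρ₀ : ℂ, IsHalfIsolatedZero ρ₀ → G ≤ ρ₀.im → 1 / 2 ≤ ρ₀.re →
      ∃ u : ℕ, Real.log (Real.log ρ₀.im) ≤ ε * u ∧ u ≤ ε * Real.log ρ₀.im ∧
        ∃ s : ℂ, ρ₀.re ≤ s.re ∧ s.re ≤ 2 ∧ |s.im - ρ₀.im| ≤ 1 ∧
          Real.exp (-(ε * u)) ≤ ‖smoothLambda (u + 1 : ℕ) s - smoothLambda u s‖ := by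
  obtain ⟨K, hK⟩ := exists_isLandauConstant
  have hsq : Tendsto Real.sqrt atTop atTop := Real.tendsto_sqrt_atTop
  have hlog : ∀ᶠ M : ℝ in atTop, Real.log (128 * M) ≤ ε / 100 * Real.sqrt M := by
    have h1 := (isLittleO_log_rpow_atTop (r := 1 / 2) (by norm_num)).bound
      (show 0 < ε / 100 / Real.sqrt 128 by positivity)
    have h2 : Tendsto (fun M : ℝ => 128 * M) atTop atTop := tendsto_id.const_mul_atTop (by norm_num)
    filter_upwards [h2.eventually h1, eventually_ge_atTop 1] with M hM hM1
    rw [← Real.sqrt_eq_rpow, Real.norm_of_nonneg (Real.log_nonneg (by linarith)),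
      Real.norm_of_nonneg (Real.sqrt_nonneg _), Real.sqrt_mul (by norm_num)] at hM
    refine hM.trans (le_of_eq ?_)
    field_simp
  have hev : ∀ᶠ M : ℝ in atTop, K ≤ Real.sqrt M ∧ 10000 ≤ Real.sqrt M ∧ 1000 / ε ≤ Real.sqrt M ∧
      Real.log (128 * M) ≤ ε / 100 * Real.sqrt M ∧ 1 ≤ M := by
    filter_upwards [hsq.eventually_ge_atTop K, hsq.eventually_ge_atTop 10000,
      hsq.eventually_ge_atTop (1000 / ε), hlog, eventually_ge_atTop 1] with M m1 m2 m3 m4 m5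
    exact ⟨m1, m2, m3, m4, m5⟩
  have hLL : Tendsto (fun γ : ℝ => Real.log (Real.log γ)) atTop atTop :=
    Real.tendsto_log_atTop.comp Real.tendsto_log_atTop
  obtain ⟨G, hG⟩ := eventually_atTop.mp ((hLL.eventually hev).and
    ((eventually_gt_atTop 0).and (Real.tendsto_log_atTop.eventually_ge_atTop 20)))
  refine ⟨G, fun ρ₀ h hGρ hβ => ?_⟩
  obtain ⟨⟨m1, m2, m3, m4, m5⟩, hγ, hL20⟩ := hG _ hGρ
  obtain ⟨Y, hY1, hY2, hY⟩ := h
  rw [abs_of_pos hγ] at hY1 hY2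
  set L := Real.log ρ₀.im with hL
  set M := Real.log L with hM
  have hM0 : 0 < M := by linarith
  have hLM : L = Real.exp M := by rw [hM, Real.exp_log (by linarith)]
  obtain ⟨n, u₁, u₂, p, E, q1, q2, q3, q4, q5, q6, q7, q8, q9⟩ :=
    exists_detection_parameters (L := L) hK.one_le hε hε1 (Real.sq_sqrt hM0.le) m1 m2
      (by rw [div_le_iff₀ hε] at m3; linarith) m4 hLM hY1 hY2
  obtain ⟨u, hu, s, s1, s2, s3, s4⟩ := exists_large_smoothLambda_sub hK (η := Real.sqrt M) hY hγ hL
    rfl rfl hβ hL20 (le_trans (one_le_pow₀ m5) hY1) (by linarith) (by positivity) q1 q2 q3 q4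
    q5 q6 q7 q8
  rw [Finset.mem_Ico] at hu
  obtain ⟨r1, r2, r3⟩ := q9 u hu.1 hu.2
  exact ⟨u, r1, r2, s, s1, s2, s3, r3.trans s4⟩

/-! ### Localising a block to log n close to u. -/

/-- The coefficients of `smoothLambda (u + 1) - smoothLambda u`, restricted to `n` with
`|log n - u| ≤ ε u`. -/
noncomputable def windowLambda (ε : ℝ) (u : ℕ) : ArithmeticFunction ℂ where
  toFun n := if (1 - ε) * u ≤ Real.log n ∧ Real.log n ≤ (1 + ε) * u then
    ((ArithmeticFunction.vonMangoldt n *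
      (gaussCDF ((u + 1 : ℕ) - Real.log n) - gaussCDF (u - Real.log n)) : ℝ) : ℂ) else 0
  map_zero' := by simp

lemma windowLambda_apply (ε : ℝ) (u n : ℕ) :
    windowLambda ε u n = if (1 - ε) * u ≤ Real.log n ∧ Real.log n ≤ (1 + ε) * u then
    ((ArithmeticFunction.vonMangoldt n *
      (gaussCDF ((u + 1 : ℕ) - Real.log n) - gaussCDF (u - Real.log n)) : ℝ) : ℂ) else 0 := rfl

lemma gaussCDF_sub_nonneg (u : ℕ) (x : ℝ) : 0 ≤ gaussCDF ((u + 1 : ℕ) - x) - gaussCDF (u - x) :=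
  sub_nonneg.mpr (gaussCDF_mono (by push_cast; linarith))

lemma norm_windowLambda_le (ε : ℝ) (u n : ℕ) :
    ‖windowLambda ε u n‖ ≤ ArithmeticFunction.vonMangoldt n := by
  rw [windowLambda_apply]
  have hΛ : 0 ≤ ArithmeticFunction.vonMangoldt n := ArithmeticFunction.vonMangoldt_nonneg
  split_ifs
  · rw [norm_real, Real.norm_of_nonneg (mul_nonneg hΛ (gaussCDF_sub_nonneg u _))]
    refine mul_le_of_le_one_right hΛ ?_
    linarith [gaussCDF_le_one ((u + 1 : ℕ) - Real.log n), gaussCDF_nonneg (u - Real.log n)]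
  · simp [hΛ]

lemma log_mem_of_windowLambda_ne_zero {ε : ℝ} {u n : ℕ} (h : windowLambda ε u n ≠ 0) :
    (1 - ε) * u ≤ Real.log n ∧ Real.log n ≤ (1 + ε) * u := by
  rw [windowLambda_apply] at h
  by_contra hc
  exact h (if_neg hc)

/-- The Chernoff bound with parameter 8/ε: outside the window |u - x| > εu, and 8/ε times this
distance is at least u + 3x. With x = log n the factor e^{-3x} makes the sum over n converge, and
e^{-u} is the saving. -/
lemma gaussCDF_sub_le {ε x : ℝ} (u : ℕ) (hε : 0 < ε) (hε1 : ε ≤ 1)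
    (hx : x < (1 - ε) * u ∨ (1 + ε) * u < x) :
    gaussCDF ((u + 1 : ℕ) - x) - gaussCDF (u - x) ≤
      Real.exp (8 / ε + (8 / ε) ^ 2) / (8 / ε) * Real.exp (-u) * Real.exp (-(3 * x)) := by
  have hA : 0 < 8 / ε := by positivity
  have hu : (0 : ℝ) ≤ u := Nat.cast_nonneg u
  have key : ∀ v : ℝ, v * (8 / ε) ≤ 8 / ε - (u + 3 * x) → gaussCDF v ≤
      Real.exp (8 / ε + (8 / ε) ^ 2) / (8 / ε) * Real.exp (-u) * Real.exp (-(3 * x)) := by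
    intro v hv
    refine (gaussCDF_le v hA).trans ?_
    rw [div_mul_eq_mul_div, div_mul_eq_mul_div, ← Real.exp_add, ← Real.exp_add]
    exact div_le_div_of_nonneg_right (Real.exp_le_exp.mpr (by linarith)) hA.le
  rcases hx with hx | hx
  · have h1 : gaussCDF ((u + 1 : ℕ) - x) - gaussCDF (u - x) ≤ gaussCDF (-(u - x)) := by
      linarith [gaussCDF_le_one ((u + 1 : ℕ) - x), gaussCDF_add_neg (u - x)]
    refine h1.trans (key _ ?_)
    have h2 : 8 * (u : ℝ) ≤ (u - x) * (8 / ε) := by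
      rw [← mul_div_assoc, le_div_iff₀ hε]; linarith
    nlinarith
  · have h1 : gaussCDF ((u + 1 : ℕ) - x) - gaussCDF (u - x) ≤ gaussCDF (u + 1 - x) := by
      push_cast
      linarith [gaussCDF_nonneg (u - x)]
    refine h1.trans (key _ ?_)
    have h2 : u + 3 * x ≤ (x - u) * (8 / ε) := by
      rw [← mul_div_assoc, le_div_iff₀ hε]
      have h3 : ε * u ≤ x - u := by linarith
      have h5 := (mul_nonneg hε.le hu).trans h3
      have h4 : ε * (x - u) ≤ x - u := mul_le_of_le_one_left h5 hε1
      linarith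
    linarith

/-- A Dirichlet series with finitely many terms. -/
lemma LSeries_hasSum_of_forall_lt {f : ℕ → ℂ} {N : ℕ} (hf : ∀ n, N < n → f n = 0) (s : ℂ) :
    LSeriesHasSum f s (∑ n ∈ Finset.Icc 1 N, f n * (n : ℂ) ^ (-s)) := by
  have h : ∑ n ∈ Finset.Icc 1 N, f n * (n : ℂ) ^ (-s) =
      ∑ n ∈ Finset.Icc 1 N, LSeries.term f s n := by
    refine Finset.sum_congr rfl fun n hn => ?_
    rw [LSeries.term_of_ne_zero (by have := (Finset.mem_Icc.mp hn).1; omega), cpow_neg,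
      div_eq_mul_inv]
  rw [h]
  refine hasSum_sum_of_ne_finset_zero fun n hn => ?_
  rcases Nat.eq_zero_or_pos n with rfl | h0
  · simp
  · rw [LSeries.term_of_ne_zero h0.ne', hf n, zero_div]
    by_contra hc
    exact hn (Finset.mem_Icc.mpr ⟨h0, not_lt.mp hc⟩)

lemma le_of_log_le {n : ℕ} {y : ℝ} (h : Real.log n ≤ y) (hn : n ≠ 0) : n ≤ ⌊Real.exp y⌋₊ := by
  refine Nat.le_floor ?_
  rwa [← Real.log_le_iff_le_exp (by exact_mod_cast Nat.pos_of_ne_zero hn)]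

lemma LSeriesSummable_windowLambda (ε : ℝ) (u : ℕ) (s : ℂ) :
    LSeriesSummable (windowLambda ε u) s := by
  refine (LSeries_hasSum_of_forall_lt (N := ⌊Real.exp ((1 + ε) * u)⌋₊) (fun n hn => ?_) s).LSeriesSummable
  by_contra hc
  exact absurd (le_of_log_le (log_mem_of_windowLambda_ne_zero hc).2 (by omega)) (by omega)

open ArithmeticFunction in
lemma exists_norm_smoothLambda_sub_sub_windowLambda_le {ε : ℝ} (hε : 0 < ε) (hε1 : ε ≤ 1) :
    ∃ C : ℝ, 0 < C ∧ ∀ (u : ℕ) (s : ℂ), 0 ≤ s.re →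
      ‖(smoothLambda (u + 1 : ℕ) s - smoothLambda u s) - LSeries (windowLambda ε u) s‖ ≤
        C * Real.exp (-u) := by
  have hs3 := (LSeriesSummable_vonMangoldt (s := 3) (by norm_num)).norm
  set D : ℝ := Real.exp (8 / ε + (8 / ε) ^ 2) / (8 / ε) with hD
  have hD0 : 0 < D := by positivity
  set S : ℝ := ∑' n, ‖LSeries.term (fun n => (vonMangoldt n : ℂ)) 3 n‖ with hS
  have hS0 : 0 ≤ S := tsum_nonneg fun _ => norm_nonneg _
  refine ⟨D * (S + 1), by positivity, fun u s hs => ?_⟩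
  have hbd : ∀ n : ℕ, ‖LSeries.term (fun n => (vonMangoldt n : ℂ) *
      (gaussCDF ((u + 1 : ℕ) - Real.log n) : ℂ)) s n - LSeries.term (fun n => (vonMangoldt n : ℂ) *
      (gaussCDF (u - Real.log n) : ℂ)) s n - LSeries.term (windowLambda ε u) s n‖ ≤
      D * Real.exp (-u) * ‖LSeries.term (fun n => (vonMangoldt n : ℂ)) 3 n‖ := by
    intro n
    rcases Nat.eq_zero_or_pos n with rfl | hn
    · simp
    have hn0 : (0 : ℝ) < n := by exact_mod_cast hn
    rw [LSeries.term_of_ne_zero hn.ne', LSeries.term_of_ne_zero hn.ne',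
      LSeries.term_of_ne_zero hn.ne', LSeries.term_of_ne_zero hn.ne', ← sub_div, ← sub_div,
      norm_div, norm_div, norm_natCast_cpow_of_pos hn, norm_natCast_cpow_of_pos hn,
      windowLambda_apply, ← mul_sub]
    have hΛ : 0 ≤ vonMangoldt n := vonMangoldt_nonneg
    split_ifs with hc
    · have : (vonMangoldt n : ℂ) * ((gaussCDF ((u + 1 : ℕ) - Real.log n) : ℂ) -
          (gaussCDF (u - Real.log n) : ℂ)) - ((vonMangoldt n *
          (gaussCDF ((u + 1 : ℕ) - Real.log n) - gaussCDF (u - Real.log n)) : ℝ) : ℂ) = 0 := by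
        push_cast; ring
      rw [this, norm_zero, zero_div]
      positivity
    · have hx : Real.log n < (1 - ε) * u ∨ (1 + ε) * u < Real.log n := by
        by_contra hcon
        push Not at hcon
        exact hc hcon
      have h1 := gaussCDF_sub_le u hε hε1 hx
      rw [← hD] at h1
      have h3 : Real.exp (-(3 * Real.log n)) = ((n : ℝ) ^ (3 : ℂ).re)⁻¹ := by
        rw [Real.exp_neg, mul_comm, Real.exp_mul, Real.exp_log hn0]; norm_num
      rw [sub_zero, norm_mul, ← ofReal_sub, norm_real, norm_real, Real.norm_of_nonneg hΛ,
        Real.norm_of_nonneg (gaussCDF_sub_nonneg u _)]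
      have hns : 1 ≤ (n : ℝ) ^ s.re := Real.one_le_rpow (by exact_mod_cast hn) hs
      calc _ ≤ vonMangoldt n * (gaussCDF ((u + 1 : ℕ) - Real.log n) - gaussCDF (u - Real.log n)) :=
            div_le_self (mul_nonneg hΛ (gaussCDF_sub_nonneg u _)) hns
        _ ≤ vonMangoldt n * (D * Real.exp (-u) * Real.exp (-(3 * Real.log n))) := by gcongr
        _ = _ := by rw [h3]; ring
  have hsumw := LSeriesSummable_windowLambda ε u s
  have hsum := (((LSeriesSummable_smoothLambda (u + 1 : ℕ) s).hasSum.sub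
    (LSeriesSummable_smoothLambda u s).hasSum).sub hsumw.hasSum)
  have := tsum_of_norm_bounded (hs3.hasSum.mul_left (D * Real.exp (-u))) hbd
  rw [hsum.tsum_eq] at this
  refine this.trans ?_
  have h5 : 0 < Real.exp (-(u : ℝ)) := Real.exp_pos _
  nlinarith [mul_pos hD0 h5]

/-! ### Mean values of Dirichlet polynomials over lines and discs. -/

lemma sum_inv_abs_sub_le {N m : ℕ} (hm : m ∈ Finset.Icc 1 N) :
    ∑ n ∈ (Finset.Icc 1 N).erase m, (|(m : ℝ) - n|)⁻¹ ≤ 2 * (1 + Real.log N) := by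
  have hH : ∑ k ∈ Finset.Icc 1 N, ((k : ℝ))⁻¹ ≤ 1 + Real.log N := by
    have := harmonic_le_one_add_log N
    rw [harmonic_eq_sum_Icc] at this
    push_cast at this
    exact this
  rw [Finset.mem_Icc] at hm
  have key : ∀ (B : Finset ℕ) (f : ℕ → ℕ), (∀ n ∈ B, f n ∈ Finset.Icc 1 N) → Set.InjOn f B →
      (∀ n ∈ B, |(m : ℝ) - n| = f n) → ∑ n ∈ B, (|(m : ℝ) - n|)⁻¹ ≤ 1 + Real.log N := by
    intro B f h1 h2 h3
    refine le_trans ?_ hH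
    calc ∑ n ∈ B, (|(m : ℝ) - n|)⁻¹ = ∑ n ∈ B, ((f n : ℕ) : ℝ)⁻¹ :=
          Finset.sum_congr rfl fun n hn => by rw [h3 n hn]
      _ = ∑ k ∈ B.image f, (k : ℝ)⁻¹ := (Finset.sum_image (f := fun k : ℕ => (k : ℝ)⁻¹) h2).symm
      _ ≤ _ := Finset.sum_le_sum_of_subset_of_nonneg (Finset.image_subset_iff.mpr h1)
          fun _ _ _ => by positivity
  rw [← Finset.sum_filter_add_sum_filter_not _ (· < m), two_mul]
  refine add_le_add (key _ (fun n => m - n) ?_ ?_ ?_) (key _ (fun n => n - m) ?_ ?_ ?_)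
  · intro n hn
    simp only [Finset.mem_filter, Finset.mem_erase, Finset.mem_Icc] at hn ⊢
    omega
  · intro x hx y hy hxy
    simp only [Finset.coe_filter, Finset.mem_erase, Finset.mem_Icc, Set.mem_ofPred_eq] at hx hy hxy
    omega
  · intro n hn
    simp only [Finset.mem_filter, Finset.mem_erase, Finset.mem_Icc] at hn
    rw [Nat.cast_sub hn.2.le, abs_of_nonneg (sub_nonneg.mpr (by exact_mod_cast hn.2.le))]
  · intro n hn
    simp only [Finset.mem_filter, Finset.mem_erase, Finset.mem_Icc] at hn ⊢
    omega
  · intro x hx y hy hxy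
    simp only [Finset.coe_filter, Finset.mem_erase, Finset.mem_Icc, Set.mem_ofPred_eq] at hx hy hxy
    omega
  · intro n hn
    simp only [Finset.mem_filter, Finset.mem_erase, Finset.mem_Icc, not_lt] at hn
    rw [Nat.cast_sub hn.2, abs_sub_comm, abs_of_nonneg (sub_nonneg.mpr (by exact_mod_cast hn.2))]

lemma le_abs_log_sub_log {N m n : ℕ} (hm : m ∈ Finset.Icc 1 N) (hn : n ∈ Finset.Icc 1 N) :
    |(m : ℝ) - n| / N ≤ |Real.log m - Real.log n| := by
  wlog h : n ≤ m generalizing m n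
  · rw [abs_sub_comm, abs_sub_comm (Real.log m)]
    exact this hn hm (by omega)
  rw [Finset.mem_Icc] at hm hn
  have hm0 : (0 : ℝ) < m := by exact_mod_cast hm.1
  have hn0 : (0 : ℝ) < n := by exact_mod_cast hn.1
  have hmN : (m : ℝ) ≤ N := by exact_mod_cast hm.2
  have hnm : (n : ℝ) ≤ m := by exact_mod_cast h
  rw [abs_of_nonneg (by linarith), abs_of_nonneg (sub_nonneg.mpr (Real.log_le_log hn0 hnm)),
    ← Real.log_div hm0.ne' hn0.ne']
  refine le_trans ?_ (Real.one_sub_inv_le_log_of_pos (div_pos hm0 hn0))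
  rw [inv_div]
  calc ((m : ℝ) - n) / N ≤ (m - n) / m := by
        apply div_le_div_of_nonneg_left (by linarith) hm0 hmN
    _ = 1 - n / m := by field_simp

lemma norm_integral_exp_mul_I_le (a b : ℝ) {c : ℝ} (hc : c ≠ 0) :
    ‖∫ t in a..b, exp ((c * I) * t)‖ ≤ 2 / |c| := by
  have hcI : (c : ℂ) * I ≠ 0 := mul_ne_zero (ofReal_ne_zero.mpr hc) I_ne_zero
  rw [integral_exp_mul_complex hcI, norm_div, norm_mul, norm_I, mul_one, norm_real, Real.norm_eq_abs]
  gcongr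
  refine (norm_sub_le _ _).trans ?_
  have : ∀ t : ℝ, ‖exp ((c : ℂ) * I * t)‖ = 1 := by
    intro t
    rw [show (c : ℂ) * I * t = ((c * t : ℝ) : ℂ) * I by push_cast; ring, norm_exp_ofReal_mul_I]
  rw [this, this]
  norm_num

/-- **Mean value theorem for Dirichlet polynomials.** -/
lemma integral_norm_sq_sum_exp_le (d : ℕ → ℂ) (N : ℕ) {a b : ℝ} (hab : a ≤ b) :
    ∫ t in a..b, ‖∑ n ∈ Finset.Icc 1 N, d n * exp (-(t * Real.log n * I))‖ ^ 2 ≤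
      ((b - a) + 4 * N * (1 + Real.log N)) * ∑ n ∈ Finset.Icc 1 N, ‖d n‖ ^ 2 := by
  set A := Finset.Icc 1 N with hA
  set J : ℕ → ℕ → ℂ := fun m n => ∫ t in a..b, exp (((Real.log n - Real.log m : ℝ) * I) * t) with hJ
  have hexp : ((∫ t in a..b, ‖∑ n ∈ A, d n * exp (-(t * Real.log n * I))‖ ^ 2 : ℝ) : ℂ) =
      ∑ m ∈ A, ∑ n ∈ A, d m * (starRingEnd ℂ) (d n) * J m n := by
    rw [← intervalIntegral.integral_ofReal]
    have h1 : ∀ t : ℝ, ((‖∑ n ∈ A, d n * exp (-(t * Real.log n * I))‖ ^ 2 : ℝ) : ℂ) =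
        ∑ m ∈ A, ∑ n ∈ A, d m * (starRingEnd ℂ) (d n) *
          exp (((Real.log n - Real.log m : ℝ) * I) * t) := by
      intro t
      rw [ofReal_pow, ← Complex.mul_conj', map_sum, Finset.sum_mul_sum]
      refine Finset.sum_congr rfl fun m _ => Finset.sum_congr rfl fun n _ => ?_
      rw [map_mul, ← exp_conj]
      have : exp (((Real.log n - Real.log m : ℝ) * I) * t) =
          exp (-(t * Real.log m * I)) * exp ((starRingEnd ℂ) (-(t * Real.log n * I))) := by
        rw [← exp_add]
        congr 1
        simp only [map_neg, map_mul, conj_ofReal, conj_I]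
        push_cast
        ring
      rw [this]
      ring
    simp_rw [h1]
    rw [intervalIntegral.integral_finsetSum]
    · refine Finset.sum_congr rfl fun m _ => ?_
      rw [intervalIntegral.integral_finsetSum]
      · refine Finset.sum_congr rfl fun n _ => ?_
        rw [intervalIntegral.integral_const_mul]
      · intro n _
        exact Continuous.intervalIntegrable (by fun_prop) _ _
    · intro m _
      exact Continuous.intervalIntegrable (by fun_prop) _ _
  -- A symmetric majorant for the inner products of the exponentials. Since |log m - log n| ≥ |m -
  -- n|/N, bounding |d_m d_n| by the mean of the squares reduces the double sum to the row sums of w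
  -- (Schur's test).
  set w : ℕ → ℕ → ℝ := fun m n => if n = m then b - a else 2 * N * (|(m : ℝ) - n|)⁻¹ with hw
  have hw0 : ∀ m n, 0 ≤ w m n := by
    intro m n
    simp only [hw]
    split_ifs
    · linarith
    · positivity
  have hws : ∀ m n, w m n = w n m := by
    intro m n
    simp only [hw, eq_comm (a := n), abs_sub_comm (m : ℝ)]
  have hJw : ∀ m ∈ A, ∀ n ∈ A, ‖J m n‖ ≤ w m n := by
    intro m hm n hn
    simp only [hJ, hw]
    split_ifs with h
    · rw [h]
      rw [sub_self, ofReal_zero]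
      simp only [zero_mul, exp_zero, intervalIntegral.integral_const, real_smul, mul_one, norm_real]
      rw [Real.norm_of_nonneg (sub_nonneg.mpr hab)]
    · have hN : (0 : ℝ) < N := by
        rw [hA, Finset.mem_Icc] at hm; exact_mod_cast (by omega : 0 < N)
      have hmn : 0 < |(m : ℝ) - n| := abs_pos.mpr (sub_ne_zero.mpr (by exact_mod_cast Ne.symm h))
      have h1 := le_abs_log_sub_log hm hn
      have h2 : 0 < |Real.log m - Real.log n| := (div_pos hmn hN).trans_le h1
      refine (norm_integral_exp_mul_I_le a b ?_).trans ?_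
      · rw [← abs_pos, abs_sub_comm]; exact h2
      · rw [abs_sub_comm (Real.log n)]
        calc 2 / |Real.log m - Real.log n| ≤ 2 / (|(m : ℝ) - n| / N) := by gcongr
          _ = 2 * N * (|(m : ℝ) - n|)⁻¹ := by field_simp
  have hrow : ∀ m ∈ A, ∑ n ∈ A, w m n ≤ (b - a) + 4 * N * (1 + Real.log N) := by
    intro m hm
    rw [← Finset.add_sum_erase A _ hm]
    refine add_le_add (by simp [hw]) ?_
    have : ∑ n ∈ A.erase m, w m n = 2 * N * ∑ n ∈ A.erase m, (|(m : ℝ) - n|)⁻¹ := by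
      rw [Finset.mul_sum]
      refine Finset.sum_congr rfl fun n hn => ?_
      simp only [hw]
      rw [if_neg (Finset.ne_of_mem_erase hn)]
    rw [this]
    calc 2 * N * ∑ n ∈ A.erase m, (|(m : ℝ) - n|)⁻¹ ≤ 2 * N * (2 * (1 + Real.log N)) := by
          gcongr; exact sum_inv_abs_sub_le hm
      _ = _ := by ring
  have h0 : 0 ≤ ∫ t in a..b, ‖∑ n ∈ A, d n * exp (-(t * Real.log n * I))‖ ^ 2 :=
    intervalIntegral.integral_nonneg hab fun _ _ => by positivity
  calc ∫ t in a..b, ‖∑ n ∈ A, d n * exp (-(t * Real.log n * I))‖ ^ 2 =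
      ‖∑ m ∈ A, ∑ n ∈ A, d m * (starRingEnd ℂ) (d n) * J m n‖ := by
        rw [← hexp, norm_real, Real.norm_of_nonneg h0]
    _ ≤ ∑ m ∈ A, ∑ n ∈ A, (‖d m‖ ^ 2 * w m n / 2 + ‖d n‖ ^ 2 * w m n / 2) := by
      refine (norm_sum_le _ _).trans (Finset.sum_le_sum fun m hm => (norm_sum_le _ _).trans
        (Finset.sum_le_sum fun n hn => ?_))
      rw [norm_mul, norm_mul, RCLike.norm_conj]
      have h1 : ‖d m‖ * ‖d n‖ ≤ (‖d m‖ ^ 2 + ‖d n‖ ^ 2) / 2 := by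
        linarith [two_mul_le_add_sq ‖d m‖ ‖d n‖]
      calc ‖d m‖ * ‖d n‖ * ‖J m n‖ ≤ (‖d m‖ ^ 2 + ‖d n‖ ^ 2) / 2 * w m n :=
            mul_le_mul h1 (hJw m hm n hn) (norm_nonneg _) (by positivity)
        _ = _ := by ring
    _ = ∑ m ∈ A, ‖d m‖ ^ 2 * ∑ n ∈ A, w m n := by
      simp_rw [Finset.sum_add_distrib]
      rw [Finset.sum_comm (f := fun m n => ‖d n‖ ^ 2 * w m n / 2), ← Finset.sum_add_distrib]
      refine Finset.sum_congr rfl fun m _ => ?_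
      rw [← Finset.sum_add_distrib, Finset.mul_sum]
      refine Finset.sum_congr rfl fun n _ => ?_
      rw [hws n m]; ring
    _ ≤ ∑ m ∈ A, ‖d m‖ ^ 2 * ((b - a) + 4 * N * (1 + Real.log N)) :=
      Finset.sum_le_sum fun m hm => by gcongr; exact hrow m hm
    _ = _ := by rw [← Finset.sum_mul, mul_comm]

/-- Area form of the sub-mean value property. -/
lemma ofReal_mul_enorm_le_lintegral_ball {g : ℂ → ℂ} (hg : Differentiable ℂ g) (z₀ : ℂ) {R : ℝ}
    (hR : 0 < R) :
    ENNReal.ofReal (Real.pi * R ^ 2) * ‖g z₀‖ₑ ≤ ∫⁻ z in ball z₀ R, ‖g z‖ₑ := by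
  -- The mean value property on each circle; integrating against r dr in polar coordinates gives the
  -- disc.
  have hcircle : ∀ r : ℝ, ENNReal.ofReal (2 * Real.pi) * ‖g z₀‖ₑ ≤
      ∫⁻ θ in Set.Ioo (-Real.pi) Real.pi, ‖g (z₀ + r * exp (θ * I))‖ₑ := by
    intro r
    have h1 : Real.circleAverage g z₀ r = g z₀ :=
      (hg.diffContOnCl).circleAverage
    rw [Real.circleAverage, inv_smul_eq_iff₀ (by positivity)] at h1
    have hper : Function.Periodic (fun θ => g (circleMap z₀ r θ)) (2 * Real.pi) := fun θ => by
      simp only [periodic_circleMap z₀ r θ]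
    have h2 := hper.intervalIntegral_add_eq (-Real.pi) 0
    rw [zero_add, h1, show -Real.pi + 2 * Real.pi = Real.pi by ring,
      intervalIntegral.integral_of_le (by linarith [Real.pi_pos]), integral_Ioc_eq_integral_Ioo] at h2
    have h3 : ENNReal.ofReal (2 * Real.pi) * ‖g z₀‖ₑ = ‖(2 * Real.pi) • g z₀‖ₑ := by
      rw [enorm_smul, Real.enorm_of_nonneg (by positivity)]
    rw [h3, ← h2]
    exact enorm_integral_le_lintegral_enorm _
  set F : ℂ → ENNReal := fun w => (ball z₀ R).indicator (fun z => ‖g z‖ₑ) (z₀ + w) with hF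
  have hFm : Measurable F :=
    ((hg.continuous.enorm.measurable).indicator measurableSet_ball).comp (measurable_const_add z₀)
  have hpol : ∀ p : ℝ × ℝ, Complex.polarCoord.symm p = p.1 * exp (p.2 * I) := by
    intro p
    rw [Complex.polarCoord_symm_apply, exp_mul_I, ofReal_cos, ofReal_sin]
  have hmeas : Measurable fun p : ℝ × ℝ => ENNReal.ofReal p.1 • F (Complex.polarCoord.symm p) := by
    simp_rw [hpol]
    refine Measurable.mul (by fun_prop) (hFm.comp ?_)
    exact Continuous.measurable (by fun_prop)
  have hball : ∫⁻ z in ball z₀ R, ‖g z‖ₑ = ∫⁻ w, F w := by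
    rw [← lintegral_indicator measurableSet_ball, ← lintegral_add_left_eq_self _ z₀]
  have hid : ∫⁻ r in Set.Ioo 0 R, ENNReal.ofReal r = ENNReal.ofReal (R ^ 2 / 2) := by
    rw [← ofReal_integral_eq_lintegral_ofReal, ← integral_Ioc_eq_integral_Ioo,
      ← intervalIntegral.integral_of_le hR.le, integral_id]
    · congr 1; ring
    · exact (continuous_id.integrableOn_Icc (a := 0) (b := R)).mono_set Set.Ioo_subset_Icc_self
    · exact (ae_restrict_mem measurableSet_Ioo).mono fun r hr => hr.1.le
  rw [hball, ← Complex.lintegral_comp_polarCoord_symm]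
  change _ ≤ ∫⁻ p in Set.Ioi (0 : ℝ) ×ˢ Set.Ioo (-Real.pi) Real.pi, _
  rw [Measure.volume_eq_prod, ← Measure.prod_restrict, lintegral_prod _ hmeas.aemeasurable]
  calc ENNReal.ofReal (Real.pi * R ^ 2) * ‖g z₀‖ₑ
      = ∫⁻ r in Set.Ioo 0 R, ENNReal.ofReal r * (ENNReal.ofReal (2 * Real.pi) * ‖g z₀‖ₑ) := by
        rw [lintegral_mul_const _ (by fun_prop), hid, ← mul_assoc,
          ← ENNReal.ofReal_mul (by positivity)]
        congr 2; ring
    _ ≤ ∫⁻ r in Set.Ioo 0 R, ∫⁻ θ in Set.Ioo (-Real.pi) Real.pi,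
          ENNReal.ofReal r • F (Complex.polarCoord.symm (r, θ)) := by
        refine setLIntegral_mono' measurableSet_Ioo fun r hr => ?_
        have : ∀ θ : ℝ, F (Complex.polarCoord.symm (r, θ)) = ‖g (z₀ + r * exp (θ * I))‖ₑ := by
          intro θ
          rw [hF, hpol]
          refine Set.indicator_of_mem ?_ _
          rw [mem_ball, dist_eq_norm, add_sub_cancel_left, norm_mul, norm_exp_ofReal_mul_I, mul_one,
            norm_real, Real.norm_of_nonneg hr.1.le]
          exact hr.2
        simp_rw [this, smul_eq_mul]
        rw [lintegral_const_mul' _ _ ENNReal.ofReal_ne_top]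
        gcongr
        exact hcircle r
    _ ≤ _ := lintegral_mono_set Set.Ioo_subset_Ioi_self

/-- The Dirichlet polynomial with coefficients `c`. -/
noncomputable def dirichletPoly (c : ℕ → ℂ) (N : ℕ) (s : ℂ) : ℂ :=
  ∑ n ∈ Finset.Icc 1 N, c n * (n : ℂ) ^ (-s)

lemma differentiable_dirichletPoly (c : ℕ → ℂ) (N : ℕ) : Differentiable ℂ (dirichletPoly c N) := by
  refine Differentiable.fun_sum fun n hn => ?_
  have : (n : ℂ) ≠ 0 := by
    have := (Finset.mem_Icc.mp hn).1
    exact_mod_cast (by omega : n ≠ 0)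
  exact (differentiable_const _).mul (differentiable_neg.const_cpow (Or.inl this))

/-- The slack y ≤ x makes the bound uniform over all vertical lines of a strip. -/
lemma integral_norm_sq_dirichletPoly_le (c : ℕ → ℂ) (N : ℕ) {a b x y : ℝ} (hab : a ≤ b)
    (hxy : y ≤ x) :
    ∫ t in a..b, ‖dirichletPoly c N (x + t * I)‖ ^ 2 ≤
      ((b - a) + 4 * N * (1 + Real.log N)) *
        ∑ n ∈ Finset.Icc 1 N, ‖c n‖ ^ 2 * (n : ℝ) ^ (-(2 * y)) := by
  have h := integral_norm_sq_sum_exp_le (fun n => c n * ((n : ℝ) ^ (-x) : ℝ)) N hab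
  have e : ∀ t : ℝ, dirichletPoly c N (x + t * I) =
      ∑ n ∈ Finset.Icc 1 N, c n * ((n : ℝ) ^ (-x) : ℝ) * exp (-(t * Real.log n * I)) := by
    intro t
    refine Finset.sum_congr rfl fun n hn => ?_
    have h1 := (Finset.mem_Icc.mp hn).1
    have hn0 : (n : ℂ) ≠ 0 := by exact_mod_cast (by omega : n ≠ 0)
    rw [mul_assoc, neg_add, cpow_add _ _ hn0, ofReal_cpow (Nat.cast_nonneg n), cpow_def_of_ne_zero hn0 (-(t * I)),
      ← natCast_log]
    push_cast
    congr 3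
    ring
  simp_rw [e]
  refine h.trans ?_
  have hlog : 0 ≤ Real.log N := Real.log_natCast_nonneg N
  have : 0 ≤ b - a := by linarith
  gcongr with n hn
  have h1 : (1 : ℝ) ≤ n := by exact_mod_cast (Finset.mem_Icc.mp hn).1
  rw [norm_mul, mul_pow, norm_real, Real.norm_of_nonneg (by positivity), ← Real.rpow_mul_natCast (by positivity)]
  gcongr
  push_cast; linarith

lemma lintegral_reProdIm_le {F : ℂ → ENNReal} (hF : Measurable F) {x₁ x₂ a b : ℝ} {B : ENNReal}
    (h : ∀ x ∈ Set.Icc x₁ x₂, ∫⁻ t in Set.Icc a b, F (x + t * I) ≤ B) :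
    ∫⁻ z in Set.Icc x₁ x₂ ×ℂ Set.Icc a b, F z ≤ B * ENNReal.ofReal (x₂ - x₁) := by
  have hmp := Complex.volume_preserving_equiv_real_prod.symm
  rw [← hmp.setLIntegral_comp_preimage_emb measurableEquivRealProd.symm.measurableEmbedding]
  have hpre : measurableEquivRealProd.symm ⁻¹' (Set.Icc x₁ x₂ ×ℂ Set.Icc a b) =
      Set.Icc x₁ x₂ ×ˢ Set.Icc a b := by
    ext p
    simp only [Set.mem_preimage, mem_reProdIm, measurableEquivRealProd_symm_apply, Set.mem_prod]
  have hFm : Measurable fun p : ℝ × ℝ => F (measurableEquivRealProd.symm p) :=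
    hF.comp measurableEquivRealProd.symm.measurable
  rw [hpre, Measure.volume_eq_prod, ← Measure.prod_restrict, lintegral_prod _ hFm.aemeasurable]
  calc _ ≤ ∫⁻ _ in Set.Icc x₁ x₂, B := by
        refine setLIntegral_mono' measurableSet_Icc fun x hx => (le_of_eq ?_).trans (h x hx)
        refine lintegral_congr fun t => ?_
        rw [measurableEquivRealProd_symm_apply, mk_eq_add_mul_I]
    _ = _ := by rw [setLIntegral_const, Real.volume_Icc]

/-- Each |Q(s_j)|², with Q the polynomial, is at most the mean of |Q|² over the disc of radius r
about s_j. A point lies in at most H of these discs, so the sum is controlled by H times the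
integral over a rectangle, where the mean value theorem applies on every vertical line. The points
need neither spacing nor a common real part. -/
theorem sum_norm_sq_dirichletPoly_le {ι : Type*} (J : Finset ι) (s : ι → ℂ) (c : ℕ → ℂ) (N : ℕ)
    {σ a b r : ℝ} {H : ℕ} (hr : 0 < r) (hσ2 : σ ≤ 2) (hab : a ≤ b)
    (hσ : ∀ j ∈ J, σ ≤ (s j).re ∧ (s j).re ≤ 2) (him : ∀ j ∈ J, a + r ≤ (s j).im ∧ (s j).im ≤ b - r)
    (hH : ∀ t : ℝ, ∀ A ⊆ J, (∀ j ∈ A, |(s j).im - t| ≤ r) → A.card ≤ H) :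
    (∑ j ∈ J, ‖dirichletPoly c N (s j)‖ ^ 2) * (Real.pi * r ^ 2) ≤
      H * (2 + 2 * r - σ) * (((b - a) + 4 * N * (1 + Real.log N)) *
        ∑ n ∈ Finset.Icc 1 N, ‖c n‖ ^ 2 * (n : ℝ) ^ (-(2 * (σ - r)))) := by
  classical
  set Q := dirichletPoly c N with hQ
  have hQd : Differentiable ℂ Q := differentiable_dirichletPoly c N
  set D : ℝ := ((b - a) + 4 * N * (1 + Real.log N)) *
        ∑ n ∈ Finset.Icc 1 N, ‖c n‖ ^ 2 * (n : ℝ) ^ (-(2 * (σ - r))) with hD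
  have hlog : 0 ≤ Real.log N := Real.log_natCast_nonneg N
  have hba : 0 ≤ b - a := by linarith
  have hD0 : 0 ≤ D := mul_nonneg (by positivity) (Finset.sum_nonneg fun _ _ => by positivity)
  set F : ℂ → ENNReal := fun z => ‖Q z ^ 2‖ₑ with hF
  have hFm : Measurable F := (hQd.continuous.pow 2).enorm.measurable
  have hrect : ∫⁻ z in Set.Icc (σ - r) (2 + r) ×ℂ Set.Icc a b, F z ≤
      ENNReal.ofReal D * ENNReal.ofReal ((2 + r) - (σ - r)) := by
    refine lintegral_reProdIm_le hFm fun x hx => ?_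
    have h1 := integral_norm_sq_dirichletPoly_le c N hab hx.1
    rw [← hQ, intervalIntegral.integral_of_le hab, ← integral_Icc_eq_integral_Ioc] at h1
    refine le_trans (le_of_eq ?_) (ENNReal.ofReal_le_ofReal h1)
    have hc : Continuous fun t : ℝ => ‖Q (x + t * I)‖ ^ 2 := by
      have := hQd.continuous
      fun_prop
    rw [ofReal_integral_eq_lintegral_ofReal hc.integrableOn_Icc
      (Eventually.of_forall fun t => by positivity)]
    refine lintegral_congr fun t => ?_
    simp only [hF]
    rw [← ofReal_norm, norm_pow]
  have hpt : ∀ z, ∑ j ∈ J, (ball (s j) r).indicator F z ≤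
      H * (Set.Icc (σ - r) (2 + r) ×ℂ Set.Icc a b).indicator F z := by
    intro z
    set A := J.filter fun j => z ∈ ball (s j) r with hA
    have h1 : ∑ j ∈ J, (ball (s j) r).indicator F z = A.card * F z := by
      rw [hA, Finset.card_filter]
      push_cast
      rw [Finset.sum_mul]
      refine Finset.sum_congr rfl fun j _ => ?_
      simp [Set.indicator_apply]
    rw [h1]
    rcases A.eq_empty_or_nonempty with h0 | ⟨j, hj⟩
    · simp [h0]
    have hball : ∀ j ∈ A, |(s j).re - z.re| < r ∧ |(s j).im - z.im| < r := by
      intro j hj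
      have := (Finset.mem_filter.mp hj).2
      rw [mem_ball', dist_eq_norm] at this
      rw [← sub_re, ← sub_im]
      exact ⟨(abs_re_le_norm _).trans_lt this, (abs_im_le_norm _).trans_lt this⟩
    obtain ⟨b1, b2⟩ := hball j hj
    have hjJ := (Finset.mem_filter.mp hj).1
    rw [abs_lt] at b1 b2
    have hz : z ∈ Set.Icc (σ - r) (2 + r) ×ℂ Set.Icc a b := by
      rw [mem_reProdIm]
      exact ⟨⟨by linarith [hσ j hjJ], by linarith [hσ j hjJ]⟩,
        ⟨by linarith [him j hjJ], by linarith [him j hjJ]⟩⟩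
    rw [Set.indicator_of_mem hz]
    gcongr
    exact hH z.im A (Finset.filter_subset _ _) fun j hj => (hball j hj).2.le
  have hmeas : MeasurableSet (Set.Icc (σ - r) (2 + r) ×ℂ Set.Icc a b) :=
    (measurable_re measurableSet_Icc).inter (measurable_im measurableSet_Icc)
  have key : ∑ j ∈ J, ENNReal.ofReal (Real.pi * r ^ 2) * F (s j) ≤
      H * (ENNReal.ofReal D * ENNReal.ofReal ((2 + r) - (σ - r))) := by
    calc ∑ j ∈ J, ENNReal.ofReal (Real.pi * r ^ 2) * F (s j)
        ≤ ∑ j ∈ J, ∫⁻ z in ball (s j) r, F z :=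
          Finset.sum_le_sum fun j _ => ofReal_mul_enorm_le_lintegral_ball (hQd.pow 2) (s j) hr
      _ = ∫⁻ z, ∑ j ∈ J, (ball (s j) r).indicator F z := by
          rw [lintegral_finsetSum _ fun j _ => hFm.indicator measurableSet_ball]
          exact Finset.sum_congr rfl fun j _ => (lintegral_indicator measurableSet_ball _).symm
      _ ≤ ∫⁻ z, H * (Set.Icc (σ - r) (2 + r) ×ℂ Set.Icc a b).indicator F z := lintegral_mono hpt
      _ = H * ∫⁻ z in Set.Icc (σ - r) (2 + r) ×ℂ Set.Icc a b, F z := by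
          rw [lintegral_const_mul _ (hFm.indicator hmeas), lintegral_indicator hmeas]
      _ ≤ _ := by gcongr
  have hL : ∑ j ∈ J, ENNReal.ofReal (Real.pi * r ^ 2) * F (s j) =
      ENNReal.ofReal ((∑ j ∈ J, ‖Q (s j)‖ ^ 2) * (Real.pi * r ^ 2)) := by
    rw [← Finset.mul_sum, mul_comm, ENNReal.ofReal_mul (Finset.sum_nonneg fun _ _ => by positivity),
      ENNReal.ofReal_sum_of_nonneg fun _ _ => by positivity]
    congr 1
    refine Finset.sum_congr rfl fun j _ => ?_
    simp only [hF]
    rw [← norm_pow, ofReal_norm]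
  rw [hL, ← ENNReal.ofReal_mul hD0, ← ENNReal.ofReal_natCast, ← ENNReal.ofReal_mul (by positivity),
    ENNReal.ofReal_le_ofReal_iff (mul_nonneg (by positivity) (mul_nonneg hD0 (by linarith)))] at key
  refine key.trans (le_of_eq ?_)
  ring

/-! ### Powers of a block and the large values estimate. -/

/-- Induction on k from ∑_{d ∣ n} Λ(d) = log n, bounding the log of the cofactor by log n. -/
lemma norm_arithmeticFunction_pow_le {f : ArithmeticFunction ℂ}
    (hf : ∀ n, ‖f n‖ ≤ ArithmeticFunction.vonMangoldt n) (k n : ℕ) :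
    ‖(f ^ k) n‖ ≤ Real.log n ^ k := by
  induction k generalizing n with
  | zero =>
    rw [pow_zero, pow_zero, ArithmeticFunction.one_apply]
    split_ifs <;> simp
  | succ k ih =>
    rw [pow_succ, ArithmeticFunction.mul_apply]
    rcases Nat.eq_zero_or_pos n with rfl | hn
    · simp
    have hlog : Real.log n ^ (k + 1) = ∑ p ∈ n.divisorsAntidiagonal,
        Real.log n ^ k * ArithmeticFunction.vonMangoldt p.2 := by
      rw [Nat.sum_divisorsAntidiagonal' (f := fun _ e => Real.log n ^ k *
        ArithmeticFunction.vonMangoldt e), ← Finset.mul_sum, ArithmeticFunction.vonMangoldt_sum,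
        pow_succ]
    rw [hlog]
    refine (norm_sum_le _ _).trans (Finset.sum_le_sum fun p hp => ?_)
    rw [norm_mul]
    obtain ⟨h1, h2⟩ := Nat.mem_divisorsAntidiagonal.mp hp
    have hp1 : 0 < p.1 := Nat.pos_of_ne_zero fun h => h2 (by rw [← h1, h, zero_mul])
    have hle : p.1 ≤ n := Nat.divisor_le (Nat.mem_divisors.mpr ⟨⟨p.2, h1.symm⟩, h2⟩)
    refine mul_le_mul ((ih p.1).trans ?_) (hf p.2) (norm_nonneg _)
      (pow_nonneg (Real.log_natCast_nonneg n) k)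
    exact pow_le_pow_left₀ (Real.log_natCast_nonneg _) (Real.log_le_log (by exact_mod_cast hp1)
      (by exact_mod_cast hle)) k

lemma log_mem_of_arithmeticFunction_pow_ne_zero {f : ArithmeticFunction ℂ} {x y : ℝ}
    (hf : ∀ n, f n ≠ 0 → x ≤ Real.log n ∧ Real.log n ≤ y) (k n : ℕ) (h : (f ^ k) n ≠ 0) :
    k * x ≤ Real.log n ∧ Real.log n ≤ k * y := by
  induction k generalizing n with
  | zero =>
    rw [pow_zero, ArithmeticFunction.one_apply] at h
    have : n = 1 := by
      by_contra hn
      exact h (if_neg hn)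
    simp [this]
  | succ k ih =>
    rw [pow_succ, ArithmeticFunction.mul_apply] at h
    obtain ⟨p, hp, hne⟩ := Finset.exists_ne_zero_of_sum_ne_zero h
    obtain ⟨h1, h2⟩ := Nat.mem_divisorsAntidiagonal.mp hp
    have hp1 : p.1 ≠ 0 := fun h => h2 (by rw [← h1, h, zero_mul])
    have hp2 : p.2 ≠ 0 := fun h => h2 (by rw [← h1, h, mul_zero])
    have a1 := ih p.1 (left_ne_zero_of_mul hne)
    have a2 := hf p.2 (right_ne_zero_of_mul hne)
    rw [← h1, Nat.cast_mul, Real.log_mul (by exact_mod_cast hp1) (by exact_mod_cast hp2)]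
    push_cast
    constructor <;> linarith [a1.1, a1.2, a2.1, a2.2]

lemma LSeries_arithmeticFunction_pow {f : ArithmeticFunction ℂ} {s : ℂ}
    (hf : LSeriesSummable f s) (k : ℕ) :
    LSeriesSummable (f ^ k : ArithmeticFunction ℂ) s ∧
      LSeries (f ^ k : ArithmeticFunction ℂ) s = LSeries f s ^ k := by
  induction k with
  | zero =>
    rw [pow_zero, pow_zero]
    have h1 : (fun n => (1 : ArithmeticFunction ℂ) n) = LSeries.delta := by
      ext n; rw [ArithmeticFunction.one_apply]; rfl
    have := LSeries_hasSum_of_forall_lt (f := (1 : ArithmeticFunction ℂ)) (N := 1)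
      (fun n hn => by rw [ArithmeticFunction.one_apply, if_neg (by omega)]) s
    exact ⟨this.LSeriesSummable, by rw [this.LSeries_eq]; simp⟩
  | succ k ih =>
    rw [pow_succ, pow_succ]
    refine ⟨ArithmeticFunction.LSeriesSummable_mul ih.1 hf, ?_⟩
    rw [ArithmeticFunction.LSeries_mul' ih.1 hf, ih.2]

set_option maxHeartbeats 1600000 in
/-- The number of separated points where a window polynomial is large. -/
theorem exists_card_le_of_large_smoothLambda {ε : ℝ} (hε : 0 < ε) (hε1 : ε ≤ 1 / 8) :
    ∃ T₀ : ℝ, ∀ T : ℝ, T₀ ≤ T → ∀ u : ℕ, Real.log (Real.log T) ≤ ε * u → u ≤ 2 * ε * Real.log T →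
      ∀ σ : ℝ, 1 / 2 ≤ σ → σ ≤ 1 → ∀ (J : Finset ℂ) (s : ℂ → ℂ) (H : ℕ),
      (∀ j ∈ J, σ ≤ (s j).re ∧ (s j).re ≤ 2) → (∀ j ∈ J, T - 1 ≤ (s j).im ∧ (s j).im ≤ 2 * T + 1) →
      (∀ j ∈ J, Real.exp (-(ε * u)) ≤ ‖smoothLambda (u + 1 : ℕ) (s j) - smoothLambda u (s j)‖) →
      (∀ t : ℝ, ∀ A ⊆ J, (∀ j ∈ A, |(s j).im - t| ≤ ε) → A.card ≤ H) →
      (J.card : ℝ) ≤ H * T ^ (2 * (1 - σ) + 30 * ε) := by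
  obtain ⟨C, hC0, hC⟩ := exists_norm_smoothLambda_sub_sub_windowLambda_le hε (by linarith)
  have hLL : Tendsto (fun T : ℝ => Real.log (Real.log T)) atTop atTop :=
    Real.tendsto_log_atTop.comp Real.tendsto_log_atTop
  have hexpL : ∀ᶠ L : ℝ in atTop, 14 * L ≤ Real.exp (ε * L) := by
    have h1 := (isLittleO_pow_exp_pos_mul_atTop 1 hε).bound (show (0 : ℝ) < 1 / 14 by norm_num)
    filter_upwards [h1, eventually_ge_atTop 0] with L hL hL0
    rw [pow_one, Real.norm_of_nonneg hL0, Real.norm_of_nonneg (Real.exp_pos _).le] at hL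
    linarith
  have hexpε : ∀ᶠ L : ℝ in atTop, 3 / ε ^ 2 ≤ Real.exp (ε * L) :=
    (Real.tendsto_exp_atTop.comp (tendsto_id.const_mul_atTop hε)).eventually_ge_atTop _
  obtain ⟨T₀, hT₀⟩ := eventually_atTop.mp ((Real.tendsto_log_atTop.eventually
    ((hexpL.and hexpε).and (eventually_ge_atTop 2))).and ((eventually_ge_atTop 4).and
    ((hLL.eventually_ge_atTop 1).and (hLL.eventually_ge_atTop (Real.log (2 * C))))))
  refine ⟨T₀, fun T hT u hu1 hu2 σ hσ1 hσ2 J s H hre him hbig hov => ?_⟩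
  obtain ⟨⟨⟨e1, e2⟩, e3⟩, hT4, e4, e5⟩ := hT₀ T hT
  set L := Real.log T with hL
  have hT0 : 0 < T := by linarith
  have hTL : T = Real.exp L := by rw [hL, Real.exp_log hT0]
  have hu0 : (0 : ℝ) < u := by
    by_contra hc
    nlinarith
  have hεu : 1 ≤ ε * u := e4.trans hu1
  -- lower bound for the window polynomial
  have hwin : ∀ j ∈ J, Real.exp (-(2 * ε * u)) ≤ ‖LSeries (windowLambda ε u) (s j)‖ := by
    intro j hj
    have h1 := hC u (s j) (by linarith [hre j hj])
    have h2 : C * Real.exp (-u) ≤ Real.exp (-(ε * u)) / 2 := by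
      have h3 : 2 * C ≤ Real.exp (u - ε * u) := by
        rw [← Real.log_le_iff_le_exp (by positivity)]
        have : 8 * (ε * u) ≤ u := by nlinarith
        linarith
      have h4 : Real.exp (-(ε * u)) = Real.exp (u - ε * u) * Real.exp (-u) := by
        rw [← Real.exp_add]; congr 1; ring
      have := mul_le_mul_of_nonneg_right h3 (Real.exp_pos (-(u : ℝ))).le
      rw [h4]; linarith
    have h5 : Real.exp (-(2 * ε * u)) ≤ Real.exp (-(ε * u)) / 2 := by
      have h6 : Real.exp (-(2 * ε * u)) = Real.exp (-(ε * u)) * Real.exp (-(ε * u)) := by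
        rw [← Real.exp_add]; congr 1; ring
      have h7 : Real.exp (-(ε * u)) ≤ 1 / 2 := by
        have : Real.exp (-(ε * u)) ≤ Real.exp (-1) := Real.exp_le_exp.mpr (by linarith)
        linarith [Real.exp_neg_one_lt_d9]
      rw [h6]
      nlinarith [Real.exp_pos (-(ε * u))]
    have h8 := norm_sub_norm_le (smoothLambda (u + 1 : ℕ) (s j) - smoothLambda u (s j))
      (LSeries (windowLambda ε u) (s j))
    linarith [hbig j hj]
  -- the power
  obtain ⟨k, hk1, hk2⟩ : ∃ k : ℕ, L ≤ k * u ∧ k * u ≤ (1 + 2 * ε) * L := by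
    refine ⟨⌈L / u⌉₊, ?_, ?_⟩
    · exact (div_le_iff₀ hu0).mp (Nat.le_ceil _)
    · have h1 := (Nat.ceil_lt_add_one (show 0 ≤ L / u by positivity)).le
      calc (⌈L / u⌉₊ : ℝ) * u ≤ (L / u + 1) * u := by gcongr
        _ = L + u := by field_simp
        _ ≤ _ := by linarith
  have hL0 : 0 < L := by linarith
  -- The k-th power has length T^{1+O(ε)} whatever u is: ku exceeds L by at most u ≤ 2εL, and the
  -- window costs a further factor 1 + ε.
  set N : ℕ := ⌊Real.exp ((1 + 4 * ε) * L)⌋₊ with hN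
  set c : ArithmeticFunction ℂ := windowLambda ε u ^ k with hc
  have hNle : (N : ℝ) ≤ Real.exp ((1 + 4 * ε) * L) := Nat.floor_le (Real.exp_pos _).le
  have hsupp : ∀ n, c n ≠ 0 → (1 - ε) * L ≤ Real.log n ∧ Real.log n ≤ (1 + 4 * ε) * L := by
    intro n hn
    obtain ⟨h1, h2⟩ := log_mem_of_arithmeticFunction_pow_ne_zero
      (fun n hn => log_mem_of_windowLambda_ne_zero hn) k n hn
    constructor
    · calc (1 - ε) * L ≤ (1 - ε) * (k * u) := by gcongr; linarith
        _ = k * ((1 - ε) * u) := by ring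
        _ ≤ _ := h1
    · calc Real.log n ≤ k * ((1 + ε) * u) := h2
        _ = (1 + ε) * (k * u) := by ring
        _ ≤ (1 + ε) * ((1 + 2 * ε) * L) := by gcongr
        _ ≤ (1 + 4 * ε) * L := by
          rw [← mul_assoc]
          gcongr
          nlinarith
  have hpoly : ∀ z, dirichletPoly c N z = LSeries (windowLambda ε u) z ^ k := by
    intro z
    rw [← (LSeries_arithmeticFunction_pow (LSeriesSummable_windowLambda ε u z) k).2, ← hc]
    refine (LSeries_hasSum_of_forall_lt (fun n hn => ?_) z).LSeries_eq.symm
    by_contra hcn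
    exact absurd (le_of_log_le (hsupp n hcn).2 (by omega)) (by omega)
  have hQ : ∀ j ∈ J, Real.exp (-(8 * ε * L)) ≤ ‖dirichletPoly c N (s j)‖ ^ 2 := by
    intro j hj
    rw [hpoly, norm_pow, ← pow_mul]
    refine le_trans ?_ (pow_le_pow_left₀ (Real.exp_pos _).le (hwin j hj) _)
    rw [← Real.exp_nat_mul]
    refine Real.exp_le_exp.mpr ?_
    push_cast
    have h1 : k * u ≤ 2 * L := hk2.trans (by nlinarith)
    nlinarith
  -- The coefficients are at most (log n)^k ≤ L^{2k} ≤ e^{2εuk} ≤ T^{4ε}. The hypothesis log L ≤ εu,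
  -- which excludes very short blocks, is used here.
  have hcoef : ∀ n ∈ Finset.Icc 1 N, ‖c n‖ ^ 2 * (n : ℝ) ^ (-(2 * (σ - ε))) ≤
      Real.exp ((12 * ε - 2 * σ) * L) := by
    intro n hn
    by_cases hcn : c n = 0
    · rw [hcn]; simp; positivity
    obtain ⟨h1, h2⟩ := hsupp n hcn
    have hn0 : (0 : ℝ) < n := by exact_mod_cast (Finset.mem_Icc.mp hn).1
    have hlogn : 0 ≤ Real.log n := Real.log_natCast_nonneg n
    have h3 : ‖c n‖ ≤ Real.exp (4 * ε * L) := by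
      refine (norm_arithmeticFunction_pow_le (norm_windowLambda_le ε u) k n).trans ?_
      have h4 : Real.log n ≤ Real.exp (2 * (ε * u)) := by
        have h5 : Real.log n ≤ L * L := h2.trans (by gcongr; linarith)
        have h6 : L ≤ Real.exp (ε * u) := by
          rw [← Real.log_le_iff_le_exp hL0]; exact hu1
        rw [two_mul, Real.exp_add]
        exact h5.trans (by gcongr)
      refine (pow_le_pow_left₀ hlogn h4 k).trans ?_
      rw [← Real.exp_nat_mul]
      refine Real.exp_le_exp.mpr ?_
      have h1 : k * u ≤ 2 * L := hk2.trans (by nlinarith)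
      nlinarith
    have h7 : (n : ℝ) ^ (-(2 * (σ - ε))) ≤ Real.exp ((4 * ε - 2 * σ) * L) := by
      rw [Real.rpow_def_of_pos hn0]
      refine Real.exp_le_exp.mpr ?_
      have h8 : (2 * (σ - ε)) * ((1 - ε) * L) ≤ (2 * (σ - ε)) * Real.log n := by
        gcongr; linarith
      have h9 : 2 * σ - 4 * ε ≤ 2 * (σ - ε) * (1 - ε) := by nlinarith
      nlinarith
    calc ‖c n‖ ^ 2 * (n : ℝ) ^ (-(2 * (σ - ε)))
        ≤ Real.exp (4 * ε * L) ^ 2 * Real.exp ((4 * ε - 2 * σ) * L) := by gcongr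
      _ = Real.exp ((12 * ε - 2 * σ) * L) := by
        rw [← Real.exp_nat_mul, ← Real.exp_add]; congr 1; push_cast; ring
  have hmain := sum_norm_sq_dirichletPoly_le J s c N (σ := σ) (a := T - 2) (b := 2 * T + 2) (r := ε)
    (H := H) hε (by linarith) (by linarith) hre
    (fun j hj => ⟨by linarith [him j hj], by linarith [him j hj]⟩) hov
  have hS : ∑ n ∈ Finset.Icc 1 N, ‖c n‖ ^ 2 * (n : ℝ) ^ (-(2 * (σ - ε))) ≤
      Real.exp ((1 + 16 * ε - 2 * σ) * L) := by
    refine (Finset.sum_le_card_nsmul _ _ _ hcoef).trans ?_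
    rw [Nat.card_Icc, Nat.add_sub_cancel, nsmul_eq_mul]
    refine (mul_le_mul_of_nonneg_right hNle (Real.exp_pos _).le).trans (le_of_eq ?_)
    rw [← Real.exp_add]; congr 1; ring
  have hlen : (2 * T + 2 - (T - 2)) + 4 * N * (1 + Real.log N) ≤ Real.exp ((1 + 5 * ε) * L) := by
    have h1 : T ≤ Real.exp ((1 + 4 * ε) * L) := by
      rw [hTL]; exact Real.exp_le_exp.mpr (by nlinarith)
    have h2 : Real.log N ≤ 2 * L := by
      rcases Nat.eq_zero_or_pos N with h0 | h0
      · rw [h0]; simp; positivity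
      have := Real.log_le_log (by exact_mod_cast h0) hNle
      rw [Real.log_exp] at this
      nlinarith
    have h0 : 0 ≤ Real.log N := Real.log_natCast_nonneg N
    calc (2 * T + 2 - (T - 2)) + 4 * N * (1 + Real.log N)
        ≤ 2 * Real.exp ((1 + 4 * ε) * L) + 4 * Real.exp ((1 + 4 * ε) * L) * (1 + 2 * L) := by
          have : 4 * N * (1 + Real.log N) ≤ 4 * Real.exp ((1 + 4 * ε) * L) * (1 + 2 * L) := by gcongr
          linarith
      _ = Real.exp ((1 + 4 * ε) * L) * (6 + 8 * L) := by ring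
      _ ≤ Real.exp ((1 + 4 * ε) * L) * Real.exp (ε * L) := by gcongr; linarith
      _ = _ := by rw [← Real.exp_add]; congr 1; ring
  have hlow : (J.card : ℝ) * Real.exp (-(8 * ε * L)) ≤ ∑ j ∈ J, ‖dirichletPoly c N (s j)‖ ^ 2 := by
    rw [← nsmul_eq_mul]
    exact Finset.card_nsmul_le_sum _ _ _ hQ
  have hlog : 0 ≤ Real.log N := Real.log_natCast_nonneg N
  have hfin : (J.card : ℝ) * Real.exp (-(8 * ε * L)) * ε ^ 2 ≤
      H * 3 * (Real.exp ((1 + 5 * ε) * L) * Real.exp ((1 + 16 * ε - 2 * σ) * L)) := by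
    calc (J.card : ℝ) * Real.exp (-(8 * ε * L)) * ε ^ 2
        ≤ (∑ j ∈ J, ‖dirichletPoly c N (s j)‖ ^ 2) * (Real.pi * ε ^ 2) := by
          gcongr
          exact le_mul_of_one_le_left (by positivity) (by linarith [Real.pi_gt_three])
      _ ≤ _ := hmain
      _ ≤ _ := mul_le_mul (mul_le_mul_of_nonneg_left (by linarith) (Nat.cast_nonneg H))
          (mul_le_mul hlen hS (Finset.sum_nonneg fun _ _ => by positivity) (Real.exp_pos _).le)
          (mul_nonneg (add_nonneg (by linarith) (by positivity))
            (Finset.sum_nonneg fun _ _ => by positivity)) (by positivity)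
  -- Losses in units of ε: 8 for the lower bound, 5 for the mean value factor, 16 for the
  -- coefficient sum, 1 for constants.
  have hTe : T ^ (2 * (1 - σ) + 30 * ε) = Real.exp (ε * L) * Real.exp (8 * ε * L) *
      (Real.exp ((1 + 5 * ε) * L) * Real.exp ((1 + 16 * ε - 2 * σ) * L)) := by
    rw [Real.rpow_def_of_pos hT0, ← hL, ← Real.exp_add, ← Real.exp_add, ← Real.exp_add]
    congr 1; ring
  rw [hTe]
  set X := Real.exp ((1 + 5 * ε) * L) * Real.exp ((1 + 16 * ε - 2 * σ) * L) with hX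
  have hX0 : 0 < X := by positivity
  have h8 : Real.exp (-(8 * ε * L)) * Real.exp (8 * ε * L) = 1 := by
    rw [← Real.exp_add, neg_add_cancel, Real.exp_zero]
  have h9 : (J.card : ℝ) = (J.card * Real.exp (-(8 * ε * L)) * ε ^ 2) * (Real.exp (8 * ε * L) / ε ^ 2) := by
    have h10 : ε ^ 2 / ε ^ 2 = 1 := div_self (by positivity)
    calc (J.card : ℝ) = J.card * (Real.exp (-(8 * ε * L)) * Real.exp (8 * ε * L)) *
          (ε ^ 2 / ε ^ 2) := by rw [h8, h10, mul_one, mul_one]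
      _ = _ := by ring
  calc (J.card : ℝ) = _ := h9
    _ ≤ H * 3 * X * (Real.exp (8 * ε * L) / ε ^ 2) := by gcongr
    _ = H * (3 / ε ^ 2 * Real.exp (8 * ε * L) * X) := by ring
    _ ≤ _ := by gcongr

/-! ### Counting zeros and conclusion. -/

lemma riemannZeta_one_sub_conj_eq_zero {ρ : ℂ} (h : riemannZeta ρ = 0) (him : 0 < ρ.im) :
    riemannZeta (1 - (starRingEnd ℂ) ρ) = 0 := by
  have h1 : riemannZeta ((starRingEnd ℂ) ρ) = 0 := by rw [riemannZeta_conj, h, map_zero]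
  rw [riemannZeta_one_sub, h1, mul_zero]
  · intro n hn
    have := congrArg im hn
    simp at this
    linarith
  · intro hn
    have := congrArg im hn
    simp at this
    linarith

/-- The number of zeros in a short interval. -/
lemma IsLandauConstant.card_le {K τ : ℝ} (hK : IsLandauConstant K) (hτ : 10 ≤ τ) (A : Finset ℂ)
    (hA : ∀ ρ ∈ A, riemannZeta ρ = 0 ∧ 1 / 2 ≤ ρ.re ∧ |ρ.im - τ| ≤ 1 / 2) :
    (A.card : ℝ) ≤ K * Real.log τ := by
  classical
  obtain ⟨Z, g, -, h2, h3, -, -, -⟩ := hK.exists_eq τ hτ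
  refine le_trans ?_ h3
  have hsub : A ⊆ Z.toFinset := by
    intro ρ hρ
    obtain ⟨a1, a2, a3⟩ := hA ρ hρ
    rw [Multiset.mem_toFinset]
    refine h2 ρ a1 ?_
    have a4 := re_lt_one_of_riemannZeta_eq_zero a1
    -- (3/2)² + (1/2)² = 2.5 ≤ (8/5)².
    refine abs_le_of_sq_le_sq' ?_ (by norm_num) |>.2
    rw [← normSq_eq_norm_sq, normSq_apply]
    simp only [sub_re, sub_im, add_re, add_im, re_ofNat, im_ofNat, mul_re, mul_im, ofReal_re, I_re,
      ofReal_im, I_im]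
    rw [abs_le] at a3
    nlinarith
  exact_mod_cast (Finset.card_le_card hsub).trans (Multiset.toFinset_card_le Z)

lemma IsLandauConstant.card_le_of_interval {K τ : ℝ} (hK : IsLandauConstant K) (hτ : 11 ≤ τ)
    (A : Finset ℂ)
    (hA : ∀ ρ ∈ A, riemannZeta ρ = 0 ∧ 1 / 2 ≤ ρ.re ∧ |ρ.im - τ| ≤ 3 / 2) :
    (A.card : ℝ) ≤ 3 * (K * Real.log (τ + 1)) := by
  classical
  have hK1 := hK.one_le
  have hsub : A ⊆ A.filter (fun ρ => |ρ.im - (τ - 1)| ≤ 1 / 2) ∪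
      A.filter (fun ρ => |ρ.im - τ| ≤ 1 / 2) ∪ A.filter (fun ρ => |ρ.im - (τ + 1)| ≤ 1 / 2) := by
    intro ρ hρ
    have h1 := (hA ρ hρ).2.2
    simp only [Finset.mem_union, Finset.mem_filter, hρ, true_and]
    rw [abs_le] at h1
    by_cases c1 : ρ.im ≤ τ - 1 / 2
    · left; left; rw [abs_le]; constructor <;> linarith
    · by_cases c2 : ρ.im ≤ τ + 1 / 2
      · left; right; rw [abs_le]; constructor <;> linarith
      · right; rw [abs_le]; constructor <;> linarith
  have key : ∀ x : ℝ, 10 ≤ x → x ≤ τ + 1 →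
      ((A.filter (fun ρ => |ρ.im - x| ≤ 1 / 2)).card : ℝ) ≤ K * Real.log (τ + 1) := by
    intro x hx hx1
    refine (hK.card_le hx _ fun ρ hρ => ?_).trans (by gcongr)
    obtain ⟨b1, b2⟩ := Finset.mem_filter.mp hρ
    exact ⟨(hA ρ b1).1, (hA ρ b1).2.1, b2⟩
  have hc := (Finset.card_le_card hsub).trans ((Finset.card_union_le _ _).trans
    (add_le_add_left (Finset.card_union_le _ _) _))
  have hc' : (A.card : ℝ) ≤ (A.filter (fun ρ => |ρ.im - (τ - 1)| ≤ 1 / 2)).card +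
      (A.filter (fun ρ => |ρ.im - τ| ≤ 1 / 2)).card +
      (A.filter (fun ρ => |ρ.im - (τ + 1)| ≤ 1 / 2)).card := by exact_mod_cast hc
  linarith [key (τ - 1) (by linarith) (by linarith), key τ (by linarith) (by linarith),
    key (τ + 1) (by linarith) le_rfl]

/-- The total number of zeros on the right of the critical line. -/
lemma IsLandauConstant.card_le_of_half_le {K T : ℝ} (hK : IsLandauConstant K) (hT : 11 ≤ T)
    (A : Finset ℂ)
    (hA : ∀ ρ ∈ A, riemannZeta ρ = 0 ∧ 1 / 2 ≤ ρ.re ∧ T ≤ ρ.im ∧ ρ.im ≤ 2 * T) :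
    (A.card : ℝ) ≤ (T + 1) * (3 * (K * Real.log (3 * T))) := by
  have hK1 := hK.one_le
  have hmaps : ∀ ρ ∈ A, ⌊ρ.im - T⌋₊ ∈ Finset.range (⌊T⌋₊ + 1) := by
    intro ρ hρ
    rw [Finset.mem_range, Nat.lt_succ_iff]
    exact Nat.floor_le_floor (by linarith [hA ρ hρ])
  have hfib : ∀ m ∈ Finset.range (⌊T⌋₊ + 1),
      ((A.filter fun ρ => ⌊ρ.im - T⌋₊ = m).card : ℝ) ≤ 3 * (K * Real.log (3 * T)) := by
    intro m hm
    have hm' : (m : ℝ) ≤ T := by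
      rw [Finset.mem_range, Nat.lt_succ_iff] at hm
      exact (Nat.cast_le.mpr hm).trans (Nat.floor_le (by linarith))
    refine (hK.card_le_of_interval (τ := T + m) (by linarith [Nat.cast_nonneg (α := ℝ) m]) _
      fun ρ hρ => ?_).trans ?_
    · obtain ⟨b1, b2⟩ := Finset.mem_filter.mp hρ
      obtain ⟨c1, c2, c3, c4⟩ := hA ρ b1
      have d1 := Nat.floor_le (show 0 ≤ ρ.im - T by linarith)
      have d2 := Nat.lt_floor_add_one (ρ.im - T)
      rw [b2] at d1 d2
      exact ⟨c1, c2, abs_le.mpr ⟨by linarith, by linarith⟩⟩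
    · have : 0 < T + m + 1 := by positivity
      gcongr
      linarith
  rw [Finset.card_eq_sum_card_fiberwise hmaps]
  push_cast
  refine (Finset.sum_le_card_nsmul _ _ _ hfib).trans ?_
  rw [Finset.card_range, nsmul_eq_mul]
  have hlog : 0 ≤ Real.log (3 * T) := Real.log_nonneg (by linarith)
  have := Nat.floor_le (show 0 ≤ T by linarith)
  gcongr
  push_cast
  linarith

/-- The reflection ρ ↦ 1 - ρ̄ preserves zeros and heights and is injective, so zeros left of the
critical line are counted on the right. -/
lemma IsLandauConstant.card_le_of_mem_Icc {K T : ℝ} (hK : IsLandauConstant K) (hT : 11 ≤ T)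
    (A : Finset ℂ) (hA : ∀ ρ ∈ A, riemannZeta ρ = 0 ∧ T ≤ ρ.im ∧ ρ.im ≤ 2 * T) :
    (A.card : ℝ) ≤ 2 * ((T + 1) * (3 * (K * Real.log (3 * T)))) := by
  classical
  have h1 := hK.card_le_of_half_le hT (A.filter fun ρ => 1 / 2 ≤ ρ.re) fun ρ hρ => by
    obtain ⟨b1, b2⟩ := Finset.mem_filter.mp hρ
    exact ⟨(hA ρ b1).1, b2, (hA ρ b1).2⟩
  have h2 := hK.card_le_of_half_le hT
    ((A.filter fun ρ => ¬ 1 / 2 ≤ ρ.re).image fun ρ => 1 - (starRingEnd ℂ) ρ) fun ρ hρ => by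
    obtain ⟨ρ', hρ', rfl⟩ := Finset.mem_image.mp hρ
    obtain ⟨b1, b2⟩ := Finset.mem_filter.mp hρ'
    obtain ⟨c1, c2, c3⟩ := hA ρ' b1
    rw [not_le] at b2
    refine ⟨riemannZeta_one_sub_conj_eq_zero c1 (by linarith), ?_, ?_, ?_⟩ <;> simp <;> linarith
  rw [Finset.card_image_of_injective _ fun x y hxy =>
    (starRingEnd ℂ).injective (by simpa using hxy)] at h2
  rw [← Finset.card_filter_add_card_filter_not (p := fun ρ : ℂ => 1 / 2 ≤ ρ.re)]
  push_cast
  linarith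

lemma finite_halfIsolatedZeros {σ T : ℝ} (hT : 0 < T) : (halfIsolatedZeros σ T).Finite := by
  have hc : IsCompact (Set.Icc (0 : ℝ) 1 ×ℂ Set.Icc T (2 * T)) :=
    isCompact_Icc.reProdIm isCompact_Icc
  refine hc.inter_riemannZetaZeros_finite.subset fun ρ hρ => ?_
  obtain ⟨⟨Y, -, -, hY⟩, -, him⟩ := hρ
  have h0 := hY.2.1
  have h1 := re_lt_one_of_riemannZeta_eq_zero h0
  have h2 := re_lt_one_of_riemannZeta_eq_zero
    (riemannZeta_one_sub_conj_eq_zero h0 (hT.trans_le him.1))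
  simp at h2
  exact ⟨mem_reProdIm.mpr ⟨⟨h2.le, h1.le⟩, him⟩, h0⟩

lemma IsHalfIsolatedZero.riemannZeta_eq_zero {ρ : ℂ} (h : IsHalfIsolatedZero ρ) :
    riemannZeta ρ = 0 := by
  obtain ⟨Y, -, -, hY⟩ := h
  exact hY.2.1

theorem exists_ncard_halfIsolatedZeros_le {ε : ℝ} (hε : 0 < ε) (hε1 : ε ≤ 1 / 8) :
    ∃ T₀ : ℝ, ∀ T : ℝ, T₀ ≤ T → ∀ σ : ℝ,
      ((halfIsolatedZeros σ T).ncard : ℝ) ≤ T ^ (2 * (1 - σ) + 31 * ε) := by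
  classical
  obtain ⟨K, hK⟩ := exists_isLandauConstant
  have hK1 := hK.one_le
  obtain ⟨G, hG⟩ := exists_large_smoothLambda_of_isHalfIsolatedZero hε (by linarith)
  obtain ⟨T₁, hT₁⟩ := exists_card_le_of_large_smoothLambda hε hε1
  have hsq : ∀ᶠ L : ℝ in atTop, 14 * K * L ^ 2 ≤ Real.exp (ε * L) := by
    have h1 := (isLittleO_pow_exp_pos_mul_atTop 2 hε).bound
      (show (0 : ℝ) < 1 / (14 * K) by positivity)
    filter_upwards [h1] with L hL
    rw [Real.norm_of_nonneg (by positivity), Real.norm_of_nonneg (Real.exp_pos _).le,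
      one_div, ← div_eq_inv_mul, le_div_iff₀ (by positivity)] at hL
    linarith
  obtain ⟨T₂, hT₂⟩ := eventually_atTop.mp ((Real.tendsto_log_atTop.eventually
    (hsq.and (eventually_ge_atTop 2))).and (eventually_ge_atTop 20))
  refine ⟨max (max G T₁) T₂, fun T hT σ => ?_⟩
  have hTG : G ≤ T := (le_max_left _ _).trans ((le_max_left _ _).trans hT)
  have hTT₁ : T₁ ≤ T := (le_max_right _ _).trans ((le_max_left _ _).trans hT)
  obtain ⟨⟨e1, e2⟩, e3⟩ := hT₂ T ((le_max_right _ _).trans hT)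
  set L := Real.log T with hL
  have hT0 : 0 < T := by linarith
  have hlog3 : Real.log (3 * T) ≤ 2 * L := by
    rw [Real.log_mul (by norm_num) hT0.ne']
    have : Real.log 3 ≤ L := Real.log_le_log (by norm_num) (by linarith)
    linarith
  have hTε : T ^ ε = Real.exp (ε * L) := by rw [Real.rpow_def_of_pos hT0, mul_comm]
  obtain ⟨J, hJ⟩ := (finite_halfIsolatedZeros (σ := σ) hT0).exists_finset_coe
  rw [← hJ, Set.ncard_coe_finset]
  have hmem : ∀ ρ ∈ J, IsHalfIsolatedZero ρ ∧ σ ≤ ρ.re ∧ T ≤ ρ.im ∧ ρ.im ≤ 2 * T := by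
    intro ρ hρ
    have : ρ ∈ halfIsolatedZeros σ T := by rw [← hJ]; exact hρ
    exact ⟨this.1, this.2.1, this.2.2.1, this.2.2.2⟩
  -- For σ < 1/2 the exponent exceeds 1 and the bound O(T log T) for all zeros suffices; for σ > 1
  -- there are none. Detection is needed only in between.
  rcases lt_or_ge σ (1 / 2) with hσ | hσ
  · have h1 := hK.card_le_of_mem_Icc (by linarith) J fun ρ hρ =>
      ⟨(hmem ρ hρ).1.riemannZeta_eq_zero, (hmem ρ hρ).2.2⟩
    have h2 : T ^ (1 + ε) ≤ T ^ (2 * (1 - σ) + 31 * ε) :=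
      Real.rpow_le_rpow_of_exponent_le (by linarith) (by linarith)
    refine h1.trans (le_trans ?_ h2)
    rw [Real.rpow_add hT0, Real.rpow_one, hTε]
    have hlog0 : 0 ≤ Real.log (3 * T) := Real.log_nonneg (by linarith)
    calc 2 * ((T + 1) * (3 * (K * Real.log (3 * T)))) ≤ 2 * ((T + T / 20) * (3 * (K * (2 * L)))) := by
          gcongr; linarith
      _ = T * (12.6 * K * L) := by ring
      _ ≤ T * (14 * K * L ^ 2) := by
          refine mul_le_mul_of_nonneg_left ?_ hT0.le
          have : 0 ≤ K * L := by positivity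
          nlinarith
      _ ≤ _ := by gcongr
  rcases lt_or_ge 1 σ with hσ1 | hσ1
  · have : J = ∅ := by
      rw [Finset.eq_empty_iff_forall_notMem]
      intro ρ hρ
      have := re_lt_one_of_riemannZeta_eq_zero (hmem ρ hρ).1.riemannZeta_eq_zero
      linarith [(hmem ρ hρ).2.1]
    rw [this]
    simp
    positivity
  have hdet : ∀ ρ ∈ J, ∃ u : ℕ, ∃ s : ℂ, Real.log L ≤ ε * u ∧ u ≤ 2 * ε * L ∧ ρ.re ≤ s.re ∧
      s.re ≤ 2 ∧ |s.im - ρ.im| ≤ 1 ∧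
      Real.exp (-(ε * u)) ≤ ‖smoothLambda (u + 1 : ℕ) s - smoothLambda u s‖ := by
    intro ρ hρ
    obtain ⟨a1, a2, a3, a4⟩ := hmem ρ hρ
    obtain ⟨u, b1, b2, s, b3, b4, b5, b6⟩ := hG ρ a1 (hTG.trans a3) (hσ.trans a2)
    have c1 : L ≤ Real.log ρ.im := Real.log_le_log hT0 a3
    have c2 : Real.log ρ.im ≤ 2 * L :=
      (Real.log_le_log (by linarith) (by linarith)).trans hlog3
    refine ⟨u, s, (Real.log_le_log (by linarith) c1).trans b1, b2.trans ?_, b3, b4, b5, b6⟩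
    calc ε * Real.log ρ.im ≤ ε * (2 * L) := by gcongr
      _ = _ := by ring
  choose! u s d1 d2 d3 d4 d5 d6 using hdet
  -- Detected points within ε of a height come from zeros within 1 + ε ≤ 3/2 of it, and there are at
  -- most 6KL of those.
  set H : ℕ := ⌈6 * K * L⌉₊ with hH
  have hH7 : (H : ℝ) ≤ 7 * K * L := by
    have := (Nat.ceil_lt_add_one (show 0 ≤ 6 * K * L by positivity)).le
    have h1 : 1 ≤ K * L := one_le_mul_of_one_le_of_one_le hK1 (by linarith)
    linarith
  have hmaps : ∀ ρ ∈ J, u ρ ∈ Finset.range (⌊L⌋₊ + 1) := by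
    intro ρ hρ
    rw [Finset.mem_range, Nat.lt_succ_iff]
    refine Nat.le_floor ((d2 ρ hρ).trans ?_)
    exact mul_le_of_le_one_left (by linarith) (by linarith)
  have hfib : ∀ m ∈ Finset.range (⌊L⌋₊ + 1), ((J.filter fun ρ => u ρ = m).card : ℝ) ≤
      7 * K * L * T ^ (2 * (1 - σ) + 30 * ε) := by
    intro m _
    rcases (J.filter fun ρ => u ρ = m).eq_empty_or_nonempty with h0 | ⟨ρ₀, hρ₀⟩
    · rw [h0]; simp; positivity
    obtain ⟨hρ₀J, rfl⟩ := Finset.mem_filter.mp hρ₀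
    have hsub : ∀ ρ ∈ J.filter fun ρ => u ρ = u ρ₀, ρ ∈ J ∧ u ρ = u ρ₀ := fun ρ hρ =>
      Finset.mem_filter.mp hρ
    refine (hT₁ T hTT₁ (u ρ₀) (d1 ρ₀ hρ₀J) (d2 ρ₀ hρ₀J) σ hσ hσ1 (J.filter fun ρ => u ρ = u ρ₀) s H
      ?_ ?_ ?_ ?_).trans (by gcongr)
    · intro ρ hρ
      obtain ⟨b1, b2⟩ := hsub ρ hρ
      exact ⟨(hmem ρ b1).2.1.trans (d3 ρ b1), d4 ρ b1⟩
    · intro ρ hρ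
      obtain ⟨b1, b2⟩ := hsub ρ hρ
      have := abs_le.mp (d5 ρ b1)
      constructor <;> linarith [(hmem ρ b1).2.2.1, (hmem ρ b1).2.2.2]
    · intro ρ hρ
      obtain ⟨b1, b2⟩ := hsub ρ hρ
      have := d6 ρ b1
      rwa [b2] at this
    · intro t A hA ht
      rcases A.eq_empty_or_nonempty with h0 | ⟨ρ₁, hρ₁⟩
      · simp [h0]
      have hA' : ∀ ρ ∈ A, riemannZeta ρ = 0 ∧ 1 / 2 ≤ ρ.re ∧ |ρ.im - t| ≤ 3 / 2 := by
        intro ρ hρ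
        obtain ⟨b1, b2⟩ := hsub ρ (hA hρ)
        have c1 := abs_le.mp (d5 ρ b1)
        have c2 := abs_le.mp (ht ρ hρ)
        exact ⟨(hmem ρ b1).1.riemannZeta_eq_zero, hσ.trans (hmem ρ b1).2.1,
          abs_le.mpr ⟨by linarith, by linarith⟩⟩
      have c1 := abs_le.mp (hA' ρ₁ hρ₁).2.2
      have c2 := hmem ρ₁ (hsub ρ₁ (hA hρ₁)).1
      have h1 := hK.card_le_of_interval (τ := t) (by linarith) A hA'
      have h2 : Real.log (t + 1) ≤ 2 * L :=
        (Real.log_le_log (by linarith) (by linarith)).trans hlog3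
      rw [hH]
      refine Nat.cast_le (α := ℝ).mp (le_trans (h1.trans ?_) (Nat.le_ceil _))
      calc 3 * (K * Real.log (t + 1)) ≤ 3 * (K * (2 * L)) := by gcongr
        _ = _ := by ring
  rw [Finset.card_eq_sum_card_fiberwise hmaps]
  push_cast
  refine (Finset.sum_le_card_nsmul _ _ _ hfib).trans ?_
  rw [Finset.card_range, nsmul_eq_mul]
  have hfl := Nat.floor_le (show 0 ≤ L by linarith)
  -- Summing over the at most 2L values of u, with overlap 7KL, costs 14KL² ≤ T^ε.
  calc ((⌊L⌋₊ + 1 : ℕ) : ℝ) * (7 * K * L * T ^ (2 * (1 - σ) + 30 * ε))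
      ≤ (2 * L) * (7 * K * L * T ^ (2 * (1 - σ) + 30 * ε)) := by
        gcongr; push_cast; linarith
    _ = (14 * K * L ^ 2) * T ^ (2 * (1 - σ) + 30 * ε) := by ring
    _ ≤ T ^ ε * T ^ (2 * (1 - σ) + 30 * ε) := by rw [hTε]; gcongr
    _ = _ := by rw [← Real.rpow_add hT0]; congr 1; ring

theorem corollary5 :
    ∃ δ : ℝ → ℝ, Filter.Tendsto δ Filter.atTop (nhds 0) ∧
      ∀ᶠ T : ℝ in Filter.atTop, ∀ σ : ℝ,
        (halfIsolatedZeros σ T).Finite ∧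
          ((halfIsolatedZeros σ T).ncard : ℝ) ≤ T ^ (2 * (1 - σ) + δ T) := by
  set S : ℝ → Set ℝ := fun T => {e | 0 < e ∧ ∀ σ : ℝ,
    ((halfIsolatedZeros σ T).ncard : ℝ) ≤ T ^ (2 * (1 - σ) + e)} with hS
  have hbdd : ∀ T, BddBelow (S T) := fun T => ⟨0, fun e he => he.1.le⟩
  have hev : ∀ η : ℝ, 0 < η → ∀ᶠ T in atTop, ∃ e ∈ S T, e ≤ η := by
    intro η hη
    have h1 : 0 < min (η / 31) (1 / 8) := by positivity
    obtain ⟨T₀, hT₀⟩ := exists_ncard_halfIsolatedZeros_le h1 (min_le_right _ _)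
    filter_upwards [eventually_ge_atTop T₀] with T hT
    refine ⟨31 * min (η / 31) (1 / 8), ⟨by positivity, hT₀ T hT⟩, ?_⟩
    linarith [min_le_left (η / 31) (1 / 8)]
  -- The smallest exponent error valid for all σ at once tends to 0, since it is eventually below
  -- any η > 0. Adding T⁻¹ avoids having to attain the infimum.
  refine ⟨fun T => sInf (S T) + T⁻¹, ?_, ?_⟩
  · rw [← add_zero (0 : ℝ)]
    refine Tendsto.add ?_ tendsto_inv_atTop_zero
    refine tendsto_order.mpr ⟨fun a ha => Eventually.of_forall fun T =>
      ha.trans_le (Real.sInf_nonneg fun e he => he.1.le), fun a ha => ?_⟩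
    filter_upwards [hev (a / 2) (by linarith)] with T ⟨e, he, hea⟩
    exact (csInf_le (hbdd T) he).trans_lt (by linarith)
  · filter_upwards [hev 1 one_pos, eventually_ge_atTop 1] with T ⟨e, he, _⟩ hT σ
    refine ⟨finite_halfIsolatedZeros (by linarith), ?_⟩
    obtain ⟨e', he', hlt⟩ := exists_lt_of_csInf_lt ⟨e, he⟩
      (show sInf (S T) < sInf (S T) + T⁻¹ by linarith [inv_pos.mpr (show 0 < T by linarith)])
    exact (he'.2 σ).trans (Real.rpow_le_rpow_of_exponent_le hT (by linarith))
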